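/- Let $\Omega\subset\mathbb R^3$ be a bounded domain (open, connected, nonempty) with $C^\infty$ boundary, with unit outward normal $\mathbf n$ and surface measure $d\sigma$ on $\partial\Omega$. $H^1(\Omega)$ carries the norm $\|w\|=\bigl(\|\nabla w\|_{L^2}^2+|\overline w|^2\bigr)^{1/2}$, where $\overline w$ is the average of $w$ over $\Omega$, and $H^{1/2}(\partial\Omega)$ is the space of traces of functions in $H^1(\Omega)$, with norm $\|\alpha\|_{H^{1/2}(\partial\Omega)}=\inf\{\|w\| : w\in H^1(\Omega),\ w|_{\partial\Omega}=\alpha\}$. For $\alpha\in H^{1/2}(\partial\Omega)$ let $\chi_\alpha$ be the unique weak solution of $$\Delta\chi=\frac1{|\Omega|}\int_{\partial\Omega}\alpha\,d\sigma\ \text{ in }\Omega,\qquad \frac{\partial\chi}{\partial\mathbf n}=\alpha\ \text{ on }\partial\Omega,\qquad \int_\Omega\chi\,dx=0 .$$ There exist constants $\kappa,s\in(0,\infty)$, depending only on $\Omega$, such that $$\|\chi_\alpha\|_{L^\infty(\Omega)}\le\kappa\,\|\alpha\|_{H^{1/2}(\partial\Omega)}\ \ \forall\,\alpha\in H^{1/2}(\partial\Omega),\qquad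 \|u\|_{L^3(\Omega)}\le s\,\|\nabla u\|_{L^2(\Omega)}\ \ \forall\,u\in H^1_0(\Omega). \tag{1}$$ Take any such $\kappa,s$ and set $\delta=1/(\kappa s)$. Let $m\in\mathbb R$, $q\in L^6(\Omega)\setminus\{0\}$ and $\alpha\in H^{1/2}(\partial\Omega)$ satisfy $$\int_{\partial\Omega}\alpha\,d\sigma=0\qquad\text{and}\qquad \|q\|_{L^6(\Omega)}\,\|\alpha\|_{H^{1/2}(\partial\Omega)}<\delta .$$ Then the problem $$\Delta u=m^2u-(q\phi)^2u,\quad \Delta\phi=(qu)^2\phi\ \text{ in }\Omega,\qquad u=0,\quad \frac{\partial\phi}{\partial\mathbf n}=\alpha\ \text{ on }\partial\Omega$$ has no nontrivial solutions: every weak solution $(u,\phi)\in H^1_0(\Omega)\times H^1(\Omega)$ has $u=0$. Here $(u,\phi)$ is a weak solution if $$\int_\Omega\bigl(\nabla u\cdot\nabla v+(m^2-(q\phi)^2)\,u\,v\bigr)\,dx=0\ \ \forall\,v\in H^1_0(\Omega),\qquad \int_\Omega\bigl(\nabla\phi\cdot\nabla\psi+(qu)^2\phi\,\psi\bigr)\,dx=\int_{\partial\Omega}\alpha\,\psi\,d\sigma\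 \ \forall\,\psi\in H^1(\Omega).$$ -/

import Mathlib

open MeasureTheory Filter Topology
open scoped ENNReal ContDiff

noncomputable section

namespace KGM

/-- Euclidean three-space. -/
abbrev E3 : Type := EuclideanSpace ℝ (Fin 3)

/-- A bounded domain (nonempty, open, connected) of class `C^∞`: near each boundary point, and after
an orthogonal change of coordinates, `Ω` is the region above the graph of a smooth function. -/
structure IsSmoothBoundedDomain (Ω : Set E3) : Prop where
  isOpen : IsOpen Ω
  isConnected : IsConnected Ω
  isBounded : Bornology.IsBounded Ω
  smooth_boundary : ∀ p ∈ frontier Ω, ∃ r : ℝ, 0 < r ∧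
    ∃ (L : E3 ≃ₗᵢ[ℝ] E3) (γ : EuclideanSpace ℝ (Fin 2) → ℝ), ContDiff ℝ ∞ γ ∧
      ∀ x ∈ Metric.ball p r, (x ∈ Ω ↔ γ !₂[L x 0, L x 1] < L x 2)

/-- Lebesgue measure on `Ω`. -/
def vol (Ω : Set E3) : Measure E3 := volume.restrict Ω

/-- Surface measure on `∂Ω`: the two-dimensional Hausdorff measure, normalized so as to agree with
Lebesgue measure on planes. -/
def surf (Ω : Set E3) : Measure E3 :=
  (Measure.euclideanHausdorffMeasure 2 : Measure E3).restrict (frontier Ω)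

/-- Test functions: smooth, with compact support contained in `Ω`. -/
def IsTestFunction (Ω : Set E3) (f : E3 → ℝ) : Prop :=
  ContDiff ℝ ∞ f ∧ HasCompactSupport f ∧ tsupport f ⊆ Ω

/-- `u ∈ H¹(Ω)` with weak gradient `Du`. -/
structure MemH1 (Ω : Set E3) (u : E3 → ℝ) (Du : E3 → E3) : Prop where
  memLp : MemLp u 2 (vol Ω)
  memLp_grad : MemLp Du 2 (vol Ω)
  weak_grad : ∀ f : E3 → ℝ, IsTestFunction Ω f →
    ∫ x, u x • gradient f x ∂(vol Ω) = - ∫ x, f x • Du x ∂(vol Ω)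

/-- The functions `f n` (assumed smooth) converge to `u`, with weak gradient `Du`, in `H¹(Ω)`. -/
def TendstoH1 (Ω : Set E3) (f : ℕ → E3 → ℝ) (u : E3 → ℝ) (Du : E3 → E3) : Prop :=
  Tendsto (fun n => eLpNorm (fun x => f n x - u x) 2 (vol Ω)) atTop (𝓝 0) ∧
  Tendsto (fun n => eLpNorm (fun x => gradient (f n) x - Du x) 2 (vol Ω)) atTop (𝓝 0)

/-- `u ∈ H¹₀(Ω)` with weak gradient `Du`: `u` lies in the `H¹`-closure of the test functions. -/
def MemH10 (Ω : Set E3) (u : E3 → ℝ) (Du : E3 → E3) : Prop :=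
  MemH1 Ω u Du ∧ ∃ f : ℕ → E3 → ℝ, (∀ n, IsTestFunction Ω (f n)) ∧ TendstoH1 Ω f u Du

/-- `g ∈ L²(∂Ω)` is the trace on `∂Ω` of `w ∈ H¹(Ω)`, whose weak gradient is `Dw`: some functions
smooth up to the boundary converge to `w` in `H¹(Ω)` and their restrictions to `∂Ω` converge to `g`
in `L²(∂Ω)`. -/
def HasTrace (Ω : Set E3) (w : E3 → ℝ) (Dw : E3 → E3) (g : E3 → ℝ) : Prop :=
  MemH1 Ω w Dw ∧ MemLp g 2 (surf Ω) ∧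
  ∃ f : ℕ → E3 → ℝ, (∀ n, ContDiff ℝ ∞ (f n)) ∧ TendstoH1 Ω f w Dw ∧
    Tendsto (fun n => eLpNorm (fun x => f n x - g x) 2 (surf Ω)) atTop (𝓝 0)

/-- The norm `(‖∇w‖₂² + |w̄|²)^{1/2}` of `H¹(Ω)`, where `w̄` is the average of `w` in `Ω`. -/
def normH1 (Ω : Set E3) (w : E3 → ℝ) (Dw : E3 → E3) : ℝ :=
  Real.sqrt ((∫ x, ‖Dw x‖ ^ 2 ∂(vol Ω)) + (⨍ x, w x ∂(vol Ω)) ^ 2)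

/-- `α ∈ H^{1/2}(∂Ω)`, the space of traces of functions in `H¹(Ω)`. -/
def MemHhalf (Ω : Set E3) (α : E3 → ℝ) : Prop :=
  ∃ (w : E3 → ℝ) (Dw : E3 → E3), HasTrace Ω w Dw α

/-- The (quotient) norm of `H^{1/2}(∂Ω)`. -/
def normHhalf (Ω : Set E3) (α : E3 → ℝ) : ℝ :=
  sInf {r : ℝ | ∃ (w : E3 → ℝ) (Dw : E3 → E3), HasTrace Ω w Dw α ∧ r = normH1 Ω w Dw}

/-- `(u, φ)` is a weak solution of
`Δu = m² u - (q φ)² u` and `Δφ = (q u)² φ` in `Ω`, `u = 0` and `∂φ/∂n = α` on `∂Ω`. -/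
def IsWeakSolution (Ω : Set E3) (m : ℝ) (q α : E3 → ℝ) (u φ : E3 → ℝ) : Prop :=
  ∃ Du Dφ : E3 → E3, MemH10 Ω u Du ∧ MemH1 Ω φ Dφ ∧
    (∀ (v : E3 → ℝ) (Dv : E3 → E3), MemH10 Ω v Dv →
      (∫ x, inner ℝ (Du x) (Dv x) ∂(vol Ω)) +
        ∫ x, (m ^ 2 * u x - (q x * φ x) ^ 2 * u x) * v x ∂(vol Ω) = 0) ∧
    (∀ (ψ : E3 → ℝ) (Dψ : E3 → E3) (g : E3 → ℝ), HasTrace Ω ψ Dψ g →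
      (∫ x, inner ℝ (Dφ x) (Dψ x) ∂(vol Ω)) +
        ∫ x, (q x * u x) ^ 2 * φ x * ψ x ∂(vol Ω) = ∫ x, α x * g x ∂(surf Ω))

/-- `χ` is the (weak) solution of `Δχ = A / |Ω|` in `Ω`, `∂χ/∂n = α` on `∂Ω`, `∫_Ω χ = 0`,
where `A = ∫_{∂Ω} α`. -/
def IsNeumannPotential (Ω : Set E3) (α : E3 → ℝ) (χ : E3 → ℝ) : Prop :=
  ∃ Dχ : E3 → E3, MemH1 Ω χ Dχ ∧ ∫ x, χ x ∂(vol Ω) = 0 ∧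
    ∀ (ψ : E3 → ℝ) (Dψ : E3 → E3) (g : E3 → ℝ), HasTrace Ω ψ Dψ g →
      (∫ x, inner ℝ (Dχ x) (Dψ x) ∂(vol Ω)) +
        ∫ x, ((∫ y, α y ∂(surf Ω)) / volume.real Ω) * ψ x ∂(vol Ω) =
          ∫ x, α x * g x ∂(surf Ω)

/-- `κ` bounds the sup norm of the Neumann potential: `‖χ‖_∞ ≤ κ ‖α‖_{H^{1/2}(∂Ω)}`. -/
def IsNeumannBound (Ω : Set E3) (κ : ℝ) : Prop :=
  ∀ α χ : E3 → ℝ, MemHhalf Ω α → IsNeumannPotential Ω α χ →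
    eLpNorm χ ∞ (vol Ω) ≤ ENNReal.ofReal (κ * normHhalf Ω α)

/-- `σ` is a constant for the embedding of `H¹₀(Ω)` in `L³(Ω)`: `‖u‖₃ ≤ σ ‖∇u‖₂`. -/
def IsSobolevBound (Ω : Set E3) (σ : ℝ) : Prop :=
  ∀ (u : E3 → ℝ) (Du : E3 → E3), MemH10 Ω u Du →
    eLpNorm u 3 (vol Ω) ≤ ENNReal.ofReal σ * eLpNorm Du 2 (vol Ω)

/-- The smallness threshold `δ = 1 / (κ σ)`; it depends on `Ω` only, through the choice of the
constants `κ` and `σ`. -/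
def IsThreshold (Ω : Set E3) (δ : ℝ) : Prop :=
  ∃ κ σ : ℝ, 0 < κ ∧ 0 < σ ∧ IsNeumannBound Ω κ ∧ IsSobolevBound Ω σ ∧ δ = 1 / (κ * σ)

end KGM

end

/-!
Nonexistence rests on a comparison with the Neumann potential `χ` of `α`. Testing the first
equation with `u` gives `‖∇u‖₂² ≤ ∫ (q u φ)²`. Testing the equations of `φ` and `χ` with `φ - χ` and
subtracting gives `‖∇(φ - χ)‖₂² + ∫ (q u)² φ (φ - χ) = 0`, hence `∫ (q u φ)² ≤ ∫ (q u χ)²`. By Hölder's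
inequality the right-hand side is at most `‖χ‖_∞² ‖q‖₆² ‖u‖₃² ≤ (κ σ ‖q‖₆ ‖α‖)² ‖∇u‖₂²`, and the factor
is less than `1`, so `∇u = 0` and `u = 0` (`IsWeakSolution.exists_energy_le`,
`IsWeakSolution.eq_zero`). The potential exists by Riesz' theorem in the closure of the gradients in
`L²(Ω)` (`exists_isNeumannPotential`).

The constant `σ` comes from the Gagliardo–Nirenberg–Sobolev inequality for test functions. The
existence of `κ` (`exists_isNeumannBound`) needs no elliptic regularity. The datum `α` is the trace
of some `w ∈ H¹(Ω)`, so its pairing with the trace of `ψ` is bounded by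
`∫ |w||ψ| + |∇w||ψ| + |w||∇ψ|` over `Ω` (`exists_abs_boundary_integral_le`). For `ψ` a truncation of
`χ` above the level `k`, Hölder's inequality with exponents `2`, `6`, `3` turns this into a power
`1/3` of `|{χ > k}|`, and the Sobolev inequality gives
`(h - k)⁶ |{χ > h}| ≤ D⁶ |{χ > k}|²` for `h > k`, with `D` proportional to the norm of `w`. Stampacchia's
lemma (`eq_zero_of_stampacchia`) bounds `χ` from above, and `-χ` is treated in the same way.

All this uses the calculus of `H¹(Ω)`: the Poincaré inequality (`exists_poincare`), the Sobolev
inequality in `L⁶` (`exists_sobolev`), the trace inequality (`exists_trace_inequality`), density of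
the functions smooth on the whole space (`MemH1.exists_tendstoH1`), and the chain rule
(`MemH1.comp`). The trace inequality is proved by integrating along vertical lines above the graphs
that describe the boundary. The others rest on one geometric fact (`exists_coneAt`): near every point
of the closure, `Ω` is stable under small translations by the vectors of a suitable cone.
-/

noncomputable section

namespace KGM

/-! ### Convergence in `L²` -/

section L2

variable {X : Type*} [MeasurableSpace X] {μ : Measure X}
variable {E : Type*} [NormedAddCommGroup E]

/-- Convergence `f n → u` in `L²(μ)`, for functions rather than equivalence classes. -/
def TendstoL2 (μ : Measure X) (f : ℕ → X → E) (u : X → E) : Prop :=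
  Tendsto (fun n => eLpNorm (fun x => f n x - u x) 2 μ) atTop (𝓝 0)

theorem tendstoL2_const (u : X → E) : TendstoL2 μ (fun _ => u) u := by
  simp [TendstoL2]

theorem TendstoL2.add {f g : ℕ → X → E} {u v : X → E} (hf : TendstoL2 μ f u)
    (hg : TendstoL2 μ g v) (hfm : ∀ n, AEStronglyMeasurable (f n) μ)
    (hum : AEStronglyMeasurable u μ) (hgm : ∀ n, AEStronglyMeasurable (g n) μ)
    (hvm : AEStronglyMeasurable v μ) :
    TendstoL2 μ (fun n x => f n x + g n x) (fun x => u x + v x) := by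
  have h := Tendsto.add hf hg
  rw [add_zero] at h
  refine tendsto_of_tendsto_of_tendsto_of_le_of_le tendsto_const_nhds h (fun _ => zero_le)
    fun n => ?_
  have : (fun x => f n x + g n x - (u x + v x)) = (fun x => f n x - u x) + (fun x => g n x - v x) := by
    ext x; simp; abel
  simp only [this]
  exact eLpNorm_add_le ((hfm n).sub hum) ((hgm n).sub hvm) (by norm_num)

theorem TendstoL2.neg {f : ℕ → X → E} {u : X → E} (hf : TendstoL2 μ f u) :
    TendstoL2 μ (fun n x => -f n x) (fun x => -u x) := by
  refine hf.congr fun n => ?_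
  rw [← eLpNorm_neg]
  congr 1
  ext x; simp; abel

theorem TendstoL2.of_le {F : Type*} [NormedAddCommGroup F] {f : ℕ → X → E} {u : X → E}
    {g : ℕ → X → F} {v : X → F} (hf : TendstoL2 μ f u) (C : ℝ)
    (h : ∀ n, ∀ᵐ x ∂μ, ‖g n x - v x‖ ≤ C * ‖f n x - u x‖) : TendstoL2 μ g v := by
  have h1 : Tendsto (fun n => ENNReal.ofReal C * eLpNorm (fun x => f n x - u x) 2 μ) atTop (𝓝 0) := by
    simpa using ENNReal.Tendsto.const_mul hf (Or.inr (by simp))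
  exact tendsto_of_tendsto_of_tendsto_of_le_of_le tendsto_const_nhds h1 (fun _ => zero_le)
    fun n => eLpNorm_le_mul_eLpNorm_of_ae_le_mul (h n) 2

theorem TendstoL2.norm {f : ℕ → X → E} {u : X → E} (hf : TendstoL2 μ f u) :
    TendstoL2 μ (fun n x => ‖f n x‖) (fun x => ‖u x‖) :=
  hf.of_le 1 fun n => Eventually.of_forall fun x => by
    rw [one_mul]; exact abs_norm_sub_norm_le _ _

theorem TendstoL2.congr_limit {f : ℕ → X → E} {u v : X → E} (hf : TendstoL2 μ f u)
    (h : u =ᵐ[μ] v) : TendstoL2 μ f v :=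
  Tendsto.congr (fun n => eLpNorm_congr_ae (h.mono fun x hx => by simp [hx])) hf

theorem TendstoL2.comp {f : ℕ → X → E} {u : X → E} (hf : TendstoL2 μ f u) {s : ℕ → ℕ}
    (hs : StrictMono s) : TendstoL2 μ (fun n => f (s n)) u := by
  have h : Tendsto (fun n => MeasureTheory.eLpNorm (fun x => f n x - u x) 2 μ) atTop (𝓝 0) := hf
  exact h.comp hs.tendsto_atTop

theorem TendstoL2.exists_ae {f : ℕ → X → E} {u : X → E} (hf : TendstoL2 μ f u)
    (hfm : ∀ n, AEStronglyMeasurable (f n) μ) (hum : AEStronglyMeasurable u μ) :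
    ∃ s : ℕ → ℕ, StrictMono s ∧ ∀ᵐ x ∂μ, Tendsto (fun n => f (s n) x) atTop (𝓝 (u x)) :=
  (tendstoInMeasure_of_tendsto_eLpNorm (by norm_num) hfm hum hf).exists_seq_tendsto_ae

theorem TendstoL2.eLpNorm {f : ℕ → X → E} {u : X → E} (hf : TendstoL2 μ f u)
    (hfm : ∀ n, MemLp (f n) 2 μ) (hum : MemLp u 2 μ) :
    Tendsto (fun n => eLpNorm (f n) 2 μ) atTop (𝓝 (eLpNorm u 2 μ)) := by
  have := ((Lp.tendsto_Lp_iff_tendsto_eLpNorm'' f hfm u hum).2 hf).enorm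
  simpa using this

/-- A limit in `L²` inherits every bound on `Lᵖ` norms, by Fatou's lemma. -/
theorem TendstoL2.eLpNorm_le {f : ℕ → X → E} {u : X → E} (hf : TendstoL2 μ f u)
    (hfm : ∀ n, AEStronglyMeasurable (f n) μ) (hum : AEStronglyMeasurable u μ) {p : ℝ≥0∞}
    {B : ℕ → ℝ≥0∞} {b : ℝ≥0∞} (hB : Tendsto B atTop (𝓝 b))
    (h : ∀ n, MeasureTheory.eLpNorm (f n) p μ ≤ B n) :
    MeasureTheory.eLpNorm u p μ ≤ b := by
  obtain ⟨s, hs, hae⟩ := hf.exists_ae hfm hum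
  refine (Lp.eLpNorm_lim_le_liminf_eLpNorm (fun n => hfm (s n)) u hae).trans ?_
  rw [← (hB.comp hs.tendsto_atTop).liminf_eq]
  exact liminf_le_liminf (Eventually.of_forall fun n => h (s n))

theorem tendsto_integral_inner {E : Type*} [NormedAddCommGroup E] [InnerProductSpace ℝ E]
    {f g : ℕ → X → E} {u v : X → E} (hf : TendstoL2 μ f u) (hg : TendstoL2 μ g v)
    (hfm : ∀ n, MemLp (f n) 2 μ) (hum : MemLp u 2 μ) (hgm : ∀ n, MemLp (g n) 2 μ)
    (hvm : MemLp v 2 μ) :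
    Tendsto (fun n => ∫ x, inner ℝ (f n x) (g n x) ∂μ) atTop (𝓝 (∫ x, inner ℝ (u x) (v x) ∂μ)) := by
  have h1 := (Lp.tendsto_Lp_iff_tendsto_eLpNorm'' f hfm u hum).2 hf
  have h2 := (Lp.tendsto_Lp_iff_tendsto_eLpNorm'' g hgm v hvm).2 hg
  have key : ∀ {a b : X → E} (ha : MemLp a 2 μ) (hb : MemLp b 2 μ),
      inner ℝ (ha.toLp a) (hb.toLp b) = ∫ x, inner ℝ (a x) (b x) ∂μ := by
    intro a b ha hb
    rw [L2.inner_def]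
    refine integral_congr_ae ?_
    filter_upwards [ha.coeFn_toLp, hb.coeFn_toLp] with x hx hy
    rw [hx, hy]
  have := h1.inner (𝕜 := ℝ) h2
  simpa only [key] using this

theorem tendsto_integral_mul {f g : ℕ → X → ℝ} {u v : X → ℝ} (hf : TendstoL2 μ f u)
    (hg : TendstoL2 μ g v) (hfm : ∀ n, MemLp (f n) 2 μ) (hum : MemLp u 2 μ)
    (hgm : ∀ n, MemLp (g n) 2 μ) (hvm : MemLp v 2 μ) :
    Tendsto (fun n => ∫ x, f n x * g n x ∂μ) atTop (𝓝 (∫ x, u x * v x ∂μ)) := by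
  have := tendsto_integral_inner hf hg hfm hum hgm hvm
  simpa only [real_inner_eq_re_inner, RCLike.inner_apply, conj_trivial, RCLike.re_to_real, mul_comm]
    using this

theorem tendsto_integral_of_tendstoL2 [IsFiniteMeasure μ] [NormedSpace ℝ E] {f : ℕ → X → E} {u : X → E}
    (hf : TendstoL2 μ f u) (hfm : ∀ n, MemLp (f n) 2 μ) (hum : MemLp u 2 μ) :
    Tendsto (fun n => ∫ x, f n x ∂μ) atTop (𝓝 (∫ x, u x ∂μ)) := by
  refine tendsto_integral_of_L1' u (hum.integrable (by norm_num)).1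
    (Eventually.of_forall fun n => (hfm n).integrable (by norm_num)) ?_
  have h1 : Tendsto (fun n => MeasureTheory.eLpNorm (fun x => f n x - u x) 2 μ *
        μ Set.univ ^ (1 / (1:ℝ≥0∞).toReal - 1 / (2:ℝ≥0∞).toReal))
      atTop (𝓝 0) := by
    simpa using ENNReal.Tendsto.mul_const hf
        (b := μ Set.univ ^ (1 / (1:ℝ≥0∞).toReal - 1 / (2:ℝ≥0∞).toReal))
        (Or.inr (ENNReal.rpow_ne_top_of_nonneg (by norm_num) (measure_ne_top _ _)))
  refine tendsto_of_tendsto_of_tendsto_of_le_of_le tendsto_const_nhds h1 (fun _ => zero_le)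
    fun n => ?_
  exact eLpNorm_le_eLpNorm_mul_rpow_measure_univ (by norm_num) ((hfm n).1.sub hum.1)

/-- `L²(μ)` is complete. The form of the Cauchy condition suits sequences of images, under a bounded
operator, of a sequence known to converge: `B n` is the distance from the `n`-th term to the limit. -/
theorem exists_tendstoL2 [CompleteSpace E] {f : ℕ → X → E} (hfm : ∀ n, MemLp (f n) 2 μ)
    {B : ℕ → ℝ≥0∞} (hB : Tendsto B atTop (𝓝 0))
    (h : ∀ n m, MeasureTheory.eLpNorm (fun x => f n x - f m x) 2 μ ≤ B n + B m) :
    ∃ u, MemLp u 2 μ ∧ TendstoL2 μ f u := by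
  have hc : CauchySeq (fun n => (hfm n).toLp (f n)) := by
    refine EMetric.cauchySeq_iff.2 fun ε hε => ?_
    obtain ⟨N, hN⟩ := eventually_atTop.1 (hB.eventually (gt_mem_nhds (ENNReal.half_pos hε.ne')))
    refine ⟨N, fun n hn m hm => ?_⟩
    rw [Lp.edist_toLp_toLp]
    calc _ ≤ B n + B m := h n m
      _ < ε / 2 + ε / 2 := ENNReal.add_lt_add (hN n hn) (hN m hm)
      _ = ε := ENNReal.add_halves ε
  obtain ⟨U, hU⟩ := cauchySeq_tendsto_of_complete hc
  refine ⟨U, Lp.memLp U, ?_⟩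
  refine (Lp.tendsto_Lp_iff_tendsto_eLpNorm'' f hfm U (Lp.memLp U)).1 ?_
  simpa using hU

theorem eLpNorm_two_sq (f : X → E) (μ : Measure X) :
    MeasureTheory.eLpNorm f 2 μ ^ 2 = ∫⁻ x, ‖f x‖ₑ ^ 2 ∂μ := by
  rw [eLpNorm_eq_lintegral_rpow_enorm_toReal (by norm_num) (by norm_num), ← ENNReal.rpow_natCast,
    ← ENNReal.rpow_mul]
  norm_num

/-- Jensen's inequality for the square. -/
theorem lintegral_sq_le [IsProbabilityMeasure μ] {f : X → ℝ≥0∞} (hf : AEMeasurable f μ) :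
    (∫⁻ x, f x ∂μ) ^ 2 ≤ ∫⁻ x, f x ^ 2 ∂μ := by
  have h := ENNReal.lintegral_mul_le_Lp_mul_Lq μ Real.HolderConjugate.two_two hf
    (aemeasurable_const (b := (1 : ℝ≥0∞)))
  simp only [Pi.mul_apply, mul_one, ENNReal.one_rpow, lintegral_const, measure_univ] at h
  calc (∫⁻ x, f x ∂μ) ^ 2 ≤ ((∫⁻ x, f x ^ (2:ℝ) ∂μ) ^ (1 / 2 : ℝ)) ^ 2 := by gcongr
    _ = ∫⁻ x, f x ^ 2 ∂μ := by
      rw [← ENNReal.rpow_natCast, ← ENNReal.rpow_mul]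
      norm_num

end L2

/-! ### Gradients of smooth functions -/

theorem enorm_gradient (F : E3 → ℝ) (x : E3) : ‖gradient F x‖ₑ = ‖fderiv ℝ F x‖ₑ := by
  rw [← ofReal_norm, ← ofReal_norm, gradient, LinearIsometryEquiv.norm_map]

theorem norm_gradient (F : E3 → ℝ) (x : E3) : ‖gradient F x‖ = ‖fderiv ℝ F x‖ := by
  rw [gradient, LinearIsometryEquiv.norm_map]

theorem inner_gradient (F : E3 → ℝ) (x d : E3) : inner ℝ (gradient F x) d = fderiv ℝ F x d := by
  simp [gradient]

theorem continuous_gradient {F : E3 → ℝ} (hF : ContDiff ℝ ∞ F) : Continuous (gradient F) :=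
  (InnerProductSpace.toDual ℝ E3).symm.continuous.comp (hF.continuous_fderiv (by simp))

theorem gradient_mul {F G : E3 → ℝ} (hF : ContDiff ℝ ∞ F) (hG : ContDiff ℝ ∞ G) (x : E3) :
    gradient (fun y => F y * G y) x = F x • gradient G x + G x • gradient F x := by
  simp only [gradient]
  rw [fderiv_fun_mul (hF.differentiable (by simp) x) (hG.differentiable (by simp) x)]
  simp

theorem gradient_add {F G : E3 → ℝ} (hF : ContDiff ℝ ∞ F) (hG : ContDiff ℝ ∞ G) (x : E3) :
    gradient (fun y => F y + G y) x = gradient F x + gradient G x := by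
  simp only [gradient]
  rw [fderiv_fun_add (hF.differentiable (by simp) x) (hG.differentiable (by simp) x)]
  simp

theorem gradient_sub {F G : E3 → ℝ} (hF : ContDiff ℝ ∞ F) (hG : ContDiff ℝ ∞ G) (x : E3) :
    gradient (fun y => F y - G y) x = gradient F x - gradient G x := by
  simp only [gradient]
  rw [fderiv_fun_sub (hF.differentiable (by simp) x) (hG.differentiable (by simp) x)]
  simp

theorem gradient_const_mul {F : E3 → ℝ} (hF : ContDiff ℝ ∞ F) (c : ℝ) (x : E3) :
    gradient (fun y => c * F y) x = c • gradient F x := by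
  simp only [gradient]
  rw [fderiv_const_mul (hF.differentiable (by simp) x)]
  simp

theorem gradient_sum {ι : Type*} (s : Finset ι) {F : ι → E3 → ℝ} (hF : ∀ i ∈ s, ContDiff ℝ ∞ (F i))
    (x : E3) : gradient (fun y => ∑ i ∈ s, F i y) x = ∑ i ∈ s, gradient (F i) x := by
  simp only [gradient]
  rw [fderiv_fun_sum fun i hi => (hF i hi).differentiable (by simp) x]
  simp

theorem gradient_comp {G : ℝ → ℝ} (hG : ContDiff ℝ ∞ G) {F : E3 → ℝ} (hF : ContDiff ℝ ∞ F)
    (x : E3) : gradient (fun y => G (F y)) x = deriv G (F x) • gradient F x := by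
  have h1 : HasFDerivAt (fun y => G (F y)) (deriv G (F x) • fderiv ℝ F x) x :=
    ((hG.differentiable (by simp) _).hasDerivAt).comp_hasFDerivAt x
      (hF.differentiable (by simp) x).hasFDerivAt
  simp only [gradient]
  rw [h1.fderiv]
  simp

theorem gradient_sub_const (F : E3 → ℝ) (c : ℝ) (x : E3) :
    gradient (fun y => F y - c) x = gradient F x := by
  simp only [gradient]
  rw [fderiv_sub_const]

theorem gradient_const (c : ℝ) (x : E3) : gradient (fun _ : E3 => c) x = 0 := by
  simp [gradient]

/-- A cutoff costs a constant in `W^{1,p}`, pointwise. -/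
theorem exists_enorm_gradient_mul_le {η : E3 → ℝ} (hη : ContDiff ℝ ∞ η) (hc : HasCompactSupport η) :
    ∃ C : NNReal, ∀ F : E3 → ℝ, ContDiff ℝ ∞ F → ∀ x,
      ‖gradient (fun y => η y * F y) x‖ₑ ≤ C * (‖F x‖ₑ + ‖gradient F x‖ₑ) := by
  obtain ⟨C1, h1⟩ := hc.exists_bound_of_continuous hη.continuous
  obtain ⟨C2, h2⟩ := (hc.fderiv (𝕜 := ℝ)).exists_bound_of_continuous
    (hη.continuous_fderiv (by simp))
  have e1 : ∀ x, ‖η x‖ₑ ≤ (max C1.toNNReal C2.toNNReal : NNReal) := fun x => by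
    rw [← ofReal_norm]
    exact ENNReal.ofReal_le_ofReal (h1 x) |>.trans (by
      rw [ENNReal.ofReal]; exact_mod_cast le_max_left _ _)
  have e2 : ∀ x, ‖gradient η x‖ₑ ≤ (max C1.toNNReal C2.toNNReal : NNReal) := fun x => by
    rw [enorm_gradient, ← ofReal_norm]
    exact ENNReal.ofReal_le_ofReal (h2 x) |>.trans (by
      rw [ENNReal.ofReal]; exact_mod_cast le_max_right _ _)
  refine ⟨max C1.toNNReal C2.toNNReal, fun F hF x => ?_⟩
  rw [gradient_mul hη hF]
  refine (enorm_add_le _ _).trans ?_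
  rw [enorm_smul, enorm_smul, mul_add, add_comm, mul_comm ‖F x‖ₑ]
  gcongr
  · exact e2 x
  · exact e1 x

/-! ### The interior cone property and partitions of unity -/

/-- In `ball p r` the set `Ω` is stable under translation by the vectors of the cone
`-P [0, ∞)³`: in the coordinates `P⁻¹` it is a lower set there. -/
def ConeAt (Ω : Set E3) (p : E3) (r : ℝ) (P : (Fin 3 → ℝ) ≃L[ℝ] E3) : Prop :=
  ∀ x ∈ Ω, x ∈ Metric.ball p r → ∀ c : Fin 3 → ℝ, (∀ i, 0 ≤ c i) →
    x - P c ∈ Metric.ball p r → x - P c ∈ Ω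

/-- The linear coordinates whose octant is a cone of slope `τ` around the downward vertical. -/
def slopeEquiv (τ : ℝ) (hτ : τ ≠ 0) : (Fin 3 → ℝ) ≃ₗ[ℝ] E3 where
  toFun c := !₂[c 0, c 1, -(τ * (c 0 + c 1 + c 2))]
  invFun v := ![v 0, v 1, -(v 2 / τ) - v 0 - v 1]
  map_add' a b := by
    ext i; fin_cases i <;> simp; ring
  map_smul' a b := by
    ext i; fin_cases i <;> simp; ring
  left_inv c := by
    ext i; fin_cases i <;> simp; field_simp; ring
  right_inv v := by
    ext i; fin_cases i <;> simp; field_simp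

/-- Every point of the closure has a cone. At a boundary point the cone points into the region above
the graph, and its slope exceeds the Lipschitz constant `K` of the graph function near the point. -/
theorem exists_coneAt {Ω : Set E3} (hΩ : IsSmoothBoundedDomain Ω) {p : E3} (hp : p ∈ closure Ω) :
    ∃ r : ℝ, 0 < r ∧ ∃ P : (Fin 3 → ℝ) ≃L[ℝ] E3, ConeAt Ω p r P := by
  by_cases hpΩ : p ∈ Ω
  · obtain ⟨r, hr, hb⟩ := Metric.isOpen_iff.1 hΩ.isOpen p hpΩ
    exact ⟨r, hr, (slopeEquiv 1 one_ne_zero).toContinuousLinearEquiv,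
      fun x _ _ c _ h => hb h⟩
  have hpf : p ∈ frontier Ω := by
    rw [hΩ.isOpen.frontier_eq]; exact ⟨hp, hpΩ⟩
  obtain ⟨r, hr, L, γ, hγ, hloc⟩ := hΩ.smooth_boundary p hpf
  have hπ : Continuous (fun x : E3 => (!₂[L x 0, L x 1] : EuclideanSpace ℝ (Fin 2))) := by
    fun_prop
  obtain ⟨K, t, ht, hK⟩ := ((hγ.of_le (by simp : (1 : WithTop ℕ∞) ≤ ((⊤ : ℕ∞) : WithTop ℕ∞))).contDiffAt
    (x := !₂[L p 0, L p 1])).exists_lipschitzOnWith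
  obtain ⟨r', hr', hb⟩ := Metric.mem_nhds_iff.1 (hπ.continuousAt.preimage_mem_nhds ht)
  have hτ : ((K : ℝ) + 1) ≠ 0 := by positivity
  refine ⟨min r r', lt_min hr hr',
    ((slopeEquiv (K + 1) hτ).trans L.symm.toLinearEquiv).toContinuousLinearEquiv, ?_⟩
  intro x hx hxb c hc hcb
  set z := ((slopeEquiv (K + 1) hτ).trans L.symm.toLinearEquiv).toContinuousLinearEquiv c with hz
  have hLz : L z = slopeEquiv (K + 1) hτ c := by simp [hz]
  have h1 := (hloc x (Metric.ball_subset_ball (min_le_left _ _) hxb)).1 hx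
  refine (hloc _ (Metric.ball_subset_ball (min_le_left _ _) hcb)).2 ?_
  have hx' := hb (Metric.ball_subset_ball (min_le_right _ _) hxb)
  have hc' := hb (Metric.ball_subset_ball (min_le_right _ _) hcb)
  have h2 := hK.dist_le_mul _ hc' _ hx'
  have hd : dist (!₂[L (x - z) 0, L (x - z) 1] : EuclideanSpace ℝ (Fin 2)) !₂[L x 0, L x 1]
      ≤ c 0 + c 1 := by
    rw [EuclideanSpace.dist_eq]
    simp only [Fin.sum_univ_two, map_sub, hLz, Real.dist_eq]
    refine Real.sqrt_le_iff.2 ⟨add_nonneg (hc 0) (hc 1), ?_⟩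
    simp [slopeEquiv]
    nlinarith [mul_nonneg (hc 0) (hc 1)]
  have h3 : L (x - z) 2 = L x 2 + (K + 1) * (c 0 + c 1 + c 2) := by
    rw [map_sub, hLz]; simp [slopeEquiv]
  rw [h3]
  rw [Real.dist_eq] at h2
  have h4 : (K : ℝ) * dist (!₂[L (x - z) 0, L (x - z) 1] : EuclideanSpace ℝ (Fin 2)) !₂[L x 0, L x 1]
      ≤ K * (c 0 + c 1) := by gcongr
  have h5 := (abs_le.1 h2).2
  have hc2 := hc 2
  have hc1 := hc 1
  have hc0 := hc 0
  have hK0 : (0:ℝ) ≤ K * c 2 := mul_nonneg K.2 hc2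
  nlinarith

/-- A finite smooth partition of unity on a compact set, subordinate to balls of given radii
around its points. -/
theorem exists_partition {K : Set E3} (hK : IsCompact K) (ρ : E3 → ℝ) (hρ : ∀ p ∈ K, 0 < ρ p) :
    ∃ (t : Finset E3) (η : E3 → E3 → ℝ), (∀ p ∈ t, p ∈ K) ∧
      (∀ p, ContDiff ℝ ∞ (η p)) ∧ (∀ p, HasCompactSupport (η p)) ∧
      (∀ p ∈ t, tsupport (η p) ⊆ Metric.ball p (ρ p)) ∧
      ∀ x ∈ K, ∑ p ∈ t, η p x = 1 := by
  classical
  obtain ⟨t, htK, hcov⟩ := hK.elim_nhds_subcover (fun p => Metric.ball p (ρ p))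
    fun p hp => Metric.ball_mem_nhds p (hρ p hp)
  obtain ⟨f, hf⟩ := SmoothPartitionOfUnity.exists_isSubordinate (modelWithCornersSelf ℝ E3)
    hK.isClosed (fun p : t => Metric.ball (p : E3) (ρ p)) (fun _ => Metric.isOpen_ball)
    (fun x hx => by
      obtain ⟨p, hp, hxp⟩ := Set.mem_iUnion₂.1 (hcov hx)
      exact Set.mem_iUnion.2 ⟨⟨p, hp⟩, hxp⟩)
  refine ⟨t, fun p => if h : p ∈ t then f ⟨p, h⟩ else 0, htK, fun p => ?_, fun p => ?_, ?_, ?_⟩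
  · dsimp only
    split_ifs with h
    · exact (f ⟨p, h⟩).contMDiff.contDiff
    · exact contDiff_const
  · dsimp only
    split_ifs with h
    · exact HasCompactSupport.of_support_subset_isCompact (isCompact_closedBall p (ρ p))
        (((subset_tsupport _).trans (hf ⟨p, h⟩)).trans Metric.ball_subset_closedBall)
    · exact HasCompactSupport.zero
  · intro p h
    simp only [h, dite_true]
    exact hf ⟨p, h⟩
  · intro x hx
    have := f.sum_eq_one hx
    rw [finsum_eq_sum_of_fintype] at this
    rw [← this, ← Finset.sum_coe_sort t (fun p => (if h : p ∈ t then f ⟨p, h⟩ else 0 : E3 → ℝ) x)]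
    simp only [Finset.coe_mem, dite_true, Subtype.coe_eta]

/-! ### The Poincaré inequality -/

theorem enorm_sq_le_two_mul {E : Type*} [NormedAddCommGroup E] (a b : E) :
    ‖a‖ₑ ^ 2 ≤ 2 * (‖a - b‖ₑ ^ 2 + ‖b‖ₑ ^ 2) := by
  have h : ‖a‖ₑ ≤ ‖a - b‖ₑ + ‖b‖ₑ := by simpa using enorm_add_le (a - b) b
  have h2 := ENNReal.rpow_add_le_mul_rpow_add_rpow ‖a - b‖ₑ ‖b‖ₑ (p := 2) (by norm_num)
  norm_num at h2
  exact (pow_le_pow_left' h 2).trans h2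

theorem setLIntegral_translate_le {A A' : Set E3} (hA : MeasurableSet A) (hA' : MeasurableSet A')
    {d : E3} (hd : ∀ x ∈ A, x - d ∈ A') (g : E3 → ℝ≥0∞) :
    ∫⁻ x in A, g (x - d) ≤ ∫⁻ x in A', g x := by
  rw [← lintegral_indicator hA, ← lintegral_indicator hA',
    ← lintegral_sub_right_eq_self (A'.indicator g) d]
  refine lintegral_mono fun x => ?_
  by_cases hx : x ∈ A
  · simp [hx, hd x hx]
  · simp [hx]

theorem enorm_sub_translate_sq_le {F : E3 → ℝ} (hF : ContDiff ℝ ∞ F) (x d : E3) :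
    ‖F (x - d) - F x‖ₑ ^ 2 ≤
      ∫⁻ t in Set.Ioc (0 : ℝ) 1, ‖d‖ₑ ^ 2 * ‖gradient F (x - t • d)‖ₑ ^ 2 := by
  have hline : ∀ t : ℝ, HasDerivAt (fun t : ℝ => F (x - t • d)) (-(fderiv ℝ F (x - t • d) d)) t := by
    intro t
    have h1 : HasDerivAt (fun t : ℝ => x - t • d) (-d) t := by
      simpa using ((hasDerivAt_id t).smul_const d).const_sub x
    have h2 := (hF.differentiable (by simp) (x - t • d)).hasFDerivAt.comp_hasDerivAt t h1
    rw [map_neg] at h2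
    exact h2
  have hcont : Continuous fun t : ℝ => -(fderiv ℝ F (x - t • d) d) := by
    have := hF.continuous_fderiv (by simp)
    fun_prop
  have hcg := continuous_gradient hF
  have hFTC := intervalIntegral.integral_eq_sub_of_hasDerivAt (a := 0) (b := 1)
    (fun t _ => hline t) (hcont.intervalIntegrable _ _)
  simp only [one_smul, zero_smul, sub_zero] at hFTC
  rw [← hFTC, intervalIntegral.integral_of_le zero_le_one]
  have : IsProbabilityMeasure (volume.restrict (Set.Ioc (0 : ℝ) 1)) := ⟨by simp⟩
  calc _ ≤ (∫⁻ t in Set.Ioc (0 : ℝ) 1, ‖-(fderiv ℝ F (x - t • d) d)‖ₑ) ^ 2 := by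
        gcongr; exact enorm_integral_le_lintegral_enorm _
    _ ≤ (∫⁻ t in Set.Ioc (0 : ℝ) 1, ‖d‖ₑ * ‖gradient F (x - t • d)‖ₑ) ^ 2 := by
        gcongr with t
        rw [enorm_neg, enorm_gradient, mul_comm]
        exact ContinuousLinearMap.le_opENorm _ _
    _ ≤ _ := by
        refine (lintegral_sq_le ?_).trans (le_of_eq ?_)
        · exact Continuous.aemeasurable (by fun_prop (disch := simp))
        · simp only [mul_pow]

/-- Increments are controlled by the gradient along segments contained in `Ω`. -/
theorem lintegral_sub_translate_sq_le {Ω A : Set E3} (hΩ : MeasurableSet Ω) (hA : MeasurableSet A)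
    {d : E3} (hseg : ∀ x ∈ A, ∀ t : ℝ, 0 ≤ t → t ≤ 1 → x - t • d ∈ Ω) {F : E3 → ℝ}
    (hF : ContDiff ℝ ∞ F) :
    ∫⁻ x in A, ‖F (x - d) - F x‖ₑ ^ 2 ≤ ‖d‖ₑ ^ 2 * ∫⁻ x in Ω, ‖gradient F x‖ₑ ^ 2 := by
  have hcg := continuous_gradient hF
  calc _ ≤ ∫⁻ x in A, ∫⁻ t in Set.Ioc (0 : ℝ) 1, ‖d‖ₑ ^ 2 * ‖gradient F (x - t • d)‖ₑ ^ 2 :=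
        lintegral_mono fun x => enorm_sub_translate_sq_le hF x d
    _ = ∫⁻ t in Set.Ioc (0 : ℝ) 1, ∫⁻ x in A, ‖d‖ₑ ^ 2 * ‖gradient F (x - t • d)‖ₑ ^ 2 := by
        refine lintegral_lintegral_swap ?_
        have h1 : Measurable fun z : E3 × ℝ => ‖gradient F (z.1 - z.2 • d)‖ₑ :=
          Continuous.measurable (by fun_prop)
        exact ((h1.pow_const 2).const_mul _).aemeasurable
    _ ≤ ∫⁻ t in Set.Ioc (0 : ℝ) 1, ‖d‖ₑ ^ 2 * ∫⁻ x in Ω, ‖gradient F x‖ₑ ^ 2 := by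
        refine setLIntegral_mono' measurableSet_Ioc fun t ht => ?_
        have hm : Measurable fun x : E3 => ‖gradient F (x - t • d)‖ₑ :=
          Continuous.measurable (by fun_prop)
        rw [lintegral_const_mul _ (hm.pow_const 2)]
        exact mul_le_mul_right (setLIntegral_translate_le hA hΩ
          (fun x hx => hseg x hx t ht.1.le ht.2) fun x => ‖gradient F x‖ₑ ^ 2) _
    _ = _ := by simp

/-- `A` is good relative to a reference set `B` when the `L²` norm over `A` of a smooth function is
controlled by its `L²` norm over `B` and that of its gradient over `Ω`. -/
def IsGood (Ω B A : Set E3) : Prop :=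
  ∃ C : NNReal, ∀ F : E3 → ℝ, ContDiff ℝ ∞ F →
    ∫⁻ x in A, ‖F x‖ₑ ^ 2 ≤ C * ((∫⁻ x in Ω, ‖gradient F x‖ₑ ^ 2) + ∫⁻ x in B, ‖F x‖ₑ ^ 2)

theorem IsGood.mono {Ω B A A' : Set E3} (h : IsGood Ω B A') (hA : A ⊆ A') : IsGood Ω B A := by
  obtain ⟨C, hC⟩ := h
  exact ⟨C, fun F hF => (lintegral_mono_set hA).trans (hC F hF)⟩

theorem IsGood.union {Ω B A A' : Set E3} (h : IsGood Ω B A) (h' : IsGood Ω B A') :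
    IsGood Ω B (A ∪ A') := by
  obtain ⟨C, hC⟩ := h
  obtain ⟨C', hC'⟩ := h'
  refine ⟨C + C', fun F hF => (lintegral_union_le _ _ _).trans ?_⟩
  rw [ENNReal.coe_add, add_mul]
  exact add_le_add (hC F hF) (hC' F hF)

/-- Goodness propagates along translations whose segments stay in `Ω`. -/
theorem IsGood.translate {Ω B A A' : Set E3} (hΩ : MeasurableSet Ω) (hA : MeasurableSet A)
    (hA' : MeasurableSet A') {d : E3} (h : IsGood Ω B A') (hd : ∀ x ∈ A, x - d ∈ A')
    (hseg : ∀ x ∈ A, ∀ t : ℝ, 0 ≤ t → t ≤ 1 → x - t • d ∈ Ω) : IsGood Ω B A := by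
  obtain ⟨C, hC⟩ := h
  refine ⟨2 * (‖d‖₊ ^ 2 + C), fun F hF => ?_⟩
  have hFc := hF.continuous
  have hm : Measurable fun x => ‖F (x - d)‖ₑ ^ 2 :=
    (Continuous.measurable (by fun_prop)).pow_const 2
  have h1 : ∫⁻ x in A, ‖F (x - d)‖ₑ ^ 2 ≤ ∫⁻ x in A', ‖F x‖ₑ ^ 2 :=
    setLIntegral_translate_le hA hA' hd fun x => ‖F x‖ₑ ^ 2
  have h2 := lintegral_sub_translate_sq_le hΩ hA hseg hF
  calc ∫⁻ x in A, ‖F x‖ₑ ^ 2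
      ≤ ∫⁻ x in A, 2 * (‖F (x - d) - F x‖ₑ ^ 2 + ‖F (x - d)‖ₑ ^ 2) := by
        refine lintegral_mono fun x => ?_
        have := enorm_sq_le_two_mul (F x) (F (x - d))
        rwa [enorm_sub_rev] at this
    _ = 2 * ((∫⁻ x in A, ‖F (x - d) - F x‖ₑ ^ 2) + ∫⁻ x in A, ‖F (x - d)‖ₑ ^ 2) := by
        rw [lintegral_const_mul' _ _ (by norm_num), lintegral_add_right _ hm]
    _ ≤ 2 * (‖d‖ₑ ^ 2 * (∫⁻ x in Ω, ‖gradient F x‖ₑ ^ 2) +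
          C * ((∫⁻ x in Ω, ‖gradient F x‖ₑ ^ 2) + ∫⁻ x in B, ‖F x‖ₑ ^ 2)) := by
        gcongr
        exact h1.trans (hC F hF)
    _ ≤ 2 * (‖d‖ₑ ^ 2 * ((∫⁻ x in Ω, ‖gradient F x‖ₑ ^ 2) + ∫⁻ x in B, ‖F x‖ₑ ^ 2) +
          C * ((∫⁻ x in Ω, ‖gradient F x‖ₑ ^ 2) + ∫⁻ x in B, ‖F x‖ₑ ^ 2)) := by
        gcongr
        exact le_self_add
    _ = _ := by
        push_cast
        rw [enorm_eq_nnnorm]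
        ring

/-- Every point of `Ω` has a good neighbourhood: the points that have one form a set that is open and
relatively closed in the connected set `Ω`. -/
theorem isGood_ball {Ω : Set E3} (hΩ : IsSmoothBoundedDomain Ω) {x₀ : E3} {r₀ : ℝ} (hr₀ : 0 < r₀)
    (hx₀ : x₀ ∈ Ω) {x : E3} (hx : x ∈ Ω) :
    ∃ ρ > 0, IsGood Ω (Metric.ball x₀ r₀) (Metric.ball x ρ) := by
  set B := Metric.ball x₀ r₀
  set S : Set E3 := {x | ∃ ρ > 0, IsGood Ω B (Metric.ball x ρ)}
  have hSo : IsOpen S := by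
    refine Metric.isOpen_iff.2 fun y ⟨ρ, hρ, hg⟩ => ⟨ρ / 2, by positivity, fun z hz => ?_⟩
    refine ⟨ρ / 2, by positivity, hg.mono (Metric.ball_subset_ball' ?_)⟩
    rw [Metric.mem_ball] at hz; linarith
  have hB : IsGood Ω B B := ⟨1, fun F _ => by simp⟩
  refine hΩ.isConnected.isPreconnected.subset_of_closure_inter_subset hSo
    ⟨x₀, hx₀, r₀, hr₀, hB⟩ ?_ hx
  rintro y ⟨hyc, hyΩ⟩
  obtain ⟨R, hR, hRb⟩ := Metric.isOpen_iff.1 hΩ.isOpen y hyΩ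
  obtain ⟨z, ⟨ρ, hρ, hg⟩, hyz⟩ := Metric.mem_closure_iff.1 hyc (R / 2) (by positivity)
  refine ⟨min ρ (R / 2), by positivity, (hg.mono (Metric.ball_subset_ball (min_le_left ρ (R / 2)))).translate
    (d := y - z) hΩ.isOpen.measurableSet Metric.isOpen_ball.measurableSet
    Metric.isOpen_ball.measurableSet ?_ ?_⟩
  · intro w hw
    rw [Metric.mem_ball, dist_eq_norm] at hw ⊢
    convert! hw using 2
    abel
  · intro w hw t ht0 ht1
    refine hRb ?_
    have hw' : ‖w - y‖ < R / 2 := by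
      rw [← dist_eq_norm]; exact (Metric.mem_ball.1 hw).trans_le (min_le_right _ _)
    rw [dist_eq_norm] at hyz
    rw [Metric.mem_ball, dist_eq_norm]
    have e : w - t • (y - z) - y = (w - y) - t • (y - z) := by abel
    have h2 : ‖t • (y - z)‖ ≤ ‖y - z‖ := by
      rw [norm_smul, Real.norm_of_nonneg ht0]
      exact mul_le_of_le_one_left (norm_nonneg _) ht1
    rw [e]
    linarith [norm_sub_le (w - y) (t • (y - z))]

/-- By compactness of the closure it suffices to find a good relative neighbourhood of each `p`
in the closure; a small vector `d` of the cone at `p` carries one into a good ball around `p - d ∈ Ω`. -/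
theorem isGood_self {Ω : Set E3} (hΩ : IsSmoothBoundedDomain Ω) {x₀ : E3} {r₀ : ℝ} (hr₀ : 0 < r₀)
    (hx₀ : x₀ ∈ Ω) : IsGood Ω (Metric.ball x₀ r₀) Ω := by
  set B := Metric.ball x₀ r₀
  have hcomp : IsCompact (closure Ω) := hΩ.isBounded.isCompact_closure
  have key : IsGood Ω B (closure Ω ∩ Ω) := by
    refine hcomp.induction_on (p := fun K => IsGood Ω B (K ∩ Ω)) ⟨0, fun F _ => by simp⟩
      (fun s t hst h => h.mono (Set.inter_subset_inter_left _ hst))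
      (fun s t hs ht => by rw [Set.union_inter_distrib_right]; exact hs.union ht) fun p hp => ?_
    obtain ⟨r, hr, P, hP⟩ := exists_coneAt hΩ hp
    -- `d` is taken in the interior of the cone, so that `p - d ∈ Ω` even if `p` is on the boundary
    obtain ⟨s, hs, hsd⟩ : ∃ s : ℝ, 0 < s ∧ ‖P (fun _ => s)‖ < r / 2 := by
      have hc : ContinuousAt (fun s : ℝ => ‖P (fun _ => s)‖) 0 := by fun_prop
      have h0 : ∀ᶠ s in 𝓝 (0 : ℝ), ‖P (fun _ => s)‖ < r / 2 := by
        refine hc.eventually_lt continuousAt_const ?_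
        have : P (fun _ : Fin 3 => (0 : ℝ)) = 0 := map_zero P
        simp [this]; positivity
      obtain ⟨s, hs1, hs2⟩ := ((h0.filter_mono nhdsWithin_le_nhds).and
        (self_mem_nhdsWithin (s := Set.Ioi (0 : ℝ)))).exists
      exact ⟨s, hs2, hs1⟩
    set d := P (fun _ => s) with hd
    have hpd : p - d ∈ Ω := by
      have hc : Continuous fun x : E3 => P.symm (x - (p - d)) := by fun_prop
      have hev : ∀ᶠ x in 𝓝 p, (∀ i, 0 < P.symm (x - (p - d)) i) ∧ x ∈ Metric.ball p r := by
        refine (eventually_all.2 fun i => ?_).and (Metric.ball_mem_nhds p hr)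
        refine continuousAt_const.eventually_lt
          ((continuous_apply i).comp hc).continuousAt ?_
        simp [hd, hs]
      obtain ⟨x, hx3, hx1, hx2⟩ := ((mem_closure_iff_frequently.1 hp).and_eventually hev).exists
      have := hP x hx3 hx2 (P.symm (x - (p - d))) (fun i => (hx1 i).le)
      simp only [ContinuousLinearEquiv.apply_symm_apply, sub_sub_cancel] at this
      refine this ?_
      rw [Metric.mem_ball, dist_eq_norm]
      have : p - d - p = -d := by abel
      rw [this, norm_neg]
      linarith
    obtain ⟨ρ, hρ, hg⟩ := isGood_ball hΩ hr₀ hx₀ hpd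
    refine ⟨Metric.ball p (min ρ (r / 2)), mem_nhdsWithin_of_mem_nhds
      (Metric.ball_mem_nhds _ (by positivity)), ?_⟩
    refine (hg.translate (d := d) hΩ.isOpen.measurableSet
      (Metric.isOpen_ball.measurableSet.inter hΩ.isOpen.measurableSet)
      Metric.isOpen_ball.measurableSet ?_ ?_)
    · intro w hw
      have := (Metric.mem_ball.1 hw.1).trans_le (min_le_left _ _)
      rw [dist_eq_norm] at this
      rw [Metric.mem_ball, dist_eq_norm]
      convert! this using 2
      abel
    · intro w hw t ht0 ht1
      have hw1 := (Metric.mem_ball.1 hw.1).trans_le (min_le_right _ _)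
      have e : t • d = P (fun _ => t * s) := by
        rw [hd, ← map_smul]; rfl
      have h2 : ‖t • d‖ ≤ ‖d‖ := by
        rw [norm_smul, Real.norm_of_nonneg ht0]
        exact mul_le_of_le_one_left (norm_nonneg _) ht1
      rw [e] at h2 ⊢
      refine hP w hw.2 (Metric.mem_ball.2 (by linarith)) _ (fun _ => by positivity) ?_
      rw [dist_eq_norm] at hw1
      rw [Metric.mem_ball, dist_eq_norm]
      have e2 : w - P (fun _ => t * s) - p = (w - p) - P (fun _ => t * s) := by abel
      rw [e2]
      linarith [norm_sub_le (w - p) (P (fun _ => t * s))]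
  exact key.mono fun x hx => ⟨subset_closure hx, hx⟩

/-- Poincaré's inequality on a ball well inside `Ω`: averaging over all translations, some value of
`F` is a suitable constant. -/
theorem exists_const_lintegral_ball_le {Ω : Set E3} (hΩ : MeasurableSet Ω) {x₀ : E3} {r : ℝ}
    (hr : 0 < r) (hb : Metric.ball x₀ (3 * r) ⊆ Ω) :
    ∃ C : NNReal, ∀ F : E3 → ℝ, ContDiff ℝ ∞ F → ∃ c : ℝ,
      ∫⁻ x in Metric.ball x₀ r, ‖F x - c‖ₑ ^ 2 ≤ C * ∫⁻ x in Ω, ‖gradient F x‖ₑ ^ 2 := by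
  set B := Metric.ball x₀ r with hB
  have hB0 : volume B ≠ 0 := (Metric.measure_ball_pos _ _ hr).ne'
  have hBt : volume B ≠ ⊤ := measure_ball_lt_top.ne
  have hD : (ENNReal.ofReal (2 * r)) ^ 2 * volume (Metric.ball (0 : E3) (2 * r)) / volume B ≠ ⊤ :=
    ENNReal.div_ne_top (ENNReal.mul_ne_top (ENNReal.pow_ne_top ENNReal.ofReal_ne_top) measure_ball_lt_top.ne) hB0
  refine ⟨((ENNReal.ofReal (2 * r)) ^ 2 * volume (Metric.ball (0 : E3) (2 * r)) / volume B).toNNReal,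
    fun F hF => ?_⟩
  rw [ENNReal.coe_toNNReal hD]
  have hFc := hF.continuous
  have hBm : MeasurableSet B := Metric.isOpen_ball.measurableSet
  have hm : Measurable (Function.uncurry fun (y x : E3) => ‖F x - F y‖ₑ ^ 2) :=
    (Continuous.measurable (by fun_prop : Continuous fun z : E3 × E3 => ‖F z.2 - F z.1‖ₑ)).pow_const 2
  obtain ⟨y, -, hy⟩ := exists_le_setLAverage (μ := volume) (s := B)
    (f := fun y => ∫⁻ x in B, ‖F x - F y‖ₑ ^ 2) hB0 hBt (hm.lintegral_prod_right').aemeasurable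
  refine ⟨F y, hy.trans ?_⟩
  rw [setLAverage_eq, ENNReal.mul_div_right_comm.symm]
  gcongr
  calc ∫⁻ y in B, ∫⁻ x in B, ‖F x - F y‖ₑ ^ 2
      = ∫⁻ x in B, ∫⁻ y in B, ‖F x - F y‖ₑ ^ 2 := lintegral_lintegral_swap hm.aemeasurable
    _ ≤ ∫⁻ x in B, ∫⁻ h in Metric.ball (0 : E3) (2 * r), ‖F (x - h) - F x‖ₑ ^ 2 := by
        refine setLIntegral_mono' hBm fun x hx => ?_
        rw [← lintegral_indicator hBm, ← lintegral_indicator Metric.isOpen_ball.measurableSet,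
          ← lintegral_sub_left_eq_self _ x]
        refine lintegral_mono fun h => ?_
        by_cases hh : x - h ∈ B
        · have : h ∈ Metric.ball (0 : E3) (2 * r) := by
            rw [Metric.mem_ball, dist_eq_norm] at *
            have e : h - 0 = (x - x₀) - (x - h - x₀) := by abel
            rw [e]
            linarith [norm_sub_le (x - x₀) (x - h - x₀)]
          simp only [hh, this, Set.indicator_of_mem]
          rw [enorm_sub_rev]
        · simp [hh]
    _ = ∫⁻ h in Metric.ball (0 : E3) (2 * r), ∫⁻ x in B, ‖F (x - h) - F x‖ₑ ^ 2 := by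
        refine lintegral_lintegral_swap (Measurable.aemeasurable ?_)
        exact (Continuous.measurable
          (by fun_prop : Continuous fun z : E3 × E3 => ‖F (z.1 - z.2) - F z.1‖ₑ)).pow_const 2
    _ ≤ ∫⁻ h in Metric.ball (0 : E3) (2 * r),
          ENNReal.ofReal (2 * r) ^ 2 * ∫⁻ x in Ω, ‖gradient F x‖ₑ ^ 2 := by
        refine setLIntegral_mono' Metric.isOpen_ball.measurableSet fun h hh => ?_
        rw [Metric.mem_ball, dist_zero_right] at hh
        refine (lintegral_sub_translate_sq_le (d := h) hΩ hBm (fun x hx t ht0 ht1 => hb ?_) hF).trans ?_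
        · rw [Metric.mem_ball, dist_eq_norm] at *
          have e : x - t • h - x₀ = (x - x₀) - t • h := by abel
          have h2 : ‖t • h‖ ≤ ‖h‖ := by
            rw [norm_smul, Real.norm_of_nonneg ht0]
            exact mul_le_of_le_one_left (norm_nonneg _) ht1
          rw [e]
          linarith [norm_sub_le (x - x₀) (t • h)]
        · gcongr
          rw [← ofReal_norm]
          exact ENNReal.ofReal_le_ofReal hh.le
    _ = _ := by
        rw [setLIntegral_const]
        ring

theorem volume_pos {Ω : Set E3} (hΩ : IsSmoothBoundedDomain Ω) : volume Ω ≠ 0 :=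
  (hΩ.isOpen.measure_pos volume hΩ.isConnected.nonempty).ne'

theorem volume_lt_top {Ω : Set E3} (hΩ : IsSmoothBoundedDomain Ω) : volume Ω < ⊤ :=
  hΩ.isBounded.measure_lt_top

theorem isFiniteMeasure_vol {Ω : Set E3} (hΩ : IsSmoothBoundedDomain Ω) :
    IsFiniteMeasure (vol Ω) := ⟨by simpa [vol] using volume_lt_top hΩ⟩

theorem memLp_vol {Ω : Set E3} (hΩ : IsSmoothBoundedDomain Ω) {E : Type*} [NormedAddCommGroup E]
    {F : E3 → E} (hF : Continuous F) (p : ℝ≥0∞) : MemLp F p (vol Ω) := by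
  have := isFiniteMeasure_vol hΩ
  obtain ⟨C, hC⟩ := (hΩ.isBounded.isCompact_closure).exists_bound_of_continuousOn hF.continuousOn
  refine MemLp.of_bound (C := C)
    hF.aestronglyMeasurable ?_
  exact (ae_restrict_iff' hΩ.isOpen.measurableSet).2
    (Eventually.of_forall fun x hx => hC x (subset_closure hx))

/-- The Poincaré inequality for smooth functions on `Ω`. -/
theorem exists_poincare {Ω : Set E3} (hΩ : IsSmoothBoundedDomain Ω) :
    ∃ C : NNReal, ∀ F : E3 → ℝ, ContDiff ℝ ∞ F →
      eLpNorm F 2 (vol Ω) ≤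
        C * (eLpNorm (gradient F) 2 (vol Ω) + ‖⨍ x, F x ∂(vol Ω)‖ₑ) := by
  have hfin := isFiniteMeasure_vol hΩ
  have hm := hΩ.isOpen.measurableSet
  obtain ⟨x₀, hx₀⟩ := hΩ.isConnected.nonempty
  obtain ⟨r, hr, hb⟩ := Metric.isOpen_iff.1 hΩ.isOpen x₀ hx₀
  obtain ⟨C1, h1⟩ := exists_const_lintegral_ball_le hm (x₀ := x₀) (r := r / 3) (by positivity)
    (by convert! hb using 2; ring)
  obtain ⟨C2, h2⟩ := isGood_self hΩ (r₀ := r / 3) (by positivity) hx₀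
  -- the oscillation about some constant `c`; the average is then within `D * N` of `c`, up to factors
  set D : NNReal := NNReal.sqrt (C2 * (1 + C1)) with hDdef
  have hosc : ∀ F : E3 → ℝ, ContDiff ℝ ∞ F → ∃ c : ℝ,
      eLpNorm (fun x => F x - c) 2 (vol Ω) ≤ D * eLpNorm (gradient F) 2 (vol Ω) := by
    intro F hF
    obtain ⟨c, hc⟩ := h1 F hF
    refine ⟨c, ?_⟩
    have h3 := h2 (fun x => F x - c) (hF.sub contDiff_const)
    simp only [gradient_sub_const] at h3
    rw [← ENNReal.pow_le_pow_left_iff two_ne_zero, mul_pow, eLpNorm_two_sq, eLpNorm_two_sq]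
    refine h3.trans ?_
    calc _ ≤ (C2 : ℝ≥0∞) * ((∫⁻ x in Ω, ‖gradient F x‖ₑ ^ 2) +
          C1 * ∫⁻ x in Ω, ‖gradient F x‖ₑ ^ 2) := by gcongr
      _ = _ := by
        have : (D : ℝ≥0∞) ^ 2 = (C2 * (1 + C1) : NNReal) := by
          rw [hDdef, ← ENNReal.coe_pow, NNReal.sq_sqrt]
        rw [this, vol]
        push_cast
        ring
  set V := (volume Ω) with hV
  have hVt : V ^ (1 / 2 : ℝ) ≠ ⊤ :=
    ENNReal.rpow_ne_top_of_nonneg (by norm_num) (volume_lt_top hΩ).ne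
  have hVi : V⁻¹ ≠ ⊤ := ENNReal.inv_ne_top.2 (volume_pos hΩ)
  have hVol : vol Ω Set.univ = V := by simp [vol, hV]
  refine ⟨D + D * (V⁻¹ * V ^ (1 / 2 : ℝ)).toNNReal * (V ^ (1 / 2 : ℝ)).toNNReal
    + (V ^ (1 / 2 : ℝ)).toNNReal, fun F hF => ?_⟩
  obtain ⟨c, hc⟩ := hosc F hF
  set M := ‖⨍ x, F x ∂(vol Ω)‖ₑ
  set N := eLpNorm (gradient F) 2 (vol Ω)
  have hF1 : Integrable F (vol Ω) := (memLp_vol hΩ hF.continuous 1).integrable le_rfl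
  have hFc : MemLp (fun x => F x - c) 2 (vol Ω) := memLp_vol hΩ (by have := hF.continuous; fun_prop) 2
  have hcM : ‖c‖ₑ ≤ M + V⁻¹ * V ^ (1 / 2 : ℝ) * (D * N) := by
    have e : c = (⨍ x, F x ∂(vol Ω)) - ⨍ x, (F x - c) ∂(vol Ω) := by
      have hne : (vol Ω).real Set.univ ≠ 0 := by
        rw [Measure.real, hVol]
        exact (ENNReal.toReal_pos (volume_pos hΩ) (volume_lt_top hΩ).ne).ne'
      rw [average_eq, average_eq, integral_sub hF1 (integrable_const c), integral_const]
      simp only [smul_eq_mul]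
      field_simp
      ring
    have h4 : ‖⨍ x, (F x - c) ∂(vol Ω)‖ₑ ≤ V⁻¹ * V ^ (1 / 2 : ℝ) * (D * N) := by
      rw [average_eq, enorm_smul, mul_assoc]
      gcongr
      · rw [Measure.real, hVol, ← ENNReal.toReal_inv, Real.enorm_eq_ofReal ENNReal.toReal_nonneg,
          ENNReal.ofReal_toReal hVi]
      · refine (enorm_integral_le_lintegral_enorm _).trans ?_
        rw [← eLpNorm_one_eq_lintegral_enorm]
        refine (eLpNorm_le_eLpNorm_mul_rpow_measure_univ (p := 1) (q := 2) (by norm_num) hFc.1).trans ?_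
        rw [hVol, mul_comm]
        have : (1 / (1 : ℝ≥0∞).toReal - 1 / (2 : ℝ≥0∞).toReal) = (1 / 2 : ℝ) := by norm_num
        rw [this]
        gcongr
    calc ‖c‖ₑ ≤ M + ‖⨍ x, (F x - c) ∂(vol Ω)‖ₑ := by
          conv_lhs => rw [e]
          exact enorm_sub_le
      _ ≤ _ := by gcongr
  have h5 : eLpNorm F 2 (vol Ω) ≤ D * N + ‖c‖ₑ * V ^ (1 / 2 : ℝ) := by
    have e : F = (fun x => F x - c) + fun _ => c := by ext x; simp
    conv_lhs => rw [e]
    refine (eLpNorm_add_le hFc.1 aestronglyMeasurable_const (by norm_num)).trans ?_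
    gcongr
    rw [eLpNorm_const' _ (by norm_num) (by norm_num), hVol]
    norm_num
  refine h5.trans ?_
  push_cast
  rw [ENNReal.coe_toNNReal (ENNReal.mul_ne_top hVi hVt), ENNReal.coe_toNNReal hVt]
  calc (D : ℝ≥0∞) * N + ‖c‖ₑ * V ^ (1 / 2 : ℝ)
      ≤ D * N + (M + V⁻¹ * V ^ (1 / 2 : ℝ) * (D * N)) * V ^ (1 / 2 : ℝ) := by gcongr
    _ = (D + D * (V⁻¹ * V ^ (1 / 2 : ℝ)) * V ^ (1 / 2 : ℝ)) * N + V ^ (1 / 2 : ℝ) * M := by ring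
    _ ≤ _ := by
        rw [mul_add]
        exact add_le_add (mul_le_mul_left le_self_add _) (mul_le_mul_left le_add_self _)

/-! ### The Sobolev inequality -/

/-- Linear changes of variables in Lebesgue integrals, with unspecified Jacobians. -/
theorem exists_lintegral_comp_equiv {V : Type*} [NormedAddCommGroup V] [NormedSpace ℝ V]
    [MeasureSpace V] [BorelSpace V] [(volume : Measure V).IsAddHaarMeasure] (L : V ≃L[ℝ] E3) :
    ∃ a b : NNReal, ∀ h : E3 → ℝ≥0∞, Measurable h →
      ∫⁻ x, h x = a * ∫⁻ c, h (L c) ∧ ∫⁻ c, h (L c) = b * ∫⁻ x, h x := by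
  have hH : (Measure.map L volume).IsAddHaarMeasure := L.isAddHaarMeasure_map volume
  have h1 := Measure.isAddLeftInvariant_eq_smul (volume : Measure E3) (Measure.map L volume)
  have h2 := Measure.isAddLeftInvariant_eq_smul (Measure.map L volume) (volume : Measure E3)
  refine ⟨Measure.addHaarScalarFactor volume (Measure.map L volume),
    Measure.addHaarScalarFactor (Measure.map L volume) volume, fun h hh => ⟨?_, ?_⟩⟩
  · conv_lhs => rw [h1]
    rw [lintegral_smul_measure, lintegral_map hh L.continuous.measurable]
    rfl
  · rw [← lintegral_map hh L.continuous.measurable]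
    conv_lhs => rw [h2]
    rw [lintegral_smul_measure]
    rfl

theorem fderiv_eq_zero_of_notMem_tsupport {G : E3 → ℝ} {y : E3} (hy : y ∉ tsupport G) :
    fderiv ℝ G y = 0 := by
  by_contra h
  exact hy (support_fderiv_subset ℝ h)

theorem gradient_eq_zero_of_notMem_tsupport {G : E3 → ℝ} {y : E3} (hy : y ∉ tsupport G) :
    gradient G y = 0 := by
  simp [gradient, fderiv_eq_zero_of_notMem_tsupport hy]

/-- The line through a point of `Ω` in a coordinate direction of the cone stays in `Ω` upstream,
as long as it stays in the ball; hence a value of `G` is bounded by a line integral over `Ω`. -/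
theorem enorm_le_lintegral_line {Ω : Set E3} {p : E3} {r : ℝ} {P : (Fin 3 → ℝ) ≃L[ℝ] E3}
    (hP : ConeAt Ω p r P) {G : E3 → ℝ} (hG : ContDiff ℝ ∞ G) (hGc : HasCompactSupport G)
    (hGs : tsupport G ⊆ Metric.ball p r) {c : Fin 3 → ℝ} (hc : P c ∈ Ω) (i : Fin 3) :
    ‖G (P c)‖ₑ ≤ ∫⁻ t : ℝ, ‖(P : (Fin 3 → ℝ) →L[ℝ] E3)‖ₑ *
      Ω.indicator (fun x => ‖gradient G x‖ₑ) (P (Function.update c i t)) := by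
  by_cases h0 : P c ∈ tsupport G
  swap
  · rw [image_eq_zero_of_notMem_tsupport h0]; simp
  have hup : ∀ t, Function.update c i t = c + (t - c i) • Pi.single i (1 : ℝ) := by
    intro t; ext j
    by_cases hj : j = i
    · subst hj; simp
    · simp [hj]
  have hcl : Topology.IsClosedEmbedding (fun t : ℝ => P (Function.update c i t)) :=
    P.toHomeomorph.isClosedEmbedding.comp (isClosedEmbedding_update c i)
  have hsm : ContDiff ℝ ∞ fun t : ℝ => G (P (Function.update c i t)) := by
    have h1 : ContDiff ℝ ∞ fun t : ℝ => P (c + (t - c i) • Pi.single i (1 : ℝ)) := by fun_prop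
    simp only [hup]
    exact hG.comp h1
  have hcs : HasCompactSupport fun t : ℝ => G (P (Function.update c i t)) :=
    hGc.comp_isClosedEmbedding hcl
  have hkey := HasCompactSupport.enorm_le_lintegral_Ici_deriv
    (hsm.of_le (by simp : (1 : WithTop ℕ∞) ≤ ((⊤ : ℕ∞) : WithTop ℕ∞))) hcs (c i)
  simp only [Function.update_eq_self] at hkey
  refine hkey.trans ((setLIntegral_mono' measurableSet_Iic fun t ht => ?_).trans
    (setLIntegral_le_lintegral (Set.Iic (c i)) _))
  have hd : HasDerivAt (fun t : ℝ => G (P (Function.update c i t)))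
      (fderiv ℝ G (P (Function.update c i t)) (P (Pi.single i (1 : ℝ)))) t := by
    have h1 : HasDerivAt (fun t : ℝ => P (Function.update c i t)) (P (Pi.single i (1 : ℝ))) t := by
      simp only [hup]
      have h2 : HasDerivAt (fun t : ℝ => c + (t - c i) • Pi.single (M := fun _ => ℝ) i (1 : ℝ))
          (Pi.single i (1 : ℝ)) t := by
        simpa using (((hasDerivAt_id t).sub_const (c i)).smul_const
          (Pi.single (M := fun _ => ℝ) i (1 : ℝ))).const_add c
      exact (P : (Fin 3 → ℝ) →L[ℝ] E3).hasFDerivAt.comp_hasDerivAt t h2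
    exact (hG.differentiable (by simp) _).hasFDerivAt.comp_hasDerivAt t h1
  rw [hd.deriv]
  by_cases hy : P (Function.update c i t) ∈ tsupport G
  · have hyΩ : P (Function.update c i t) ∈ Ω := by
      have e : P (Function.update c i t) = P c - P ((c i - t) • Pi.single i (1 : ℝ)) := by
        rw [hup, ← map_sub]
        congr 1
        module
      have hyb := hGs hy
      rw [e] at hyb ⊢
      refine hP _ hc (hGs h0) _ (fun j => ?_) hyb
      have : 0 ≤ c i - t := sub_nonneg.2 ht
      by_cases hj : j = i
      · subst hj; simpa using this
      · simp [hj]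
    rw [Set.indicator_of_mem hyΩ, enorm_gradient, mul_comm]
    refine (ContinuousLinearMap.le_opENorm _ _).trans ?_
    gcongr
    refine (ContinuousLinearMap.le_opENorm (P : (Fin 3 → ℝ) →L[ℝ] E3) _).trans ?_
    have : ‖(Pi.single i (1 : ℝ) : Fin 3 → ℝ)‖ₑ = 1 := by
      rw [← ofReal_norm, Pi.norm_single]; simp
    rw [this, mul_one]
  · simp [fderiv_eq_zero_of_notMem_tsupport hy]

/-- The `W^{1,1} → L^{3/2}` inequality of Gagliardo and Nirenberg in a patch of `Ω`: the grid-lines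
lemma of Mathlib applies to the coordinates of the cone, since lines upstream stay in `Ω`. -/
theorem exists_gagliardo {Ω : Set E3} (hΩ : MeasurableSet Ω) {p : E3} {r : ℝ}
    {P : (Fin 3 → ℝ) ≃L[ℝ] E3} (hP : ConeAt Ω p r P) :
    ∃ C : NNReal, ∀ G : E3 → ℝ, ContDiff ℝ ∞ G → HasCompactSupport G →
      tsupport G ⊆ Metric.ball p r →
      ∫⁻ x in Ω, ‖G x‖ₑ ^ (3 / 2 : ℝ) ≤ C * (∫⁻ x in Ω, ‖gradient G x‖ₑ) ^ (3 / 2 : ℝ) := by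
  obtain ⟨a, b, hab⟩ := exists_lintegral_comp_equiv P
  set M : NNReal := ‖(P : (Fin 3 → ℝ) →L[ℝ] E3)‖₊
  refine ⟨a * (b * M) ^ (3 / 2 : ℝ), fun G hG hGc hGs => ?_⟩
  set f : (Fin 3 → ℝ) → ℝ≥0∞ := fun c => ‖(P : (Fin 3 → ℝ) →L[ℝ] E3)‖ₑ *
      Ω.indicator (fun x => ‖gradient G x‖ₑ) (P c) with hf
  have hgm : Measurable (Ω.indicator (fun x => ‖gradient G x‖ₑ)) :=
    ((continuous_gradient hG).enorm.measurable).indicator hΩ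
  have hfm : Measurable f := (hgm.comp P.continuous.measurable).const_mul _
  have hconj : Real.HolderConjugate (Fintype.card (Fin 3)) (3 / 2 : ℝ) := by
    rw [Real.holderConjugate_iff]; norm_num
  have hgrid := lintegral_prod_lintegral_pow_le (fun _ : Fin 3 => (volume : Measure ℝ)) hconj hfm
  rw [← volume_pi] at hgrid
  have hpt : ∀ c : Fin 3 → ℝ, Ω.indicator (fun x => ‖G x‖ₑ ^ (3 / 2 : ℝ)) (P c) ≤
      ∏ i, (∫⁻ t : ℝ, f (Function.update c i t)) ^ ((1 : ℝ) / (Fintype.card (Fin 3) - 1 : ℝ)) := by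
    intro c
    by_cases hc : P c ∈ Ω
    · rw [Set.indicator_of_mem hc]
      calc ‖G (P c)‖ₑ ^ (3 / 2 : ℝ)
          = ∏ _i : Fin 3, ‖G (P c)‖ₑ ^ ((1 : ℝ) / (Fintype.card (Fin 3) - 1 : ℝ)) := by
            rw [Finset.prod_const, ← ENNReal.rpow_natCast, ← ENNReal.rpow_mul]
            norm_num
        _ ≤ _ := by
            refine Finset.prod_le_prod' fun i _ => ENNReal.rpow_le_rpow ?_ (by norm_num)
            exact enorm_le_lintegral_line hP hG hGc hGs hc i
    · rw [Set.indicator_of_notMem hc]; exact zero_le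
  have hGm : Measurable (Ω.indicator (fun x => ‖G x‖ₑ ^ (3 / 2 : ℝ))) :=
    ((hG.continuous.enorm.measurable).pow_const _).indicator hΩ
  calc ∫⁻ x in Ω, ‖G x‖ₑ ^ (3 / 2 : ℝ)
      = a * ∫⁻ c, Ω.indicator (fun x => ‖G x‖ₑ ^ (3 / 2 : ℝ)) (P c) := by
        rw [← lintegral_indicator hΩ]; exact (hab _ hGm).1
    _ ≤ a * (∫⁻ c, f c) ^ (3 / 2 : ℝ) := by
        gcongr
        exact (lintegral_mono hpt).trans hgrid
    _ = a * (M * (b * ∫⁻ x in Ω, ‖gradient G x‖ₑ)) ^ (3 / 2 : ℝ) := by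
        have e : ∫⁻ c, f c = M * ∫⁻ c, Ω.indicator (fun x => ‖gradient G x‖ₑ) (P c) :=
          lintegral_const_mul _ (hgm.comp P.continuous.measurable)
        rw [e, (hab _ hgm).2, lintegral_indicator hΩ]
    _ = _ := by
        rw [← mul_assoc, ENNReal.mul_rpow_of_nonneg _ _ (by norm_num), ENNReal.coe_mul,
          ENNReal.coe_rpow_of_nonneg _ (by norm_num), ENNReal.coe_mul, mul_comm (M : ℝ≥0∞)]
        ring

theorem gradient_pow_four {H : E3 → ℝ} (hH : ContDiff ℝ ∞ H) (x : E3) :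
    gradient (fun y => H y ^ 4) x = (4 * H x ^ 3) • gradient H x := by
  have := gradient_comp (G := fun t : ℝ => t ^ 4) (contDiff_id.pow 4) hH x
  rw [this]
  simp

/-- The passage from `W^{1,1} → L^{3/2}` to `H¹ → L⁶`: the former is applied to `H ^ 4`. -/
theorem eLpNorm_six_le_of_gagliardo {Ω : Set E3} (hΩ : IsSmoothBoundedDomain Ω) {C : NNReal}
    {H : E3 → ℝ} (hH : ContDiff ℝ ∞ H)
    (h : ∫⁻ x in Ω, ‖H x ^ 4‖ₑ ^ (3 / 2 : ℝ) ≤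
      C * (∫⁻ x in Ω, ‖gradient (fun y => H y ^ 4) x‖ₑ) ^ (3 / 2 : ℝ)) :
    eLpNorm H 6 (vol Ω) ≤ (4 * C ^ (2 / 3 : ℝ) : NNReal) * eLpNorm (gradient H) 2 (vol Ω) := by
  have hcg := continuous_gradient hH
  have hN : eLpNorm H 6 (vol Ω) ≠ ⊤ := (memLp_vol hΩ hH.continuous 6).2.ne
  set N := eLpNorm H 6 (vol Ω) with hNdef
  set Y := eLpNorm (gradient H) 2 (vol Ω)
  have hX : ∫⁻ x in Ω, ‖H x‖ₑ ^ 6 = N ^ 6 := by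
    rw [hNdef, eLpNorm_eq_lintegral_rpow_enorm_toReal (by norm_num) (by norm_num),
      ← ENNReal.rpow_natCast, ← ENNReal.rpow_mul]
    norm_num
    rfl
  have hL : ∫⁻ x in Ω, ‖H x ^ 4‖ₑ ^ (3 / 2 : ℝ) = N ^ 6 := by
    rw [← hX]
    refine lintegral_congr fun x => ?_
    rw [enorm_pow, ← ENNReal.rpow_natCast, ← ENNReal.rpow_mul, ← ENNReal.rpow_natCast]
    norm_num
  have hR : ∫⁻ x in Ω, ‖gradient (fun y => H y ^ 4) x‖ₑ ≤ 4 * (N ^ 3 * Y) := by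
    have hhol := ENNReal.lintegral_mul_le_Lp_mul_Lq (vol Ω) Real.HolderConjugate.two_two
      (f := fun x => ‖H x‖ₑ ^ 3) (g := fun x => ‖gradient H x‖ₑ)
      ((hH.continuous.enorm.measurable).pow_const 3).aemeasurable
      hcg.enorm.measurable.aemeasurable
    have e1 : (∫⁻ x, (‖H x‖ₑ ^ 3) ^ (2 : ℝ) ∂(vol Ω)) ^ (1 / 2 : ℝ) = N ^ 3 := by
      have : ∀ x, (‖H x‖ₑ ^ 3) ^ (2 : ℝ) = ‖H x‖ₑ ^ 6 := fun x => by
        rw [← ENNReal.rpow_natCast, ← ENNReal.rpow_mul, ← ENNReal.rpow_natCast]; norm_num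
      simp only [this]
      rw [vol, hX, ← ENNReal.rpow_natCast, ← ENNReal.rpow_mul, ← ENNReal.rpow_natCast]; norm_num
    have e2 : (∫⁻ x, ‖gradient H x‖ₑ ^ (2 : ℝ) ∂(vol Ω)) ^ (1 / 2 : ℝ) = Y := by
      simp only [Y]
      rw [eLpNorm_eq_lintegral_rpow_enorm_toReal (by norm_num) (by norm_num)]
      norm_num
    rw [e1, e2] at hhol
    calc ∫⁻ x in Ω, ‖gradient (fun y => H y ^ 4) x‖ₑ
        = ∫⁻ x in Ω, 4 * (‖H x‖ₑ ^ 3 * ‖gradient H x‖ₑ) := by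
          refine lintegral_congr fun x => ?_
          rw [gradient_pow_four hH, enorm_smul, enorm_mul, enorm_pow, mul_assoc]
          congr 1
          rw [Real.enorm_eq_ofReal (by norm_num)]; norm_num
      _ = 4 * ∫⁻ x in Ω, ‖H x‖ₑ ^ 3 * ‖gradient H x‖ₑ :=
          lintegral_const_mul' _ _ (by norm_num)
      _ ≤ _ := by gcongr; exact hhol
  rw [hL] at h
  have h1 : N ^ 6 ≤ C * (4 * (N ^ 3 * Y)) ^ (3 / 2 : ℝ) := h.trans (by gcongr)
  have h2 : N ^ 4 ≤ C ^ (2 / 3 : ℝ) * (4 * (N ^ 3 * Y)) := by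
    have := ENNReal.rpow_le_rpow h1 (by norm_num : (0 : ℝ) ≤ 2 / 3)
    rw [ENNReal.mul_rpow_of_nonneg _ _ (by norm_num), ← ENNReal.rpow_mul, ← ENNReal.rpow_natCast,
      ← ENNReal.rpow_mul] at this
    norm_num at this
    rw [← ENNReal.rpow_natCast]
    norm_num
    exact this
  -- one can divide by `N ^ 3`, because `N` is finite
  rcases eq_or_ne N 0 with h0 | h0
  · rw [h0]; exact zero_le
  have h3 : N ^ 3 * N ≤ N ^ 3 * ((4 * C ^ (2 / 3 : ℝ) : NNReal) * Y) := by
    calc N ^ 3 * N = N ^ 4 := by ring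
      _ ≤ _ := h2
      _ = _ := by
        push_cast
        rw [← ENNReal.coe_rpow_of_nonneg _ (by norm_num)]
        ring
  exact (ENNReal.mul_le_mul_iff_right (pow_ne_zero 3 h0) (ENNReal.pow_ne_top hN)).1 h3

theorem eLpNorm_le_mul_add_of_enorm_le {X : Type*} [MeasurableSpace X] {μ : Measure X}
    {E F G : Type*} [NormedAddCommGroup E] [NormedAddCommGroup F] [NormedAddCommGroup G]
    {f : X → E} {g : X → F} {h : X → G} {C : NNReal}
    (hle : ∀ x, ‖f x‖ₑ ≤ C * (‖g x‖ₑ + ‖h x‖ₑ)) (hg : AEStronglyMeasurable g μ)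
    (hh : AEStronglyMeasurable h μ) {p : ℝ≥0∞} (hp : 1 ≤ p) :
    eLpNorm f p μ ≤ C * (eLpNorm g p μ + eLpNorm h p μ) := by
  have h1 : ∀ x, ‖f x‖ ≤ C * ‖‖g x‖ + ‖h x‖‖ := by
    intro x
    rw [Real.norm_of_nonneg (by positivity)]
    have := ENNReal.toReal_mono (by finiteness) (hle x)
    rw [ENNReal.toReal_mul, ENNReal.toReal_add (by simp) (by simp)] at this
    simpa using this
  refine (eLpNorm_le_mul_eLpNorm_of_ae_le_mul (Eventually.of_forall h1) p).trans ?_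
  rw [ENNReal.ofReal_coe_nnreal]
  gcongr
  refine (eLpNorm_add_le hg.norm hh.norm hp).trans ?_
  rw [eLpNorm_norm, eLpNorm_norm]

/-- The Sobolev inequality `H¹(Ω) → L⁶(Ω)` for smooth functions. -/
theorem exists_sobolev {Ω : Set E3} (hΩ : IsSmoothBoundedDomain Ω) :
    ∃ C : NNReal, ∀ F : E3 → ℝ, ContDiff ℝ ∞ F →
      eLpNorm F 6 (vol Ω) ≤ C * (eLpNorm F 2 (vol Ω) + eLpNorm (gradient F) 2 (vol Ω)) := by
  have hm := hΩ.isOpen.measurableSet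
  have hloc : ∀ p : E3, ∃ r : ℝ, p ∈ closure Ω → 0 < r ∧ ∃ C : NNReal, ∀ G : E3 → ℝ,
      ContDiff ℝ ∞ G → HasCompactSupport G → tsupport G ⊆ Metric.ball p r →
      ∫⁻ x in Ω, ‖G x‖ₑ ^ (3 / 2 : ℝ) ≤ C * (∫⁻ x in Ω, ‖gradient G x‖ₑ) ^ (3 / 2 : ℝ) := by
    intro p
    by_cases hp : p ∈ closure Ω
    · obtain ⟨r, hr, P, hP⟩ := exists_coneAt hΩ hp
      exact ⟨r, fun _ => ⟨hr, exists_gagliardo hm hP⟩⟩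
    · exact ⟨0, fun h => absurd h hp⟩
  choose ρ hρ using hloc
  obtain ⟨t, η, ht, hη, hηc, hηs, hsum⟩ := exists_partition hΩ.isBounded.isCompact_closure ρ
    fun p hp => (hρ p hp).1
  have hone : ∀ p : E3, ∃ C : NNReal, p ∈ t → ∀ F : E3 → ℝ, ContDiff ℝ ∞ F →
      eLpNorm (fun x => η p x * F x) 6 (vol Ω) ≤
        C * (eLpNorm F 2 (vol Ω) + eLpNorm (gradient F) 2 (vol Ω)) := by
    intro p
    by_cases hp : p ∈ t
    swap
    · exact ⟨0, fun h => absurd h hp⟩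
    obtain ⟨C, hC⟩ := (hρ p (ht p hp)).2
    obtain ⟨C', hC'⟩ := exists_enorm_gradient_mul_le (hη p) (hηc p)
    refine ⟨4 * C ^ (2 / 3 : ℝ) * C', fun _ F hF => ?_⟩
    have hH : ContDiff ℝ ∞ fun x => η p x * F x := (hη p).mul hF
    have hsupp : tsupport (fun x => (η p x * F x) ^ 4) ⊆ tsupport (η p) := by
      refine closure_mono fun x hx => ?_
      simp only [Function.mem_support] at hx ⊢
      intro h0; simp [h0] at hx
    have h1 := eLpNorm_six_le_of_gagliardo hΩ hH (hC _ (hH.pow 4)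
      ((hηc p).of_isClosed_subset (isClosed_tsupport _) hsupp) (hsupp.trans (hηs p hp)))
    refine h1.trans ?_
    rw [ENNReal.coe_mul _ C', mul_assoc]
    gcongr
    exact eLpNorm_le_mul_add_of_enorm_le (fun x => hC' F hF x)
      hF.continuous.aestronglyMeasurable (continuous_gradient hF).aestronglyMeasurable (by norm_num)
  choose C hC using hone
  refine ⟨∑ p ∈ t, C p, fun F hF => ?_⟩
  have hae : F =ᵐ[vol Ω] ∑ p ∈ t, fun x => η p x * F x := by
    refine (ae_restrict_iff' hm).2 (Eventually.of_forall fun x hx => ?_)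
    rw [Finset.sum_apply, ← Finset.sum_mul, hsum x (subset_closure hx), one_mul]
  rw [eLpNorm_congr_ae hae]
  refine (eLpNorm_sum_le (fun p _ => ((hη p).mul hF).continuous.aestronglyMeasurable)
    (by norm_num)).trans ?_
  rw [ENNReal.ofNNReal_finsetSum, Finset.sum_mul]
  exact Finset.sum_le_sum fun p hp => hC p hp F hF

/-! ### The trace inequality -/

theorem euclideanHausdorffMeasure_image_le {E₂ : Type*} [EMetricSpace E₂] [MeasurableSpace E₂]
    [BorelSpace E₂] {Γ : EuclideanSpace ℝ (Fin 2) → E₂} {D : Set (EuclideanSpace ℝ (Fin 2))}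
    {K : NNReal} (hΓ : LipschitzOnWith K Γ D) :
    (Measure.euclideanHausdorffMeasure 2 : Measure E₂) (Γ '' D) ≤ (K : ℝ≥0∞) ^ 2 * volume D := by
  have h := hΓ.hausdorffMeasure_image_le (d := (2 : ℕ)) (by positivity)
  rw [← EuclideanSpace.euclideanHausdorffMeasure_eq_volume 2]
  rw [Measure.euclideanHausdorffMeasure_def, Measure.euclideanHausdorffMeasure_def]
  simp only [Measure.smul_apply, ENNReal.smul_def, smul_eq_mul]
  rw [mul_left_comm]
  gcongr
  rwa [ENNReal.rpow_natCast] at h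

/-- Surface integrals over a Lipschitz parametrized surface are bounded by parameter integrals. -/
theorem setLIntegral_image_le {Γ : EuclideanSpace ℝ (Fin 2) → E3} (hΓc : Continuous Γ)
    {D : Set (EuclideanSpace ℝ (Fin 2))} {K : NNReal} (hΓ : LipschitzOnWith K Γ D)
    {h : E3 → ℝ≥0∞} (hh : Measurable h) :
    ∫⁻ x in Γ '' D, h x ∂(Measure.euclideanHausdorffMeasure 2 : Measure E3) ≤
      (K : ℝ≥0∞) ^ 2 * ∫⁻ y, h (Γ y) := by
  have hle : (Measure.euclideanHausdorffMeasure 2 : Measure E3).restrict (Γ '' D) ≤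
      (K : ℝ≥0∞) ^ 2 • Measure.map Γ volume := by
    refine Measure.le_iff.2 fun S hS => ?_
    rw [Measure.restrict_apply hS, Measure.smul_apply, Measure.map_apply hΓc.measurable hS,
      smul_eq_mul]
    have e : S ∩ Γ '' D = Γ '' (D ∩ Γ ⁻¹' S) := by
      rw [Set.image_inter_preimage, Set.inter_comm]
    rw [e]
    refine (euclideanHausdorffMeasure_image_le (hΓ.mono Set.inter_subset_left)).trans ?_
    gcongr
    exact Set.inter_subset_right
  refine (lintegral_mono' hle le_rfl).trans ?_
  rw [lintegral_smul_measure, lintegral_map hh hΓc.measurable, smul_eq_mul]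

/-- The coordinates (horizontal part, height) in the orthonormal frame of `L`. The product carries the
sup norm, so this is only a linear homeomorphism. -/
def cylinderEquiv (L : E3 ≃ₗᵢ[ℝ] E3) : (EuclideanSpace ℝ (Fin 2) × ℝ) ≃L[ℝ] E3 :=
  (LinearEquiv.trans
    { toFun := fun z : EuclideanSpace ℝ (Fin 2) × ℝ => (!₂[z.1 0, z.1 1, z.2] : E3)
      invFun := fun x => (!₂[x 0, x 1], x 2)
      map_add' := fun a b => by ext i; fin_cases i <;> simp
      map_smul' := fun a b => by ext i; fin_cases i <;> simp
      left_inv := fun z => by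
        refine Prod.ext ?_ ?_
        · ext i; fin_cases i <;> simp
        · simp
      right_inv := fun x => by ext i; fin_cases i <;> simp } L.symm.toLinearEquiv).toContinuousLinearEquiv

theorem cylinderEquiv_apply (L : E3 ≃ₗᵢ[ℝ] E3) (z : EuclideanSpace ℝ (Fin 2) × ℝ) :
    cylinderEquiv L z = L.symm !₂[z.1 0, z.1 1, z.2] := rfl

/-- In a boundary patch, a value of `G` on the graph is the integral of its derivative along the
vertical half-line above, which lies in `Ω` as long as it meets the support of `G`. -/
theorem exists_trace_patch {Ω : Set E3} (hΩ : IsSmoothBoundedDomain Ω) {p : E3}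
    (hp : p ∈ frontier Ω) :
    ∃ r : ℝ, 0 < r ∧ ∃ C : NNReal, ∀ G : E3 → ℝ, ContDiff ℝ ∞ G → HasCompactSupport G →
      tsupport G ⊆ Metric.ball p r →
      ∫⁻ x, ‖G x‖ₑ ∂(surf Ω) ≤ C * ∫⁻ x in Ω, ‖gradient G x‖ₑ := by
  obtain ⟨r, hr, L, γ, hγ, hloc⟩ := hΩ.smooth_boundary p hp
  have hm := hΩ.isOpen.measurableSet
  set Q := cylinderEquiv L with hQ
  have hLQ : ∀ y t, L (Q (y, t)) = !₂[y 0, y 1, t] := fun y t => by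
    rw [hQ, cylinderEquiv_apply, LinearIsometryEquiv.apply_symm_apply]
  have hπQ : ∀ (y : EuclideanSpace ℝ (Fin 2)) (t : ℝ),
      (!₂[L (Q (y, t)) 0, L (Q (y, t)) 1] : EuclideanSpace ℝ (Fin 2)) = y := fun y t => by
    rw [hLQ]; ext i; fin_cases i <;> simp
  set Γ : EuclideanSpace ℝ (Fin 2) → E3 := fun y => Q (y, γ y) with hΓdef
  have hΓs : ContDiff ℝ ∞ Γ := Q.contDiff.comp (contDiff_id.prodMk hγ)
  set π : E3 → EuclideanSpace ℝ (Fin 2) := fun x => !₂[L x 0, L x 1] with hπ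
  have hπc : Continuous π := by fun_prop
  set D := Metric.closedBall (π p) r
  obtain ⟨K, hK⟩ : ∃ K, LipschitzOnWith K Γ D :=
    ((hΓs.of_le (by simp : (1 : WithTop ℕ∞) ≤ ((⊤ : ℕ∞) : WithTop ℕ∞))).contDiffOn).exists_lipschitzOnWith
      one_ne_zero (convex_closedBall _ _) (isCompact_closedBall _ _)
  -- the boundary is locally contained in the graph
  have hgraph : frontier Ω ∩ Metric.ball p r ⊆ Γ '' D := by
    rintro x ⟨hxf, hxb⟩
    rw [hΩ.isOpen.frontier_eq] at hxf
    have h1 : L x 2 ≤ γ (π x) := not_lt.1 fun h => hxf.2 ((hloc x hxb).2 h)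
    have h2 : γ (π x) ≤ L x 2 := by
      by_contra hlt
      push Not at hlt
      have hc1 : Continuous fun x : E3 => L x 2 := by fun_prop
      have hc2 : Continuous fun x : E3 => γ (π x) := hγ.continuous.comp hπc
      have hev : ∀ᶠ z in 𝓝 x, L z 2 < γ (π z) ∧ z ∈ Metric.ball p r :=
        (hc1.continuousAt.eventually_lt hc2.continuousAt hlt).and
          (Metric.isOpen_ball.mem_nhds hxb)
      obtain ⟨z, hz, hz1, hz2⟩ := ((mem_closure_iff_frequently.1 hxf.1).and_eventually hev).exists
      exact absurd ((hloc z hz2).1 hz) (not_lt.2 hz1.le)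
    refine ⟨π x, ?_, ?_⟩
    · rw [Metric.mem_closedBall, EuclideanSpace.dist_eq]
      have h3 : dist (L x) (L p) < r := by rw [L.dist_map]; exact hxb
      rw [EuclideanSpace.dist_eq] at h3
      refine le_trans (Real.sqrt_le_sqrt ?_) h3.le
      rw [Fin.sum_univ_two, Fin.sum_univ_three]
      simp only [hπ]
      have := sq_nonneg (dist (L x 2) (L p 2))
      simp
    · refine L.injective ?_
      rw [hΓdef, hLQ, le_antisymm h2 h1]
      ext i; fin_cases i <;> simp [hπ]
  have : (volume : Measure (EuclideanSpace ℝ (Fin 2) × ℝ)).IsAddHaarMeasure :=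
    inferInstanceAs ((volume : Measure (EuclideanSpace ℝ (Fin 2))).prod
      (volume : Measure ℝ)).IsAddHaarMeasure
  obtain ⟨a, b, hab⟩ := exists_lintegral_comp_equiv Q
  set M : NNReal := ‖(Q : (EuclideanSpace ℝ (Fin 2) × ℝ) →L[ℝ] E3)‖₊ with hM
  refine ⟨r, hr, K ^ 2 * (M * b), fun G hG hGc hGs => ?_⟩
  set f : E3 → ℝ≥0∞ := Ω.indicator (fun x => ‖gradient G x‖ₑ) with hf
  have hfm : Measurable f := ((continuous_gradient hG).enorm.measurable).indicator hm
  have hmap : ∀ y : EuclideanSpace ℝ (Fin 2), ‖G (Γ y)‖ₑ ≤ M * ∫⁻ t : ℝ, f (Q (y, t)) := by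
    intro y
    have hcl : Topology.IsClosedEmbedding (fun t : ℝ => Q (y, -t)) :=
      Q.toHomeomorph.isClosedEmbedding.comp
        ((Function.LeftInverse.isClosedEmbedding (f := Prod.snd) (g := fun t : ℝ => (y, t))
          (fun _ => rfl) continuous_snd (by fun_prop)).comp (Homeomorph.neg ℝ).isClosedEmbedding)
    have hsm : ContDiff ℝ ∞ fun t : ℝ => G (Q (y, -t)) :=
      hG.comp (Q.contDiff.comp (contDiff_const.prodMk contDiff_neg))
    have hcs : HasCompactSupport fun t : ℝ => G (Q (y, -t)) := hGc.comp_isClosedEmbedding hcl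
    have hkey := HasCompactSupport.enorm_le_lintegral_Ici_deriv
      (hsm.of_le (by simp : (1 : WithTop ℕ∞) ≤ ((⊤ : ℕ∞) : WithTop ℕ∞))) hcs (-γ y)
    rw [neg_neg, ← setLIntegral_congr Iio_ae_eq_Iic] at hkey
    have hneg : ∫⁻ t : ℝ, f (Q (y, t)) = ∫⁻ t : ℝ, f (Q (y, -t)) :=
      (lintegral_neg_eq_self (fun t => f (Q (y, t)))).symm
    rw [hneg, ← lintegral_const_mul' _ _ ENNReal.coe_ne_top]
    refine hkey.trans ((setLIntegral_mono' measurableSet_Iio fun t ht => ?_).trans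
      (setLIntegral_le_lintegral (Set.Iio (-γ y)) _))
    have hd : HasDerivAt (fun t : ℝ => G (Q (y, -t)))
        (fderiv ℝ G (Q (y, -t)) (Q (0, -1))) t := by
      have h1 : HasDerivAt (fun t : ℝ => Q (y, -t)) (Q (0, -1)) t :=
        (Q : (EuclideanSpace ℝ (Fin 2) × ℝ) →L[ℝ] E3).hasFDerivAt.comp_hasDerivAt t
          ((hasDerivAt_const t y).prodMk (hasDerivAt_neg t))
      exact (hG.differentiable (by simp) _).hasFDerivAt.comp_hasDerivAt t h1
    rw [hd.deriv]
    by_cases hy : Q (y, -t) ∈ tsupport G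
    · have hyΩ : Q (y, -t) ∈ Ω := by
        rw [hloc _ (hGs hy), hπQ, hLQ]
        have : t < -γ y := ht
        simp; linarith
      rw [hf, Set.indicator_of_mem hyΩ, enorm_gradient, mul_comm]
      refine (ContinuousLinearMap.le_opENorm _ _).trans ?_
      gcongr
      refine (ContinuousLinearMap.le_opENorm (Q : (EuclideanSpace ℝ (Fin 2) × ℝ) →L[ℝ] E3) _).trans ?_
      have : ‖((0, -1) : EuclideanSpace ℝ (Fin 2) × ℝ)‖ₑ = 1 := by
        rw [← ofReal_norm, Prod.norm_def]; simp
      rw [this, mul_one, hM, enorm_eq_nnnorm]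
    · simp [fderiv_eq_zero_of_notMem_tsupport hy]
  calc ∫⁻ x, ‖G x‖ₑ ∂(surf Ω)
      ≤ ∫⁻ x in Γ '' D, ‖G x‖ₑ ∂(Measure.euclideanHausdorffMeasure 2 : Measure E3) := by
        have hfr : MeasurableSet (frontier Ω) := isClosed_frontier.measurableSet
        have hGD : MeasurableSet (Γ '' D) :=
          ((isCompact_closedBall _ _).image hΓs.continuous).isClosed.measurableSet
        rw [surf, ← lintegral_indicator hfr, ← lintegral_indicator hGD]
        refine lintegral_mono fun x => ?_
        by_cases hx : x ∈ frontier Ω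
        · by_cases hxb : x ∈ Metric.ball p r
          · simp [hx, hgraph ⟨hx, hxb⟩]
          · have : G x = 0 := image_eq_zero_of_notMem_tsupport fun h => hxb (hGs h)
            simp [this, hx]
        · simp [hx]
    _ ≤ (K : ℝ≥0∞) ^ 2 * ∫⁻ y, ‖G (Γ y)‖ₑ :=
        setLIntegral_image_le hΓs.continuous hK hG.continuous.enorm.measurable
    _ ≤ (K : ℝ≥0∞) ^ 2 * ∫⁻ y, M * ∫⁻ t : ℝ, f (Q (y, t)) := by
        gcongr with y
        exact hmap y
    _ = (K : ℝ≥0∞) ^ 2 * (M * ∫⁻ z : EuclideanSpace ℝ (Fin 2) × ℝ, f (Q z)) := by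
        have e : ∫⁻ z : EuclideanSpace ℝ (Fin 2) × ℝ, f (Q z) = ∫⁻ y, ∫⁻ t : ℝ, f (Q (y, t)) :=
          lintegral_prod _ (hfm.comp Q.continuous.measurable).aemeasurable
        rw [lintegral_const_mul' _ _ ENNReal.coe_ne_top, e]
    _ = _ := by
        rw [(hab f hfm).2, hf, lintegral_indicator hm]
        push_cast
        ring

/-- The trace inequality `W^{1,1}(Ω) → L¹(∂Ω)` for smooth functions. -/
theorem exists_trace_inequality {Ω : Set E3} (hΩ : IsSmoothBoundedDomain Ω) :
    ∃ C : NNReal, ∀ F : E3 → ℝ, ContDiff ℝ ∞ F →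
      ∫⁻ x, ‖F x‖ₑ ∂(surf Ω) ≤ C * ∫⁻ x in Ω, (‖F x‖ₑ + ‖gradient F x‖ₑ) := by
  have hm := hΩ.isOpen.measurableSet
  have hloc : ∀ p : E3, ∃ r : ℝ, p ∈ frontier Ω → 0 < r ∧ ∃ C : NNReal, ∀ G : E3 → ℝ,
      ContDiff ℝ ∞ G → HasCompactSupport G → tsupport G ⊆ Metric.ball p r →
      ∫⁻ x, ‖G x‖ₑ ∂(surf Ω) ≤ C * ∫⁻ x in Ω, ‖gradient G x‖ₑ := by
    intro p
    by_cases hp : p ∈ frontier Ω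
    · obtain ⟨r, hr, h⟩ := exists_trace_patch hΩ hp
      exact ⟨r, fun _ => ⟨hr, h⟩⟩
    · exact ⟨0, fun h => absurd h hp⟩
  choose ρ hρ using hloc
  obtain ⟨t, η, ht, hη, hηc, hηs, hsum⟩ := exists_partition
    (hΩ.isBounded.isCompact_closure.of_isClosed_subset isClosed_frontier frontier_subset_closure) ρ
    fun p hp => (hρ p hp).1
  have hone : ∀ p : E3, ∃ C : NNReal, p ∈ t → ∀ F : E3 → ℝ, ContDiff ℝ ∞ F →
      ∫⁻ x, ‖η p x * F x‖ₑ ∂(surf Ω) ≤ C * ∫⁻ x in Ω, (‖F x‖ₑ + ‖gradient F x‖ₑ) := by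
    intro p
    by_cases hp : p ∈ t
    swap
    · exact ⟨0, fun h => absurd h hp⟩
    obtain ⟨C, hC⟩ := (hρ p (ht p hp)).2
    obtain ⟨C', hC'⟩ := exists_enorm_gradient_mul_le (hη p) (hηc p)
    refine ⟨C * C', fun _ F hF => ?_⟩
    have hsupp : tsupport (fun x => η p x * F x) ⊆ tsupport (η p) := tsupport_mul_subset_left
    refine (hC _ ((hη p).mul hF) ((hηc p).mul_right) (hsupp.trans (hηs p hp))).trans ?_
    rw [ENNReal.coe_mul, mul_assoc]
    refine mul_le_mul_right ?_ _
    rw [← lintegral_const_mul' _ _ ENNReal.coe_ne_top]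
    exact lintegral_mono fun x => hC' F hF x
  choose C hC using hone
  refine ⟨∑ p ∈ t, C p, fun F hF => ?_⟩
  calc ∫⁻ x, ‖F x‖ₑ ∂(surf Ω) ≤ ∫⁻ x, ∑ p ∈ t, ‖η p x * F x‖ₑ ∂(surf Ω) := by
        refine setLIntegral_mono' isClosed_frontier.measurableSet fun x hx => ?_
        have : F x = ∑ p ∈ t, η p x * F x := by
          rw [← Finset.sum_mul, hsum x hx, one_mul]
        conv_lhs => rw [this]
        exact enorm_sum_le _ _
    _ = ∑ p ∈ t, ∫⁻ x, ‖η p x * F x‖ₑ ∂(surf Ω) :=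
        lintegral_finsetSum _ fun p _ => ((hη p).mul hF).continuous.enorm.measurable
    _ ≤ ∑ p ∈ t, C p * ∫⁻ x in Ω, (‖F x‖ₑ + ‖gradient F x‖ₑ) :=
        Finset.sum_le_sum fun p hp => hC p hp F hF
    _ = _ := by rw [ENNReal.ofNNReal_finsetSum, Finset.sum_mul]

/-! ### Mollification and density of smooth functions -/

section Mollify

variable {E : Type*} [NormedAddCommGroup E] [NormedSpace ℝ E]

/-- Translations act continuously on `L²`. -/
theorem tendsto_eLpNorm_translate_sub {E : Type*} [NormedAddCommGroup E] {w : E3 → E}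
    (hw : MemLp w 2 (volume : Measure E3)) :
    Tendsto (fun z : E3 => eLpNorm (fun x => w (x - z) - w x) 2 volume) (𝓝 0) (𝓝 0) := by
  set g : C(E3, C(E3, E3)) := ContinuousMap.curry ⟨fun z : E3 × E3 => z.2 - z.1, by fun_prop⟩
  have hmp : ∀ z, MeasurePreserving (g z) (volume : Measure E3) volume :=
    fun z => measurePreserving_sub_right volume z
  have h := Tendsto.compMeasurePreservingLp (tendsto_const_nhds (x := hw.toLp w))
    (g.continuous.tendsto 0) hmp (hmp 0) (by norm_num)
  have h2 := tendsto_iff_edist_tendsto_0.1 h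
  refine h2.congr fun z => ?_
  rw [Lp.edist_def]
  refine eLpNorm_congr_ae ?_
  have e : ∀ z, (Lp.compMeasurePreserving (g z) (hmp z) (hw.toLp w) : E3 → E) =ᵐ[volume]
      fun x => w (x - z) := fun z =>
    (Lp.coeFn_compMeasurePreserving _ (hmp z)).trans
      ((hmp z).quasiMeasurePreserving.ae_eq_comp hw.coeFn_toLp)
  filter_upwards [e z, e 0] with x h1 h2
  simp only [Pi.sub_apply]
  rw [h1, h2, sub_zero]

/-- The convolution of `w` with the scalar kernel `k`. -/
def mollify (k : E3 → ℝ) (w : E3 → E) (x : E3) : E := ∫ z, k z • w (x - z)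

theorem mollify_eq_swap (k : E3 → ℝ) (w : E3 → E) (x : E3) :
    mollify k w x = ∫ y, k (x - y) • w y := by
  rw [mollify, ← integral_sub_left_eq_self _ volume x]
  simp

theorem integrable_mollify {k : E3 → ℝ} (hk : Continuous k) (hkc : HasCompactSupport k) {w : E3 → E}
    (hw : LocallyIntegrable w) (x : E3) : Integrable fun z => k z • w (x - z) :=
  hkc.convolutionExists_left (ContinuousLinearMap.lsmul ℝ ℝ) hk hw x

/-- The distance from `w` to its mollification is at most the largest translation error over the
support of the kernel. -/
theorem eLpNorm_mollify_sub_le [CompleteSpace E] {k : E3 → ℝ} (hk : Continuous k)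
    (hkc : HasCompactSupport k)
    (hk0 : ∀ z, 0 ≤ k z) (hk1 : ∫ z, k z = 1) {w : E3 → E} (hws : StronglyMeasurable w)
    (hw : MemLp w 2 (volume : Measure E3)) {δ : ℝ≥0∞}
    (hδ : ∀ z, k z ≠ 0 → eLpNorm (fun x => w (x - z) - w x) 2 volume ≤ δ) :
    eLpNorm (fun x => mollify k w x - w x) 2 volume ≤ δ := by
  have hkm : Measurable fun z => ENNReal.ofReal (k z) := hk.measurable.ennreal_ofReal
  have hkint : Integrable k := hk.integrable_of_hasCompactSupport hkc
  set ν : Measure E3 := volume.withDensity fun z => ENNReal.ofReal (k z) with hν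
  have hνp : IsProbabilityMeasure ν := ⟨by
    rw [hν, withDensity_apply _ MeasurableSet.univ, setLIntegral_univ,
      ← ofReal_integral_eq_lintegral_ofReal hkint (Eventually.of_forall hk0), hk1,
      ENNReal.ofReal_one]⟩
  have hloc : LocallyIntegrable w := hw.locallyIntegrable (by norm_num)
  have hmeas : StronglyMeasurable (Function.uncurry fun (x z : E3) => w (x - z) - w x) :=
    (hws.comp_measurable (measurable_fst.sub measurable_snd)).sub (hws.comp_measurable measurable_fst)
  have hm2 : Measurable (Function.uncurry fun (x z : E3) => ‖w (x - z) - w x‖ₑ ^ 2) :=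
    hmeas.enorm.pow_const 2
  have hpt : ∀ x, ‖mollify k w x - w x‖ₑ ^ 2 ≤ ∫⁻ z, ‖w (x - z) - w x‖ₑ ^ 2 ∂ν := by
    intro x
    have e : mollify k w x - w x = ∫ z, k z • (w (x - z) - w x) := by
      simp only [smul_sub]
      rw [integral_sub (integrable_mollify hk hkc hloc x) (hkint.smul_const _),
        integral_smul_const, hk1, one_smul, mollify]
    have hmx : Measurable fun z => ‖w (x - z) - w x‖ₑ :=
      (hmeas.comp_measurable (measurable_prodMk_left (x := x))).enorm
    rw [e]
    calc _ ≤ (∫⁻ z, ‖k z • (w (x - z) - w x)‖ₑ) ^ 2 := by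
          gcongr; exact enorm_integral_le_lintegral_enorm _
      _ = (∫⁻ z, ‖w (x - z) - w x‖ₑ ∂ν) ^ 2 := by
          rw [hν, lintegral_withDensity_eq_lintegral_mul _ hkm hmx]
          congr 1
          refine lintegral_congr fun z => ?_
          rw [enorm_smul, Pi.mul_apply, Real.enorm_eq_ofReal (hk0 z)]
      _ ≤ _ := lintegral_sq_le hmx.aemeasurable
  rw [← ENNReal.pow_le_pow_left_iff two_ne_zero, eLpNorm_two_sq]
  calc _ ≤ ∫⁻ x, ∫⁻ z, ‖w (x - z) - w x‖ₑ ^ 2 ∂ν := lintegral_mono hpt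
    _ = ∫⁻ z, (∫⁻ x, ‖w (x - z) - w x‖ₑ ^ 2) ∂ν := lintegral_lintegral_swap hm2.aemeasurable
    _ ≤ ∫⁻ _z, δ ^ 2 ∂ν := by
        refine lintegral_mono_ae ?_
        rw [hν, ae_withDensity_iff hkm]
        refine Eventually.of_forall fun z hz => ?_
        rw [← eLpNorm_two_sq]
        have hz0 : k z ≠ 0 := fun h => hz (by simp [h])
        exact pow_le_pow_left' (hδ z hz0) 2
    _ = δ ^ 2 := by simp

theorem contDiff_mollify {k : E3 → ℝ} (hk : ContDiff ℝ ∞ k) (hkc : HasCompactSupport k)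
    {w : E3 → ℝ} (hw : LocallyIntegrable w) : ContDiff ℝ ∞ (mollify k w) :=
  hkc.contDiff_convolution_left (ContinuousLinearMap.lsmul ℝ ℝ) hk hw

theorem gradient_mollify {k : E3 → ℝ} (hk : ContDiff ℝ ∞ k) (hkc : HasCompactSupport k)
    {w : E3 → ℝ} (hw : LocallyIntegrable w) (x : E3) :
    gradient (mollify k w) x = ∫ y, w y • gradient k (x - y) := by
  have h := hkc.hasFDerivAt_convolution_left (ContinuousLinearMap.lsmul ℝ ℝ : ℝ →L[ℝ] ℝ →L[ℝ] ℝ)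
    (hk.of_le (by simp : (1 : WithTop ℕ∞) ≤ ((⊤ : ℕ∞) : WithTop ℕ∞))) hw x
  rw [convolution_eq_swap] at h
  have e : ∀ y, (ContinuousLinearMap.precompL E3 (ContinuousLinearMap.lsmul ℝ ℝ : ℝ →L[ℝ] ℝ →L[ℝ] ℝ)
      (fderiv ℝ k (x - y))) (w y) = w y • fderiv ℝ k (x - y) := fun y => by
    ext v
    rw [ContinuousLinearMap.precompL_apply]
    simp [mul_comm]
  simp only [e] at h
  have h2 : fderiv ℝ (mollify k w) x = ∫ y, w y • fderiv ℝ k (x - y) := h.fderiv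
  rw [gradient, h2]
  have hcf : Continuous (fderiv ℝ k) := hk.continuous_fderiv (by simp)
  have hcs : IsCompact ((fun y => x - y) ⁻¹' tsupport (fderiv ℝ k)) :=
    (Homeomorph.subLeft x).isClosedEmbedding.isCompact_preimage (hkc.fderiv (𝕜 := ℝ)).isCompact
  have hcs1 : HasCompactSupport fun y => fderiv ℝ k (x - y) :=
    HasCompactSupport.of_support_subset_isCompact hcs fun y hy => subset_tsupport _ hy
  have hcs2 : HasCompactSupport fun y => gradient k (x - y) :=
    hcs1.comp_left (g := (InnerProductSpace.toDual ℝ E3).symm) (map_zero _)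
  have i1 : Integrable fun y => w y • fderiv ℝ k (x - y) :=
    hw.integrable_smul_right_of_hasCompactSupport (by fun_prop) hcs1
  have i2 : Integrable fun y => w y • gradient k (x - y) :=
    hw.integrable_smul_right_of_hasCompactSupport
      ((continuous_gradient hk).comp (by fun_prop)) hcs2
  refine ext_inner_right ℝ fun v => ?_
  rw [InnerProductSpace.toDual_symm_apply, ContinuousLinearMap.integral_apply i1, real_inner_comm,
    ← integral_inner i2]
  refine integral_congr_ae (Eventually.of_forall fun y => ?_)
  simp [inner_smul_right]

end Mollify

/-- A mollifier supported in the intersection of a cone and a small ball. -/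
theorem exists_cone_kernel (P : (Fin 3 → ℝ) ≃L[ℝ] E3) {ε : ℝ} (hε : 0 < ε) :
    ∃ k : E3 → ℝ, ContDiff ℝ ∞ k ∧ HasCompactSupport k ∧ (∀ z, 0 ≤ k z) ∧ ∫ z, k z = 1 ∧
      ∀ z ∈ tsupport k, ‖z‖ < ε ∧ ∀ i, 0 ≤ P.symm z i := by
  set U : Set E3 := {z | ‖z‖ < ε ∧ ∀ i, 0 < P.symm z i} with hU
  have hUo : IsOpen U := by
    refine (isOpen_lt continuous_norm continuous_const).inter ?_
    have : {z : E3 | ∀ i, 0 < P.symm z i} = ⋂ i, {z | 0 < P.symm z i} := by ext; simp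
    change IsOpen {z : E3 | ∀ i, 0 < P.symm z i}
    rw [this]
    refine isOpen_iInter_of_finite fun i => isOpen_lt continuous_const ?_
    fun_prop
  obtain ⟨d, hd⟩ : U.Nonempty := by
    have hc : ContinuousAt (fun s : ℝ => ‖P (fun _ => s)‖) 0 := by fun_prop
    have h0 : ∀ᶠ s in 𝓝 (0 : ℝ), ‖P (fun _ => s)‖ < ε := by
      refine hc.eventually_lt continuousAt_const ?_
      have : P (fun _ : Fin 3 => (0 : ℝ)) = 0 := map_zero P
      simpa [this]
    obtain ⟨s, hs1, hs2⟩ := ((h0.filter_mono nhdsWithin_le_nhds).and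
      (self_mem_nhdsWithin (s := Set.Ioi (0 : ℝ)))).exists
    exact ⟨P fun _ => s, hs1, fun i => by simpa using hs2⟩
  obtain ⟨R, hR, hb⟩ := Metric.isOpen_iff.1 hUo d hd
  let f : ContDiffBump d := ⟨R / 4, R / 2, by positivity, by linarith⟩
  refine ⟨f.normed volume, f.contDiff_normed, f.hasCompactSupport_normed, f.nonneg_normed,
    f.integral_normed, fun z hz => ?_⟩
  rw [f.tsupport_normed_eq] at hz
  have := hb (Metric.closedBall_subset_ball (show R / 2 < R by linarith) hz)
  exact ⟨this.1, fun i => (this.2 i).le⟩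

/-- If the kernel looks into `Ω` from every point of `Ω` near the support of `η`, then
mollification of `η u` commutes with weak differentiation in `Ω`. -/
theorem gradient_mollify_eq {Ω : Set E3} (hΩ : IsSmoothBoundedDomain Ω) {u : E3 → ℝ}
    {Du : E3 → E3} (h : MemH1 Ω u Du) {η k : E3 → ℝ} (hη : ContDiff ℝ ∞ η)
    (hηc : HasCompactSupport η) (hk : ContDiff ℝ ∞ k) (hkc : HasCompactSupport k)
    (hloc : LocallyIntegrable (Ω.indicator fun y => η y * u y)) {x : E3}
    (hx : ∀ z ∈ tsupport k, x - z ∈ tsupport η → x - z ∈ Ω) :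
    gradient (mollify k (Ω.indicator fun y => η y * u y)) x =
      mollify k (Ω.indicator fun y => η y • Du y + u y • gradient η y) x := by
  have hfin := isFiniteMeasure_vol hΩ
  have hm := hΩ.isOpen.measurableSet
  have hkx : ContDiff ℝ ∞ fun y => k (x - y) := hk.comp (contDiff_const.sub contDiff_id)
  have hgkx : ∀ y, gradient (fun y => k (x - y)) y = - gradient k (x - y) := by
    intro y
    have h1 : HasFDerivAt (fun y => k (x - y)) (-(fderiv ℝ k (x - y))) y := by
      have h2 : HasFDerivAt (fun y : E3 => x - y) (-ContinuousLinearMap.id ℝ E3) y :=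
        (hasFDerivAt_id y).const_sub x
      have h3 := (hk.differentiable (by simp) (x - y)).hasFDerivAt.comp y h2
      refine h3.congr_fderiv ?_
      ext v; simp
    rw [gradient, h1.fderiv, map_neg, gradient]
  have htest : IsTestFunction Ω (fun y => η y * k (x - y)) := by
    refine ⟨hη.mul hkx, hηc.mul_right, fun y hy => ?_⟩
    have hy1 : y ∈ tsupport η := tsupport_mul_subset_left hy
    have hy2 : x - y ∈ tsupport k := by
      have h3 : tsupport (fun y => k (x - y)) ⊆ (fun y => x - y) ⁻¹' tsupport k := by
        refine closure_minimal (fun z hz => subset_tsupport _ hz)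
          ((isClosed_tsupport k).preimage (by fun_prop))
      exact h3 (tsupport_mul_subset_right hy)
    have := hx (x - y) hy2
    rw [sub_sub_cancel] at this
    exact this hy1
  have hw := h.weak_grad _ htest
  simp only [gradient_mul hη hkx, hgkx, smul_add] at hw
  have hu1 := h.memLp
  have bdd : ∀ {g : E3 → E3}, Continuous g → Integrable (fun y => u y • g y) (vol Ω) := by
    intro g hg
    have h1 := (memLp_vol hΩ hg 2).smul (r := 1) hu1
    exact h1.integrable le_rfl
  have hckx : Continuous fun y => k (x - y) := hkx.continuous
  have hcη := hη.continuous
  have hcgη := continuous_gradient hη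
  have hcgk : Continuous fun y => gradient k (x - y) := (continuous_gradient hk).comp (by fun_prop)
  have i1 : Integrable (fun y => u y • η y • -gradient k (x - y)) (vol Ω) := bdd (by fun_prop)
  have i2 : Integrable (fun y => u y • k (x - y) • gradient η y) (vol Ω) := bdd (by fun_prop)
  have i3 : Integrable (fun y => (η y * k (x - y)) • Du y) (vol Ω) := by
    have h1 := h.memLp_grad.smul (r := 1)
      (memLp_vol hΩ (by fun_prop : Continuous fun y => η y * k (x - y)) 2)
    exact h1.integrable le_rfl
  rw [integral_add i1 i2] at hw
  rw [gradient_mollify hk hkc hloc, mollify_eq_swap]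
  have e1 : ∫ y, (Ω.indicator (fun y => η y * u y) y) • gradient k (x - y) =
      - ∫ y, u y • η y • -gradient k (x - y) ∂(vol Ω) := by
    rw [← integral_neg, vol, ← integral_indicator hm]
    refine integral_congr_ae (Eventually.of_forall fun y => ?_)
    by_cases hy : y ∈ Ω
    · simp [hy, smul_smul, mul_comm]
    · simp [hy]
  have e2 : ∫ y, k (x - y) • (Ω.indicator (fun y => η y • Du y + u y • gradient η y) y) =
      (∫ y, (η y * k (x - y)) • Du y ∂(vol Ω)) + ∫ y, u y • k (x - y) • gradient η y ∂(vol Ω) := by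
    rw [← integral_add i3 i2, vol, ← integral_indicator hm]
    refine integral_congr_ae (Eventually.of_forall fun y => ?_)
    by_cases hy : y ∈ Ω
    · simp only [hy, Set.indicator_of_mem, smul_add, smul_smul]
      rw [mul_comm (η y), mul_comm (u y)]
    · simp [hy]
  rw [e1, e2]
  rw [← sub_eq_zero]
  rw [← sub_eq_zero] at hw
  rw [← neg_eq_zero, ← hw]
  abel

/-- Local approximation by smooth functions: mollify with a kernel supported in the inner cone. -/
theorem exists_smooth_approx_patch {Ω : Set E3} (hΩ : IsSmoothBoundedDomain Ω) {u : E3 → ℝ}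
    {Du : E3 → E3} (h : MemH1 Ω u Du) (hus : StronglyMeasurable u) (hDus : StronglyMeasurable Du)
    {p : E3} {r : ℝ} {P : (Fin 3 → ℝ) ≃L[ℝ] E3} (hP : ConeAt Ω p r P) {η : E3 → ℝ}
    (hη : ContDiff ℝ ∞ η) (hηc : HasCompactSupport η) (hηs : tsupport η ⊆ Metric.ball p r)
    {δ : ℝ≥0∞} (hδ : 0 < δ) :
    ∃ f : E3 → ℝ, ContDiff ℝ ∞ f ∧
      eLpNorm (fun x => f x - η x * u x) 2 (vol Ω) ≤ δ ∧
      eLpNorm (fun x => gradient f x - (η x • Du x + u x • gradient η x)) 2 (vol Ω) ≤ δ := by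
  have hm := hΩ.isOpen.measurableSet
  have hcη := hη.continuous
  have hcgη := continuous_gradient hη
  set v : E3 → ℝ := Ω.indicator fun y => η y * u y with hv
  set W : E3 → E3 := Ω.indicator fun y => η y • Du y + u y • gradient η y with hW
  have hvs : StronglyMeasurable v := (hcη.stronglyMeasurable.mul hus).indicator hm
  have hWs : StronglyMeasurable W :=
    ((hcη.stronglyMeasurable.smul hDus).add (hus.smul hcgη.stronglyMeasurable)).indicator hm
  obtain ⟨C1, h1⟩ := hηc.exists_bound_of_continuous hcη
  obtain ⟨C2, h2⟩ : ∃ C, ∀ x, ‖gradient η x‖ ≤ C := by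
    obtain ⟨C, hC⟩ := (hηc.fderiv (𝕜 := ℝ)).exists_bound_of_continuous
      (hη.continuous_fderiv (by simp))
    exact ⟨C, fun x => by rw [norm_gradient]; exact hC x⟩
  have hvL : MemLp v 2 (volume : Measure E3) := by
    rw [hv, memLp_indicator_iff_restrict hm]
    exact (h.memLp.mul (p := ⊤) (r := 2) (memLp_top_of_bound hcη.aestronglyMeasurable C1
      (Eventually.of_forall h1)))
  have hWL : MemLp W 2 (volume : Measure E3) := by
    rw [hW, memLp_indicator_iff_restrict hm]
    refine MemLp.add ?_ ?_
    · exact h.memLp_grad.smul (p := ⊤) (r := 2) (memLp_top_of_bound hcη.aestronglyMeasurable C1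
        (Eventually.of_forall h1))
    · exact (memLp_top_of_bound hcgη.aestronglyMeasurable C2 (Eventually.of_forall h2)).smul
        (p := 2) (r := 2) h.memLp
  have hvloc : LocallyIntegrable v := hvL.locallyIntegrable (by norm_num)
  obtain ⟨ε1, hε1, he1⟩ := Metric.eventually_nhds_iff.1
    ((tendsto_eLpNorm_translate_sub hvL).eventually (ge_mem_nhds hδ))
  obtain ⟨ε2, hε2, he2⟩ := Metric.eventually_nhds_iff.1
    ((tendsto_eLpNorm_translate_sub hWL).eventually (ge_mem_nhds hδ))
  obtain ⟨ε3, hε3, he3⟩ := hηc.isCompact.exists_thickening_subset_open Metric.isOpen_ball hηs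
  obtain ⟨k, hk, hkc, hk0, hk1, hks⟩ := exists_cone_kernel P (lt_min hε1 (lt_min hε2 hε3))
  have hks' : ∀ z, k z ≠ 0 → ‖z‖ < min ε1 (min ε2 ε3) := fun z hz => (hks z (subset_tsupport _ hz)).1
  refine ⟨mollify k v, contDiff_mollify hk hkc hvloc, ?_, ?_⟩
  · have h3 := eLpNorm_mollify_sub_le hk.continuous hkc hk0 hk1 hvs hvL (δ := δ) fun z hz =>
      he1 (by rw [dist_zero_right]; exact (hks' z hz).trans_le (min_le_left _ _))
    refine le_trans ?_ ((eLpNorm_mono_measure _ (Measure.restrict_le_self (s := Ω))).trans h3)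
    refine le_of_eq (eLpNorm_congr_ae ?_)
    refine (ae_restrict_iff' hm).2 (Eventually.of_forall fun x hx => ?_)
    simp [hv, hx]
  · have h3 := eLpNorm_mollify_sub_le hk.continuous hkc hk0 hk1 hWs hWL (δ := δ) fun z hz =>
      he2 (by rw [dist_zero_right]; exact (hks' z hz).trans_le ((min_le_right _ _).trans (min_le_left _ _)))
    refine le_trans ?_ ((eLpNorm_mono_measure _ (Measure.restrict_le_self (s := Ω))).trans h3)
    refine le_of_eq (eLpNorm_congr_ae ?_)
    refine (ae_restrict_iff' hm).2 (Eventually.of_forall fun x hx => ?_)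
    have hg := gradient_mollify_eq hΩ h hη hηc hk hkc hvloc (x := x) fun z hz hxz => by
      obtain ⟨hz1, hz2⟩ := hks z hz
      have hxb : x ∈ Metric.ball p r := he3 (Metric.mem_thickening_iff.2 ⟨x - z, hxz, by
        rw [dist_eq_norm, sub_sub_cancel]
        exact hz1.trans_le ((min_le_right _ _).trans (min_le_right _ _))⟩)
      have := hP x hx hxb (P.symm z) hz2
      rw [ContinuousLinearEquiv.apply_symm_apply] at this
      exact this (hηs hxz)
    simp only
    rw [hg]
    simp [hW, hx]

/-- Density of smooth functions, for representatives that are strongly measurable. -/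
theorem exists_tendstoH1_of_stronglyMeasurable {Ω : Set E3} (hΩ : IsSmoothBoundedDomain Ω)
    {u : E3 → ℝ} {Du : E3 → E3} (h : MemH1 Ω u Du) (hus : StronglyMeasurable u)
    (hDus : StronglyMeasurable Du) :
    ∃ f : ℕ → E3 → ℝ, (∀ n, ContDiff ℝ ∞ (f n)) ∧ TendstoH1 Ω f u Du := by
  have hm := hΩ.isOpen.measurableSet
  have hloc : ∀ p : E3, ∃ (r : ℝ) (P : (Fin 3 → ℝ) ≃L[ℝ] E3), p ∈ closure Ω →
      0 < r ∧ ConeAt Ω p r P := by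
    intro p
    by_cases hp : p ∈ closure Ω
    · obtain ⟨r, hr, P, hP⟩ := exists_coneAt hΩ hp
      exact ⟨r, P, fun _ => ⟨hr, hP⟩⟩
    · exact ⟨0, (slopeEquiv 1 one_ne_zero).toContinuousLinearEquiv, fun h => absurd h hp⟩
  choose ρ P hρ using hloc
  obtain ⟨t, η, ht, hη, hηc, hηs, hsum⟩ := exists_partition hΩ.isBounded.isCompact_closure ρ
    fun p hp => (hρ p hp).1
  -- the gradients of a partition of unity sum to zero
  have hgsum : ∀ x ∈ Ω, ∑ p ∈ t, gradient (η p) x = 0 := by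
    intro x hx
    rw [← gradient_sum t (fun p _ => hη p) x]
    have hev : (fun y => ∑ p ∈ t, η p y) =ᶠ[𝓝 x] fun _ => 1 :=
      eventually_of_mem (hΩ.isOpen.mem_nhds hx) fun y hy => hsum y (subset_closure hy)
    rw [gradient, hev.fderiv_eq]
    simp
  have happ : ∀ (n : ℕ) (p : E3), ∃ f : E3 → ℝ, p ∈ t → ContDiff ℝ ∞ f ∧
      eLpNorm (fun x => f x - η p x * u x) 2 (vol Ω) ≤ ((n : ℝ≥0∞) + 1)⁻¹ ∧
      eLpNorm (fun x => gradient f x - (η p x • Du x + u x • gradient (η p) x)) 2 (vol Ω) ≤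
        ((n : ℝ≥0∞) + 1)⁻¹ := by
    intro n p
    by_cases hp : p ∈ t
    · obtain ⟨f, hf⟩ := exists_smooth_approx_patch hΩ h hus hDus (hρ p (ht p hp)).2 (hη p) (hηc p)
        (hηs p hp) (δ := ((n : ℝ≥0∞) + 1)⁻¹) (by simp)
      exact ⟨f, fun _ => hf⟩
    · exact ⟨0, fun h => absurd h hp⟩
  choose f hf using happ
  have hlim : Tendsto (fun n : ℕ => ∑ _p ∈ t, ((n : ℝ≥0∞) + 1)⁻¹) atTop (𝓝 0) := by
    have h1 : Tendsto (fun n : ℕ => ((n : ℝ≥0∞) + 1)⁻¹) atTop (𝓝 0) := by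
      have := (tendsto_add_atTop_iff_nat (f := fun n : ℕ => (n : ℝ≥0∞)⁻¹) 1).2
        ENNReal.tendsto_inv_nat_nhds_zero
      simpa using this
    simpa using tendsto_finsetSum t fun _ _ => h1
  refine ⟨fun n x => ∑ p ∈ t, f n p x, fun n => ContDiff.sum fun p hp => (hf n p hp).1, ?_, ?_⟩
  · refine tendsto_of_tendsto_of_tendsto_of_le_of_le tendsto_const_nhds hlim (fun _ => zero_le)
      fun n => ?_
    have e : (fun x => (∑ p ∈ t, f n p x) - u x) =ᵐ[vol Ω]
        ∑ p ∈ t, fun x => f n p x - η p x * u x := by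
      refine (ae_restrict_iff' hm).2 (Eventually.of_forall fun x hx => ?_)
      rw [Finset.sum_apply, Finset.sum_sub_distrib, ← Finset.sum_mul, hsum x (subset_closure hx),
        one_mul]
    simp only
    rw [eLpNorm_congr_ae e]
    refine (eLpNorm_sum_le (fun p hp => ?_) (by norm_num)).trans
      (Finset.sum_le_sum fun p hp => (hf n p hp).2.1)
    exact ((hf n p hp).1.continuous.aestronglyMeasurable).sub
      ((hη p).continuous.aestronglyMeasurable.mul hus.aestronglyMeasurable)
  · refine tendsto_of_tendsto_of_tendsto_of_le_of_le tendsto_const_nhds hlim (fun _ => zero_le)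
      fun n => ?_
    have e : (fun x => gradient (fun x => ∑ p ∈ t, f n p x) x - Du x) =ᵐ[vol Ω]
        ∑ p ∈ t, fun x => gradient (f n p) x - (η p x • Du x + u x • gradient (η p) x) := by
      refine (ae_restrict_iff' hm).2 (Eventually.of_forall fun x hx => ?_)
      rw [Finset.sum_apply, Finset.sum_sub_distrib, Finset.sum_add_distrib, ← Finset.sum_smul,
        ← Finset.smul_sum, hsum x (subset_closure hx), hgsum x hx, one_smul, smul_zero, add_zero]
      simp only
      rw [gradient_sum t fun p hp => (hf n p hp).1]
    simp only
    rw [eLpNorm_congr_ae e]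
    refine (eLpNorm_sum_le (fun p hp => ?_) (by norm_num)).trans
      (Finset.sum_le_sum fun p hp => (hf n p hp).2.2)
    exact ((continuous_gradient (hf n p hp).1).aestronglyMeasurable).sub
      (((hη p).continuous.aestronglyMeasurable.smul hDus.aestronglyMeasurable).add
        (hus.aestronglyMeasurable.smul (continuous_gradient (hη p)).aestronglyMeasurable))

theorem MemH1.congr {Ω : Set E3} {u v : E3 → ℝ} {Du Dv : E3 → E3} (h : MemH1 Ω u Du)
    (hu : u =ᵐ[vol Ω] v) (hD : Du =ᵐ[vol Ω] Dv) : MemH1 Ω v Dv where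
  memLp := (memLp_congr_ae hu).1 h.memLp
  memLp_grad := (memLp_congr_ae hD).1 h.memLp_grad
  weak_grad f hf := by
    rw [← integral_congr_ae (hD.mono fun x hx => by simp only [hx] :
        (fun x => f x • Du x) =ᵐ[vol Ω] fun x => f x • Dv x),
      ← integral_congr_ae (hu.mono fun x hx => by simp only [hx] :
        (fun x => u x • gradient f x) =ᵐ[vol Ω] fun x => v x • gradient f x)]
    exact h.weak_grad f hf

/-- The functions smooth on the whole space are dense in `H¹(Ω)`. -/
theorem MemH1.exists_tendstoH1 {Ω : Set E3} (hΩ : IsSmoothBoundedDomain Ω) {u : E3 → ℝ}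
    {Du : E3 → E3} (h : MemH1 Ω u Du) :
    ∃ f : ℕ → E3 → ℝ, (∀ n, ContDiff ℝ ∞ (f n)) ∧ TendstoH1 Ω f u Du := by
  obtain ⟨f, hf, h1, h2⟩ := exists_tendstoH1_of_stronglyMeasurable hΩ
    (h.congr h.memLp.1.ae_eq_mk h.memLp_grad.1.ae_eq_mk) h.memLp.1.stronglyMeasurable_mk
    h.memLp_grad.1.stronglyMeasurable_mk
  exact ⟨f, hf, TendstoL2.congr_limit h1 h.memLp.1.ae_eq_mk.symm,
    TendstoL2.congr_limit h2 h.memLp_grad.1.ae_eq_mk.symm⟩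

/-! ### Sobolev functions and their traces -/

theorem integral_gradient_eq_zero {F : E3 → ℝ} (hF : ContDiff ℝ ∞ F) (hc : HasCompactSupport F) :
    ∫ x, gradient F x = 0 := by
  have hcg := continuous_gradient hF
  have hgc : HasCompactSupport (gradient F) :=
    (hc.fderiv (𝕜 := ℝ)).comp_left (g := (InnerProductSpace.toDual ℝ E3).symm) (map_zero _)
  refine ext_inner_left ℝ fun v => ?_
  rw [← integral_inner (hcg.integrable_of_hasCompactSupport hgc), inner_zero_right]
  have h := integral_mul_fderiv_eq_neg_fderiv_mul_of_integrable (μ := (volume : Measure E3))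
    (f := fun _ => (1 : ℝ)) (g := F) (v := v) (by simp) ?_ ?_ (fun x _ => by fun_prop)
    (fun x _ => hF.differentiable (by simp) x)
  · simp only [one_mul, fderiv_fun_const, Pi.zero_apply, zero_apply, zero_mul,
      integral_zero, neg_zero] at h
    rw [← h]
    refine integral_congr_ae (Eventually.of_forall fun x => ?_)
    simp only
    rw [real_inner_comm, inner_gradient]
  · simp only [one_mul]
    have hcf : Continuous fun x => fderiv ℝ F x v :=
      (hF.continuous_fderiv (by simp)).clm_apply continuous_const
    exact hcf.integrable_of_hasCompactSupport
      ((hc.fderiv (𝕜 := ℝ)).comp_left (g := fun L : E3 →L[ℝ] ℝ => L v) (by simp))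
  · simpa using hF.continuous.integrable_of_hasCompactSupport hc

theorem memH1_of_contDiff {Ω : Set E3} (hΩ : IsSmoothBoundedDomain Ω) {F : E3 → ℝ}
    (hF : ContDiff ℝ ∞ F) : MemH1 Ω F (gradient F) where
  memLp := memLp_vol hΩ hF.continuous 2
  memLp_grad := memLp_vol hΩ (continuous_gradient hF) 2
  weak_grad f hf := by
    obtain ⟨hf1, hf2, hf3⟩ := hf
    have hcF := hF.continuous
    have hcf := hf1.continuous
    have hcgF := continuous_gradient hF
    have hcgf := continuous_gradient hf1
    have hz : ∀ x ∉ Ω, f x = 0 := fun x hx => image_eq_zero_of_notMem_tsupport fun h => hx (hf3 h)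
    have hgz : ∀ x ∉ Ω, gradient f x = 0 :=
      fun x hx => gradient_eq_zero_of_notMem_tsupport fun h => hx (hf3 h)
    have hgc : HasCompactSupport (gradient f) :=
      (hf2.fderiv (𝕜 := ℝ)).comp_left (g := (InnerProductSpace.toDual ℝ E3).symm) (map_zero _)
    rw [vol, setIntegral_eq_integral_of_forall_compl_eq_zero fun x hx => by simp [hgz x hx],
      setIntegral_eq_integral_of_forall_compl_eq_zero fun x hx => by simp [hz x hx],
      eq_neg_iff_add_eq_zero, ← integral_add]
    · have := integral_gradient_eq_zero (hF.mul hf1) hf2.mul_left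
      simp only [gradient_mul hF hf1] at this
      exact this
    · exact (hcF.smul hcgf).integrable_of_hasCompactSupport hgc.smul_left
    · exact (hcf.smul hcgF).integrable_of_hasCompactSupport hf2.smul_right

/-- An `L²` limit of smooth functions and of their gradients lies in `H¹(Ω)`. -/
theorem memH1_of_tendstoH1 {Ω : Set E3} (hΩ : IsSmoothBoundedDomain Ω) {f : ℕ → E3 → ℝ}
    {u : E3 → ℝ} {Du : E3 → E3} (hf : ∀ n, ContDiff ℝ ∞ (f n)) (h : TendstoH1 Ω f u Du)
    (hu : MemLp u 2 (vol Ω)) (hDu : MemLp Du 2 (vol Ω)) : MemH1 Ω u Du where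
  memLp := hu
  memLp_grad := hDu
  weak_grad g hg := by
    have hcg := hg.1.continuous
    have hcgg := continuous_gradient hg.1
    have hg2 := memLp_vol hΩ hcgg 2
    have hg1 := memLp_vol hΩ hcg 2
    have hfin := isFiniteMeasure_vol hΩ
    obtain ⟨C1, hC1⟩ := hg.2.1.exists_bound_of_continuous hcg
    have hgc : HasCompactSupport (gradient g) :=
      (hg.2.1.fderiv (𝕜 := ℝ)).comp_left (g := (InnerProductSpace.toDual ℝ E3).symm) (map_zero _)
    obtain ⟨C2, hC2⟩ := hgc.exists_bound_of_continuous hcgg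
    have t1 : TendstoL2 (vol Ω) (fun n x => f n x • gradient g x) (fun x => u x • gradient g x) :=
      TendstoL2.of_le h.1 C2 fun n => Eventually.of_forall fun x => by
        rw [← sub_smul, norm_smul, mul_comm]
        exact mul_le_mul_of_nonneg_right (hC2 x) (norm_nonneg _)
    have t2 : TendstoL2 (vol Ω) (fun n x => g x • gradient (f n) x) (fun x => g x • Du x) :=
      TendstoL2.of_le h.2 C1 fun n => Eventually.of_forall fun x => by
        rw [← smul_sub, norm_smul]
        exact mul_le_mul_of_nonneg_right (hC1 x) (norm_nonneg _)
    have btop1 : MemLp (gradient g) ⊤ (vol Ω) :=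
      memLp_top_of_bound hcgg.aestronglyMeasurable C2 (Eventually.of_forall hC2)
    have btop2 : MemLp g ⊤ (vol Ω) :=
      memLp_top_of_bound hcg.aestronglyMeasurable C1 (Eventually.of_forall hC1)
    have l1 := tendsto_integral_of_tendstoL2 t1
      (fun n => memLp_vol hΩ ((hf n).continuous.smul hcgg) 2) (btop1.smul (p := 2) hu)
    have l2 := tendsto_integral_of_tendstoL2 t2
      (fun n => memLp_vol hΩ (hcg.smul (continuous_gradient (hf n))) 2) (hDu.smul (p := ⊤) btop2)
    refine tendsto_nhds_unique l1 ?_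
    refine l2.neg.congr fun n => ?_
    exact ((memH1_of_contDiff hΩ (hf n)).weak_grad g hg).symm

theorem MemH1.sub {Ω : Set E3} (hΩ : IsSmoothBoundedDomain Ω) {u v : E3 → ℝ} {Du Dv : E3 → E3}
    (hu : MemH1 Ω u Du) (hv : MemH1 Ω v Dv) :
    MemH1 Ω (fun x => u x - v x) (fun x => Du x - Dv x) where
  memLp := hu.memLp.sub hv.memLp
  memLp_grad := hu.memLp_grad.sub hv.memLp_grad
  weak_grad f hf := by
    have hfin := isFiniteMeasure_vol hΩ
    have h1 := memLp_vol hΩ hf.1.continuous 2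
    have h2 := memLp_vol hΩ (continuous_gradient hf.1) 2
    simp only [sub_smul, smul_sub]
    rw [integral_sub, integral_sub, hu.weak_grad f hf, hv.weak_grad f hf]
    · abel
    · exact (hu.memLp_grad.smul (r := 1) h1).integrable le_rfl
    · exact (hv.memLp_grad.smul (r := 1) h1).integrable le_rfl
    · exact (h2.smul (r := 1) hu.memLp).integrable le_rfl
    · exact (h2.smul (r := 1) hv.memLp).integrable le_rfl

theorem gradient_neg' (F : E3 → ℝ) (x : E3) : gradient (fun y => -F y) x = -gradient F x := by
  simp only [gradient]
  rw [fderiv_fun_neg, map_neg]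

theorem MemH1.neg {Ω : Set E3} {u : E3 → ℝ} {Du : E3 → E3} (hu : MemH1 Ω u Du) :
    MemH1 Ω (fun x => -u x) (fun x => -Du x) where
  memLp := hu.memLp.neg
  memLp_grad := hu.memLp_grad.neg
  weak_grad f hf := by
    simp only [neg_smul, smul_neg, integral_neg]
    rw [hu.weak_grad f hf]

theorem HasTrace.neg {Ω : Set E3} {u : E3 → ℝ} {Du : E3 → E3} {g : E3 → ℝ}
    (hu : HasTrace Ω u Du g) : HasTrace Ω (fun x => -u x) (fun x => -Du x) (fun x => -g x) := by
  obtain ⟨h1, h2, f, hf, hl, ht⟩ := hu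
  refine ⟨h1.neg, h2.neg, fun n x => -f n x, fun n => (hf n).neg,
    ⟨TendstoL2.neg (f := f) hl.1, ?_⟩, TendstoL2.neg (f := f) ht⟩
  have := TendstoL2.neg (f := fun n => gradient (f n)) hl.2
  simpa only [TendstoL2, gradient_neg'] using this

theorem tendsto_eLpNorm_grad {Ω : Set E3} (hΩ : IsSmoothBoundedDomain Ω) {f : ℕ → E3 → ℝ}
    {u : E3 → ℝ} {Du : E3 → E3} (hf : ∀ n, ContDiff ℝ ∞ (f n)) (h : TendstoH1 Ω f u Du)
    (hu : MemH1 Ω u Du) :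
    Tendsto (fun n => eLpNorm (gradient (f n)) 2 (vol Ω)) atTop (𝓝 (eLpNorm Du 2 (vol Ω))) :=
  TendstoL2.eLpNorm h.2 (fun n => memLp_vol hΩ (continuous_gradient (hf n)) 2) hu.memLp_grad

theorem tendsto_average {Ω : Set E3} (hΩ : IsSmoothBoundedDomain Ω) {f : ℕ → E3 → ℝ}
    {u : E3 → ℝ} (hf : ∀ n, ContDiff ℝ ∞ (f n)) (h : TendstoL2 (vol Ω) f u)
    (hu : MemLp u 2 (vol Ω)) :
    Tendsto (fun n => ⨍ x, f n x ∂(vol Ω)) atTop (𝓝 (⨍ x, u x ∂(vol Ω))) := by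
  have hfin := isFiniteMeasure_vol hΩ
  simp only [average_eq]
  exact (tendsto_integral_of_tendstoL2 h (fun n => memLp_vol hΩ (hf n).continuous 2) hu).const_smul _

/-- The Sobolev inequality for `H¹(Ω)`, in terms of the gradient and the average. -/
theorem MemH1.exists_sobolev {Ω : Set E3} (hΩ : IsSmoothBoundedDomain Ω) :
    ∃ C : NNReal, ∀ (u : E3 → ℝ) (Du : E3 → E3), MemH1 Ω u Du →
      eLpNorm u 6 (vol Ω) ≤ C * (eLpNorm Du 2 (vol Ω) + ‖⨍ x, u x ∂(vol Ω)‖ₑ) := by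
  obtain ⟨C1, h1⟩ := KGM.exists_sobolev hΩ
  obtain ⟨C2, h2⟩ := exists_poincare hΩ
  refine ⟨C1 * (C2 + 1), fun u Du h => ?_⟩
  obtain ⟨f, hf, hl⟩ := h.exists_tendstoH1 hΩ
  refine TendstoL2.eLpNorm_le (f := f) hl.1 (fun n => (hf n).continuous.aestronglyMeasurable) h.memLp.1
    (ENNReal.Tendsto.const_mul ((tendsto_eLpNorm_grad hΩ hf hl h).add
      (tendsto_average hΩ hf hl.1 h.memLp).enorm) (Or.inr ENNReal.coe_ne_top)) fun n => ?_
  refine (h1 _ (hf n)).trans ?_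
  rw [ENNReal.coe_mul, mul_assoc, ENNReal.coe_add, ENNReal.coe_one, add_mul, one_mul]
  gcongr
  · exact h2 _ (hf n)
  · exact le_self_add

theorem MemH1.memLp_six {Ω : Set E3} (hΩ : IsSmoothBoundedDomain Ω) {u : E3 → ℝ} {Du : E3 → E3}
    (h : MemH1 Ω u Du) : MemLp u 6 (vol Ω) := by
  obtain ⟨C, hC⟩ := MemH1.exists_sobolev hΩ
  refine ⟨h.memLp.1, (hC u Du h).trans_lt ?_⟩
  exact ENNReal.mul_lt_top ENNReal.coe_lt_top
    (ENNReal.add_lt_top.2 ⟨h.memLp_grad.2, by simp⟩)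

theorem isFiniteMeasure_surf {Ω : Set E3} (hΩ : IsSmoothBoundedDomain Ω) :
    IsFiniteMeasure (surf Ω) := by
  obtain ⟨C, hC⟩ := exists_trace_inequality hΩ
  have h := hC (fun _ => 1) contDiff_const
  simp only [gradient_const, enorm_zero, add_zero, lintegral_const, enorm_one, one_mul,
    Measure.restrict_apply_univ] at h
  exact ⟨h.trans_lt (ENNReal.mul_lt_top ENNReal.coe_lt_top (volume_lt_top hΩ))⟩

theorem memLp_surf {Ω : Set E3} (hΩ : IsSmoothBoundedDomain Ω) {F : E3 → ℝ} (hF : Continuous F) :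
    MemLp F 2 (surf Ω) := by
  have := isFiniteMeasure_surf hΩ
  have hc : IsCompact (frontier Ω) :=
    hΩ.isBounded.isCompact_closure.of_isClosed_subset isClosed_frontier frontier_subset_closure
  obtain ⟨C, hC⟩ := hc.exists_bound_of_continuousOn hF.continuousOn
  refine MemLp.of_bound (C := C) hF.aestronglyMeasurable ?_
  exact (ae_restrict_iff' isClosed_frontier.measurableSet).2 (Eventually.of_forall hC)

theorem two_mul_le_sq_add_sq (a b : ℝ≥0∞) : 2 * (a * b) ≤ a ^ 2 + b ^ 2 := by
  rcases eq_or_ne a ⊤ with rfl | ha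
  · simp
  rcases eq_or_ne b ⊤ with rfl | hb
  · simp
  lift a to NNReal using ha
  lift b to NNReal using hb
  norm_cast
  rw [← mul_assoc]
  exact two_mul_le_add_sq a b

/-- The trace inequality `H¹(Ω) → L²(∂Ω)`: that from `W^{1,1}` to `L¹`, applied to `F ^ 2`. -/
theorem exists_trace_inequality_two {Ω : Set E3} (hΩ : IsSmoothBoundedDomain Ω) :
    ∃ C : NNReal, ∀ F : E3 → ℝ, ContDiff ℝ ∞ F →
      eLpNorm F 2 (surf Ω) ≤ C * (eLpNorm F 2 (vol Ω) + eLpNorm (gradient F) 2 (vol Ω)) := by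
  obtain ⟨C, hC⟩ := exists_trace_inequality hΩ
  refine ⟨NNReal.sqrt (2 * C), fun F hF => ?_⟩
  have hcF := hF.continuous
  have h := hC _ (hF.mul hF)
  simp only [gradient_mul hF hF] at h
  rw [← ENNReal.pow_le_pow_left_iff two_ne_zero, eLpNorm_two_sq, mul_pow, ← ENNReal.coe_pow,
    NNReal.sq_sqrt]
  calc ∫⁻ x, ‖F x‖ₑ ^ 2 ∂(surf Ω) = ∫⁻ x, ‖F x * F x‖ₑ ∂(surf Ω) := by
        simp only [enorm_mul, sq]
    _ ≤ _ := h
    _ ≤ C * ∫⁻ x in Ω, 2 * (‖F x‖ₑ ^ 2 + ‖gradient F x‖ₑ ^ 2) := by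
        refine mul_le_mul_right (lintegral_mono fun x => ?_) _
        rw [← two_smul ℝ, enorm_smul, enorm_mul, enorm_smul]
        have e : ‖(2 : ℝ)‖ₑ = 2 := by rw [Real.enorm_eq_ofReal (by norm_num)]; norm_num
        have h2 := two_mul_le_sq_add_sq ‖F x‖ₑ ‖gradient F x‖ₑ
        rw [e, ← sq, two_mul (_ + _)]
        exact add_le_add le_self_add h2
    _ = (2 * C : NNReal) * (eLpNorm F 2 (vol Ω) ^ 2 + eLpNorm (gradient F) 2 (vol Ω) ^ 2) := by
        rw [lintegral_const_mul' _ _ (by norm_num),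
          lintegral_add_left (hcF.enorm.measurable.pow_const 2), eLpNorm_two_sq, eLpNorm_two_sq, vol]
        push_cast
        ring
    _ ≤ _ := by
        gcongr
        rw [add_sq, add_right_comm]
        exact le_self_add

/-- The boundary values of an approximating sequence converge. -/
theorem exists_trace_limit {Ω : Set E3} (hΩ : IsSmoothBoundedDomain Ω) {f : ℕ → E3 → ℝ}
    {u : E3 → ℝ} {Du : E3 → E3} (hf : ∀ n, ContDiff ℝ ∞ (f n)) (h : TendstoH1 Ω f u Du)
    (hu : MemH1 Ω u Du) : ∃ g, MemLp g 2 (surf Ω) ∧ TendstoL2 (surf Ω) f g := by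
  obtain ⟨C, hC⟩ := exists_trace_inequality_two hΩ
  have hB := ENNReal.Tendsto.const_mul (h.1.add h.2) (a := (C : ℝ≥0∞)) (Or.inr ENNReal.coe_ne_top)
  rw [add_zero, mul_zero] at hB
  have tri : ∀ {E : Type} [NormedAddCommGroup E] {a b c : E3 → E}, MemLp a 2 (vol Ω) →
      MemLp b 2 (vol Ω) → MemLp c 2 (vol Ω) → eLpNorm (fun x => a x - b x) 2 (vol Ω) ≤
        eLpNorm (fun x => a x - c x) 2 (vol Ω) + eLpNorm (fun x => b x - c x) 2 (vol Ω) := by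
    intro E _ a b c ha hb hc
    have e : (fun x => a x - b x) = (fun x => a x - c x) - (fun x => b x - c x) := by
      ext x; simp
    rw [e]
    exact eLpNorm_sub_le (ha.sub hc).1 (hb.sub hc).1 (by norm_num)
  refine exists_tendstoL2 (fun n => memLp_surf hΩ (hf n).continuous) hB fun n m => ?_
  refine (hC _ ((hf n).sub (hf m))).trans ?_
  have e : gradient (fun x => f n x - f m x) = fun x => gradient (f n) x - gradient (f m) x :=
    funext fun x => gradient_sub (hf n) (hf m) x
  rw [e, ← mul_add]
  refine mul_le_mul_right ?_ _
  have t1 := tri (memLp_vol hΩ (hf n).continuous 2) (memLp_vol hΩ (hf m).continuous 2) hu.memLp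
  have t2 := tri (memLp_vol hΩ (continuous_gradient (hf n)) 2)
    (memLp_vol hΩ (continuous_gradient (hf m)) 2) hu.memLp_grad
  refine (add_le_add t1 t2).trans (le_of_eq ?_)
  ring

/-- Every function in `H¹(Ω)` has a trace. -/
theorem MemH1.exists_hasTrace {Ω : Set E3} (hΩ : IsSmoothBoundedDomain Ω) {u : E3 → ℝ}
    {Du : E3 → E3} (h : MemH1 Ω u Du) : ∃ g, HasTrace Ω u Du g := by
  obtain ⟨f, hf, hl⟩ := h.exists_tendstoH1 hΩ
  obtain ⟨g, hg, ht⟩ := exists_trace_limit hΩ hf hl h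
  exact ⟨g, h, hg, f, hf, hl, ht⟩

theorem hasTrace_of_contDiff {Ω : Set E3} (hΩ : IsSmoothBoundedDomain Ω) {F : E3 → ℝ}
    (hF : ContDiff ℝ ∞ F) : HasTrace Ω F (gradient F) F :=
  ⟨memH1_of_contDiff hΩ hF, memLp_surf hΩ hF.continuous, fun _ => F, fun _ => hF,
    ⟨tendstoL2_const F, tendstoL2_const (gradient F)⟩, tendstoL2_const F⟩

/-- The boundary pairing of two traces is bounded by volume integrals: the `W^{1,1}` trace inequality
for a product. -/
theorem exists_abs_boundary_integral_le {Ω : Set E3} (hΩ : IsSmoothBoundedDomain Ω) :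
    ∃ C : NNReal, ∀ (w ψ : E3 → ℝ) (Dw Dψ : E3 → E3) (α g : E3 → ℝ),
      HasTrace Ω w Dw α → HasTrace Ω ψ Dψ g →
      |∫ x, α x * g x ∂(surf Ω)| ≤ C * ((∫ x, |w x| * |ψ x| ∂(vol Ω)) +
        (∫ x, ‖Dw x‖ * |ψ x| ∂(vol Ω)) + ∫ x, |w x| * ‖Dψ x‖ ∂(vol Ω)) := by
  obtain ⟨C, hC⟩ := exists_trace_inequality hΩ
  have hprod : ∀ {a b : E3 → ℝ}, MemLp a 2 (vol Ω) → MemLp b 2 (vol Ω) →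
      Integrable (fun x => a x * b x) (vol Ω) := fun ha hb => ha.integrable_mul hb
  have hsm : ∀ F G : E3 → ℝ, ContDiff ℝ ∞ F → ContDiff ℝ ∞ G →
      |∫ x, F x * G x ∂(surf Ω)| ≤ C * ((∫ x, |F x| * |G x| ∂(vol Ω)) +
        (∫ x, ‖gradient F x‖ * |G x| ∂(vol Ω)) + ∫ x, |F x| * ‖gradient G x‖ ∂(vol Ω)) := by
    intro F G hF hG
    have hF2 : MemLp (fun x => |F x|) 2 (vol Ω) := memLp_vol hΩ hF.continuous.abs 2
    have hG2 : MemLp (fun x => |G x|) 2 (vol Ω) := memLp_vol hΩ hG.continuous.abs 2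
    have hgF : MemLp (fun x => ‖gradient F x‖) 2 (vol Ω) :=
      memLp_vol hΩ (continuous_gradient hF).norm 2
    have hgG : MemLp (fun x => ‖gradient G x‖) 2 (vol Ω) :=
      memLp_vol hΩ (continuous_gradient hG).norm 2
    have i1 := hprod hF2 hG2
    have i2 := hprod hgF hG2
    have i3 := hprod hF2 hgG
    have i12 : Integrable (fun x => |F x| * |G x| + ‖gradient F x‖ * |G x|) (vol Ω) := i1.add i2
    have i123 : Integrable (fun x => |F x| * |G x| + ‖gradient F x‖ * |G x| +
        |F x| * ‖gradient G x‖) (vol Ω) := i12.add i3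
    rw [← integral_add i1 i2, ← integral_add i12 i3]
    set S := ∫ x, |F x| * |G x| + ‖gradient F x‖ * |G x| + |F x| * ‖gradient G x‖ ∂(vol Ω) with hS
    have hS0 : 0 ≤ S := integral_nonneg fun x => by positivity
    have h1 : ENNReal.ofReal |∫ x, F x * G x ∂(surf Ω)| ≤ C * ENNReal.ofReal S := by
      rw [← Real.enorm_eq_ofReal_abs]
      refine (enorm_integral_le_lintegral_enorm _).trans ((hC _ (hF.mul hG)).trans ?_)
      rw [hS, ofReal_integral_eq_lintegral_ofReal i123
        (Eventually.of_forall fun x => by positivity)]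
      refine mul_le_mul_right (lintegral_mono fun x => ?_) _
      rw [gradient_mul hF hG]
      refine (add_le_add le_rfl (enorm_add_le _ _)).trans (le_of_eq ?_)
      rw [ENNReal.ofReal_add (by positivity) (by positivity),
        ENNReal.ofReal_add (by positivity) (by positivity), ENNReal.ofReal_mul (by positivity),
        ENNReal.ofReal_mul (by positivity), ENNReal.ofReal_mul (by positivity),
        enorm_mul, enorm_smul, enorm_smul, ofReal_norm, ofReal_norm, ← Real.enorm_eq_ofReal_abs,
        ← Real.enorm_eq_ofReal_abs]
      ring
    rw [← ENNReal.ofReal_coe_nnreal, ← ENNReal.ofReal_mul (by positivity)] at h1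
    exact (ENNReal.ofReal_le_ofReal_iff (by positivity)).1 h1
  refine ⟨C, fun w ψ Dw Dψ α g hw hψ => ?_⟩
  obtain ⟨hw1, hα, f, hf, hfl, hft⟩ := hw
  obtain ⟨hψ1, hg, k, hk, hkl, hkt⟩ := hψ
  have lim0 := tendsto_integral_mul (f := f) (g := k) hft hkt
    (fun n => memLp_surf hΩ (hf n).continuous) hα (fun n => memLp_surf hΩ (hk n).continuous) hg
  have nf := TendstoL2.norm (f := f) hfl.1
  have nk := TendstoL2.norm (f := k) hkl.1
  have ngf := TendstoL2.norm (f := fun n => gradient (f n)) hfl.2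
  have ngk := TendstoL2.norm (f := fun n => gradient (k n)) hkl.2
  have mf := fun n => memLp_vol hΩ (hf n).continuous.norm 2
  have mk := fun n => memLp_vol hΩ (hk n).continuous.norm 2
  have mgf := fun n => memLp_vol hΩ (continuous_gradient (hf n)).norm 2
  have mgk := fun n => memLp_vol hΩ (continuous_gradient (hk n)).norm 2
  have lim1 := tendsto_integral_mul nf nk mf hw1.memLp.norm mk hψ1.memLp.norm
  have lim2 := tendsto_integral_mul ngf nk mgf hw1.memLp_grad.norm mk hψ1.memLp.norm
  have lim3 := tendsto_integral_mul nf ngk mf hw1.memLp.norm mgk hψ1.memLp_grad.norm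
  exact le_of_tendsto_of_tendsto' lim0.abs (((lim1.add lim2).add lim3).const_mul (C : ℝ))
    fun n => hsm _ _ (hf n) (hk n)

/-- The chain rule in `H¹(Ω)`. Along an approximating sequence that converges almost everywhere,
`G' (f n) • ∇(f n) - G' u • Du` is `G' (f n) • (∇(f n) - Du)`, small in `L²`, plus
`(G' (f n) - G' u) • Du`, which tends to `0` by dominated convergence. -/
theorem MemH1.comp {Ω : Set E3} (hΩ : IsSmoothBoundedDomain Ω) {u : E3 → ℝ} {Du : E3 → E3}
    (h : MemH1 Ω u Du) {G : ℝ → ℝ} (hG : ContDiff ℝ ∞ G) (hG' : ∀ t, |deriv G t| ≤ 1) :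
    MemH1 Ω (fun x => G (u x)) (fun x => deriv G (u x) • Du x) := by
  have hfin := isFiniteMeasure_vol hΩ
  have hcG := hG.continuous
  have hcG' : Continuous (deriv G) := hG.continuous_deriv (by simp)
  have hlip : ∀ a b, |G a - G b| ≤ |a - b| := fun a b => by
    have := Convex.norm_image_sub_le_of_norm_deriv_le (f := G) (s := Set.univ) (C := 1)
      (fun x _ => hG.differentiable (by simp) x) (fun x _ => hG' x) convex_univ
      (Set.mem_univ b) (Set.mem_univ a)
    simpa using this
  obtain ⟨f, hf, hl⟩ := h.exists_tendstoH1 hΩ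
  obtain ⟨s, hs, hae⟩ := TendstoL2.exists_ae (f := f) hl.1
    (fun n => (hf n).continuous.aestronglyMeasurable) h.memLp.1
  have hl1 : TendstoL2 (vol Ω) (fun n => f (s n)) u := TendstoL2.comp (f := f) hl.1 hs
  have hl2 : TendstoL2 (vol Ω) (fun n => gradient (f (s n))) Du :=
    TendstoL2.comp (f := fun n => gradient (f n)) hl.2 hs
  have hum : AEStronglyMeasurable (fun x => deriv G (u x)) (vol Ω) :=
    hcG'.comp_aestronglyMeasurable h.memLp.1
  have hmem : MemLp (fun x => G (u x)) 2 (vol Ω) := by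
    have h1 : MemLp (fun x => |u x| + |G 0|) 2 (vol Ω) := h.memLp.abs.add (memLp_const _)
    refine h1.mono (hcG.comp_aestronglyMeasurable h.memLp.1) (Eventually.of_forall fun x => ?_)
    rw [Real.norm_eq_abs, Real.norm_of_nonneg (by positivity)]
    have h2 := hlip (u x) 0
    rw [sub_zero] at h2
    have h3 := abs_sub_abs_le_abs_sub (G (u x)) (G 0)
    linarith
  have hbd : MemLp (fun x => deriv G (u x)) ⊤ (vol Ω) :=
    memLp_top_of_bound hum 1 (Eventually.of_forall fun x => hG' _)
  have hmemg : MemLp (fun x => deriv G (u x) • Du x) 2 (vol Ω) := h.memLp_grad.smul (p := ⊤) hbd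
  refine memH1_of_tendstoH1 hΩ (f := fun n x => G (f (s n) x)) (fun n => hG.comp (hf (s n)))
    ⟨?_, ?_⟩ hmem hmemg
  · exact TendstoL2.of_le hl1 1 fun n => Eventually.of_forall fun x => by
      rw [one_mul]; exact hlip _ _
  · have t1 : TendstoL2 (vol Ω)
        (fun n x => deriv G (f (s n) x) • (gradient (f (s n)) x - Du x)) (fun _ => (0 : E3)) :=
      TendstoL2.of_le hl2 1 fun n => Eventually.of_forall fun x => by
        rw [sub_zero, norm_smul]
        exact mul_le_mul_of_nonneg_right (hG' _) (norm_nonneg _)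
    have t2 : TendstoL2 (vol Ω) (fun n x => deriv G (f (s n) x) • Du x)
        (fun x => deriv G (u x) • Du x) := by
      have hd : Tendsto (fun n => ∫⁻ x, ‖deriv G (f (s n) x) • Du x - deriv G (u x) • Du x‖ₑ ^ 2
          ∂(vol Ω)) atTop (𝓝 (∫⁻ _x, 0 ∂(vol Ω))) := by
        refine tendsto_lintegral_of_dominated_convergence' (fun x => (2 * ‖Du x‖ₑ) ^ 2) ?_ ?_ ?_ ?_
        · intro n
          have hcn : Continuous fun x => deriv G (f (s n) x) := hcG'.comp (hf (s n)).continuous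
          exact (((hcn.aestronglyMeasurable.smul h.memLp_grad.1).sub
            (hum.smul h.memLp_grad.1)).enorm).pow_const 2
        · intro n
          refine Eventually.of_forall fun x => ?_
          have e1 : ∀ t, ‖deriv G t • Du x‖ₑ ≤ ‖Du x‖ₑ := fun t => by
            rw [enorm_smul]
            refine mul_le_of_le_one_left zero_le ?_
            rw [Real.enorm_eq_ofReal_abs]
            exact ENNReal.ofReal_le_one.2 (hG' t)
          refine pow_le_pow_left' (enorm_sub_le.trans ?_) 2
          rw [two_mul]
          exact add_le_add (e1 _) (e1 _)
        · simp only [mul_pow]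
          rw [lintegral_const_mul' _ _ (by norm_num), ← eLpNorm_two_sq]
          exact ENNReal.mul_ne_top (by norm_num) (ENNReal.pow_ne_top h.memLp_grad.2.ne)
        · filter_upwards [hae] with x hx
          have h1 : Tendsto (fun n => deriv G (f (s n) x) • Du x - deriv G (u x) • Du x) atTop
              (𝓝 (deriv G (u x) • Du x - deriv G (u x) • Du x)) :=
            (((hcG'.tendsto (u x)).comp hx).smul_const _).sub_const _
          rw [sub_self] at h1
          have h2 := h1.enorm
          rw [enorm_zero] at h2
          simpa using ENNReal.Tendsto.pow (n := 2) h2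
      simp only [lintegral_zero, ← eLpNorm_two_sq] at hd
      have h3 := ((ENNReal.continuous_rpow_const (y := (1 / 2 : ℝ))).tendsto 0).comp hd
      rw [ENNReal.zero_rpow_of_pos (by norm_num)] at h3
      refine h3.congr fun n => ?_
      simp only [Function.comp]
      rw [← ENNReal.rpow_natCast, ← ENNReal.rpow_mul]
      norm_num
    have t3 := t1.add t2
      (fun n => ((hcG'.comp (hf (s n)).continuous).aestronglyMeasurable).smul
        ((continuous_gradient (hf (s n))).aestronglyMeasurable.sub h.memLp_grad.1))
      aestronglyMeasurable_const
      (fun n => ((hcG'.comp (hf (s n)).continuous).aestronglyMeasurable).smul h.memLp_grad.1)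
      (hum.smul h.memLp_grad.1)
    refine Tendsto.congr (fun n => ?_) t3
    congr 1
    ext1 x
    simp only [gradient_comp hG (hf (s n)), smul_sub, zero_add, sub_add_cancel]

/-! ### Boundedness of Neumann potentials -/

/-- The norm of `Lᵖ(Ω)` as a real number; it is meaningful for functions in `Lᵖ(Ω)` only. -/
def lpn {E : Type*} [NormedAddCommGroup E] (Ω : Set E3) (p : ℝ≥0∞) (f : E3 → E) : ℝ :=
  (eLpNorm f p (vol Ω)).toReal

section Norms

variable {E F : Type*} [NormedAddCommGroup E] [NormedAddCommGroup F] {Ω : Set E3}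

theorem lpn_nonneg (p : ℝ≥0∞) (f : E3 → E) : 0 ≤ lpn Ω p f := ENNReal.toReal_nonneg

theorem integral_norm_sq_eq {f : E3 → E} (hf : MemLp f 2 (vol Ω)) :
    ∫ x, ‖f x‖ ^ 2 ∂(vol Ω) = lpn Ω 2 f ^ 2 := by
  have h := eLpNorm_two_sq f (vol Ω)
  have hm : AEStronglyMeasurable (fun x => ‖f x‖ ^ 2) (vol Ω) := hf.1.norm.pow 2
  rw [lpn, ← ENNReal.toReal_pow, h, integral_eq_lintegral_of_nonneg_ae
    (Eventually.of_forall fun x => by positivity) hm]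
  congr 1
  refine lintegral_congr fun x => ?_
  rw [ENNReal.ofReal_pow (norm_nonneg _), ofReal_norm]

theorem lintegral_rpow_two_eq (f : E3 → E) (μ : Measure E3) :
    (∫⁻ x, ‖f x‖ₑ ^ (2 : ℝ) ∂μ) ^ (1 / 2 : ℝ) = eLpNorm f 2 μ := by
  rw [eLpNorm_eq_lintegral_rpow_enorm_toReal (by norm_num) (by norm_num)]
  norm_num

/-- Hölder's inequality with exponents `2`, `6`, `3`, for a product supported in `A`. -/
theorem integral_norm_mul_norm_le (hΩ : IsSmoothBoundedDomain Ω) {f : E3 → E} {g : E3 → F}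
    (hf : MemLp f 2 (vol Ω)) (hg : MemLp g 6 (vol Ω)) {A : Set E3}
    (hA : NullMeasurableSet A (vol Ω)) (h0 : ∀ x, x ∉ A → ‖f x‖ * ‖g x‖ = 0) :
    ∫ x, ‖f x‖ * ‖g x‖ ∂(vol Ω) ≤
      lpn Ω 2 f * lpn Ω 6 g * ((vol Ω).real A) ^ (1 / 3 : ℝ) := by
  have hfin := isFiniteMeasure_vol hΩ
  have hAt : vol Ω A ^ (1 / 3 : ℝ) ≠ ⊤ :=
    ENNReal.rpow_ne_top_of_nonneg (by norm_num) (measure_ne_top _ _)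
  have key : ∫⁻ x, ‖f x‖ₑ * ‖g x‖ₑ ∂(vol Ω) ≤
      eLpNorm f 2 (vol Ω) * (eLpNorm g 6 (vol Ω) * vol Ω A ^ (1 / 3 : ℝ)) := by
    have e : ∫⁻ x, ‖f x‖ₑ * ‖g x‖ₑ ∂(vol Ω) = ∫⁻ x in A, ‖f x‖ₑ * ‖g x‖ₑ ∂(vol Ω) := by
      rw [← lintegral_indicator₀ hA]
      refine lintegral_congr fun x => ?_
      by_cases hx : x ∈ A
      · simp [hx]
      · rw [Set.indicator_of_notMem hx, ← ofReal_norm, ← ofReal_norm,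
          ← ENNReal.ofReal_mul (norm_nonneg _), h0 x hx, ENNReal.ofReal_zero]
    rw [e]
    have hh := ENNReal.lintegral_mul_le_Lp_mul_Lq ((vol Ω).restrict A) Real.HolderConjugate.two_two
      (hf.1.restrict (s := A)).enorm (hg.1.restrict (s := A)).enorm
    refine hh.trans ?_
    rw [lintegral_rpow_two_eq, lintegral_rpow_two_eq]
    refine mul_le_mul' (eLpNorm_mono_measure _ Measure.restrict_le_self) ?_
    refine (eLpNorm_le_eLpNorm_mul_rpow_measure_univ (p := 2) (q := 6)
      (ENNReal.coe_le_coe.2 (by norm_num : (2 : NNReal) ≤ 6)) (hg.1.restrict (s := A))).trans ?_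
    rw [Measure.restrict_apply_univ]
    have e3 : (1 / (2 : ℝ≥0∞).toReal - 1 / (6 : ℝ≥0∞).toReal) = (1 / 3 : ℝ) := by norm_num
    rw [e3]
    exact mul_le_mul_left (eLpNorm_mono_measure _ Measure.restrict_le_self) _
  have e4 : ∫ x, ‖f x‖ * ‖g x‖ ∂(vol Ω) = (∫⁻ x, ‖f x‖ₑ * ‖g x‖ₑ ∂(vol Ω)).toReal := by
    have hm : AEStronglyMeasurable (fun x => ‖f x‖ * ‖g x‖) (vol Ω) := hf.1.norm.mul hg.1.norm
    rw [integral_eq_lintegral_of_nonneg_ae (Eventually.of_forall fun x => by positivity) hm]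
    congr 1
    refine lintegral_congr fun x => ?_
    rw [ENNReal.ofReal_mul (norm_nonneg _), ofReal_norm, ofReal_norm]
  rw [e4]
  refine (ENNReal.toReal_mono (ENNReal.mul_ne_top hf.2.ne (ENNReal.mul_ne_top hg.2.ne hAt)) key).trans
    (le_of_eq ?_)
  rw [ENNReal.toReal_mul, ENNReal.toReal_mul, lpn, lpn, Measure.real, ENNReal.toReal_rpow]
  ring

theorem integrable_inner_of_memLp {H : Type*} [NormedAddCommGroup H] [InnerProductSpace ℝ H]
    {f g : E3 → H} (hf : MemLp f 2 (vol Ω)) (hg : MemLp g 2 (vol Ω)) :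
    Integrable (fun x => inner ℝ (f x) (g x)) (vol Ω) := by
  have h : Integrable (fun x => ‖f x‖ * ‖g x‖) (vol Ω) := hf.norm.integrable_mul hg.norm
  exact h.mono (hf.1.inner hg.1) (Eventually.of_forall fun x =>
    (norm_inner_le_norm _ _).trans (le_abs_self _))

theorem lpn_two_le (hΩ : IsSmoothBoundedDomain Ω) {f : E3 → E} (hf : MemLp f 6 (vol Ω)) :
    lpn Ω 2 f ≤ lpn Ω 6 f * ((vol Ω).real Set.univ) ^ (1 / 3 : ℝ) := by
  have hfin := isFiniteMeasure_vol hΩ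
  have h := eLpNorm_le_eLpNorm_mul_rpow_measure_univ (p := 2) (q := 6) (μ := vol Ω)
    (ENNReal.coe_le_coe.2 (by norm_num : (2 : NNReal) ≤ 6)) hf.1
  have e3 : (1 / (2 : ℝ≥0∞).toReal - 1 / (6 : ℝ≥0∞).toReal) = (1 / 3 : ℝ) := by norm_num
  rw [e3] at h
  have := ENNReal.toReal_mono (ENNReal.mul_ne_top hf.2.ne
    (ENNReal.rpow_ne_top_of_nonneg (by norm_num) (measure_ne_top _ _))) h
  rwa [ENNReal.toReal_mul, ← ENNReal.toReal_rpow] at this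

theorem exists_sobolev_real (hΩ : IsSmoothBoundedDomain Ω) :
    ∃ C : ℝ, 0 ≤ C ∧ ∀ (u : E3 → ℝ) (Du : E3 → E3), MemH1 Ω u Du →
      lpn Ω 6 u ≤ C * (lpn Ω 2 Du + |⨍ x, u x ∂(vol Ω)|) := by
  obtain ⟨C, hC⟩ := MemH1.exists_sobolev hΩ
  refine ⟨C, C.2, fun u Du h => ?_⟩
  have h1 := ENNReal.toReal_mono (ENNReal.mul_ne_top ENNReal.coe_ne_top
    (ENNReal.add_ne_top.2 ⟨h.memLp_grad.2.ne, by simp⟩)) (hC u Du h)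
  rw [ENNReal.toReal_mul, ENNReal.toReal_add h.memLp_grad.2.ne (by simp)] at h1
  simpa [lpn] using h1

end Norms

theorem vol_real_pos {Ω : Set E3} (hΩ : IsSmoothBoundedDomain Ω) : 0 < (vol Ω).real Set.univ := by
  rw [Measure.real, vol, Measure.restrict_apply_univ]
  exact ENNReal.toReal_pos (volume_pos hΩ) (volume_lt_top hΩ).ne

/-- The pairing of a trace `α` with the trace of a function supported in `A` is bounded by a power of
`|A|`. The number `N` stands for the norm of an extension `w` of `α`. -/
theorem exists_boundary_form_bound {Ω : Set E3} (hΩ : IsSmoothBoundedDomain Ω) :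
    ∃ K : ℝ, 0 ≤ K ∧ ∀ (w ψ : E3 → ℝ) (Dw Dψ : E3 → E3) (α g : E3 → ℝ) (N : ℝ),
      HasTrace Ω w Dw α → HasTrace Ω ψ Dψ g → lpn Ω 2 Dw ≤ N → |⨍ x, w x ∂(vol Ω)| ≤ N →
      ∀ A : Set E3, NullMeasurableSet A (vol Ω) → (∀ x, x ∉ A → ψ x = 0 ∧ Dψ x = 0) →
      |∫ x, α x * g x ∂(surf Ω)| ≤
        K * N * ((vol Ω).real A) ^ (1 / 3 : ℝ) * (lpn Ω 6 ψ + lpn Ω 2 Dψ) := by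
  obtain ⟨C, hC⟩ := exists_abs_boundary_integral_le hΩ
  obtain ⟨S, hS0, hS⟩ := exists_sobolev_real hΩ
  set v := ((vol Ω).real Set.univ) ^ (1 / 3 : ℝ) with hv
  have hv0 : 0 ≤ v := by positivity
  refine ⟨C * (2 * S * v + 1 + 2 * S), by positivity,
    fun w ψ Dw Dψ α g N hw hψ hDw hav A hA hz => ?_⟩
  have hN : 0 ≤ N := (abs_nonneg _).trans hav
  set a := ((vol Ω).real A) ^ (1 / 3 : ℝ) with ha
  have ha0 : 0 ≤ a := by positivity
  have hw6 : lpn Ω 6 w ≤ 2 * S * N := by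
    refine (hS w Dw hw.1).trans ?_
    nlinarith
  have hw2 : lpn Ω 2 w ≤ 2 * S * N * v :=
    (lpn_two_le hΩ (hw.1.memLp_six hΩ)).trans (by gcongr)
  have hψ6 := hψ.1.memLp_six hΩ
  have t1 := integral_norm_mul_norm_le hΩ hw.1.memLp hψ6 hA fun x hx => by simp [(hz x hx).1]
  have t2 := integral_norm_mul_norm_le hΩ hw.1.memLp_grad hψ6 hA fun x hx => by simp [(hz x hx).1]
  have t3 := integral_norm_mul_norm_le hΩ hψ.1.memLp_grad (hw.1.memLp_six hΩ) hA
    fun x hx => by simp [(hz x hx).2]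
  have n6 := lpn_nonneg (Ω := Ω) 6 ψ
  have n2 := lpn_nonneg (Ω := Ω) 2 Dψ
  have h := hC w ψ Dw Dψ α g hw hψ
  simp only [Real.norm_eq_abs] at t1 t2 t3
  have e3 : ∫ x, |w x| * ‖Dψ x‖ ∂(vol Ω) = ∫ x, ‖Dψ x‖ * |w x| ∂(vol Ω) := by
    simp only [mul_comm]
  rw [e3] at h
  have b1 : lpn Ω 2 w * lpn Ω 6 ψ * a ≤ (2 * S * N * v) * lpn Ω 6 ψ * a := by gcongr
  have b2 : lpn Ω 2 Dw * lpn Ω 6 ψ * a ≤ N * lpn Ω 6 ψ * a := by gcongr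
  have b3 : lpn Ω 2 Dψ * lpn Ω 6 w * a ≤ lpn Ω 2 Dψ * (2 * S * N) * a := by gcongr
  refine h.trans ?_
  have c1 : 0 ≤ N * a * lpn Ω 6 ψ := by positivity
  have c2 : 0 ≤ N * a * lpn Ω 2 Dψ := by positivity
  calc (C : ℝ) * _ ≤ C * ((2 * S * N * v) * lpn Ω 6 ψ * a + N * lpn Ω 6 ψ * a +
        lpn Ω 2 Dψ * (2 * S * N) * a) :=
        mul_le_mul_of_nonneg_left (by linarith) C.2
    _ ≤ C * ((2 * S * v + 1 + 2 * S) * (N * a * lpn Ω 6 ψ) +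
          (2 * S * v + 1 + 2 * S) * (N * a * lpn Ω 2 Dψ)) := by
        have d1 : 0 ≤ 2 * S * (N * a * lpn Ω 6 ψ) := by positivity
        have d2 : 0 ≤ 2 * S * v * (N * a * lpn Ω 2 Dψ) := by positivity
        refine mul_le_mul_of_nonneg_left ?_ C.2
        linarith
    _ = _ := by ring

/-- The energy inequality for `G(χ)`, where `χ` is a Neumann potential and `G` a smooth truncation
that vanishes off `A`. -/
theorem exists_energy_bound {Ω : Set E3} (hΩ : IsSmoothBoundedDomain Ω) :
    ∃ K : ℝ, 0 ≤ K ∧ ∀ (w χ : E3 → ℝ) (Dw Dχ : E3 → E3) (α : E3 → ℝ) (N : ℝ),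
      HasTrace Ω w Dw α → lpn Ω 2 Dw ≤ N → |⨍ x, w x ∂(vol Ω)| ≤ N → MemH1 Ω χ Dχ →
      (∀ (ψ : E3 → ℝ) (Dψ : E3 → E3) (g : E3 → ℝ), HasTrace Ω ψ Dψ g →
        (∫ x, inner ℝ (Dχ x) (Dψ x) ∂(vol Ω)) +
          ∫ x, ((∫ y, α y ∂(surf Ω)) / volume.real Ω) * ψ x ∂(vol Ω) =
            ∫ x, α x * g x ∂(surf Ω)) →
      ∀ (G : ℝ → ℝ), ContDiff ℝ ∞ G → (∀ t, 0 ≤ deriv G t) → (∀ t, deriv G t ≤ 1) →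
      ∀ A : Set E3, NullMeasurableSet A (vol Ω) →
        (∀ x, x ∉ A → G (χ x) = 0 ∧ deriv G (χ x) = 0) →
      lpn Ω 2 (fun x => deriv G (χ x) • Dχ x) ^ 2 ≤ K * N * ((vol Ω).real A) ^ (1 / 3 : ℝ) *
        (lpn Ω 6 (fun x => G (χ x)) + lpn Ω 2 (fun x => deriv G (χ x) • Dχ x)) := by
  have hfin := isFiniteMeasure_vol hΩ
  obtain ⟨K, hK0, hK⟩ := exists_boundary_form_bound hΩ
  have hV := vol_real_pos hΩ
  set V := (vol Ω).real Set.univ with hVdef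
  have hVΩ : volume.real Ω = V := by simp [hVdef, Measure.real, vol]
  -- `J * N * |A| ^ (1 / 3)` bounds the term that comes from the mean of `α`
  set I₆ := lpn Ω 6 (fun _ => (1 : ℝ))
  set I₂ := lpn Ω 2 (fun _ => (1 : ℝ))
  have hI6 : 0 ≤ I₆ := lpn_nonneg _ _
  have hI2 : 0 ≤ I₂ := lpn_nonneg _ _
  set J := K * V ^ (1 / 3 : ℝ) * I₆ / V * I₂ with hJ
  have hJ0 : 0 ≤ J := by positivity
  refine ⟨K + J, by positivity, ?_⟩
  intro w χ Dw Dχ α N hw hDw hav hχ heq G hG hG0 hG1 A hA hz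
  have hN : 0 ≤ N := (abs_nonneg _).trans hav
  have hψ := hχ.comp hΩ hG (fun t => abs_le.2 ⟨by linarith [hG0 t], hG1 t⟩)
  obtain ⟨g, hg⟩ := hψ.exists_hasTrace hΩ
  have h1 := heq _ _ g hg
  have hb := hK w _ Dw _ α g N hw hg hDw hav A hA fun x hx => by simp [hz x hx]
  set ψ := fun x => G (χ x) with hψdef
  set Dψ := fun x => deriv G (χ x) • Dχ x with hDψ
  set a := ((vol Ω).real A) ^ (1 / 3 : ℝ) with ha
  have ha0 : 0 ≤ a := by positivity
  have hmean : |∫ y, α y ∂(surf Ω)| ≤ K * N * V ^ (1 / 3 : ℝ) * I₆ := by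
    have h2 := hK w _ Dw _ α _ N hw (hasTrace_of_contDiff hΩ (contDiff_const (c := (1 : ℝ)))) hDw hav
      Set.univ MeasurableSet.univ.nullMeasurableSet (fun x hx => absurd (Set.mem_univ x) hx)
    have e : lpn Ω 2 (gradient fun _ : E3 => (1 : ℝ)) = 0 := by
      have : (gradient fun _ : E3 => (1 : ℝ)) = fun _ => 0 := funext fun x => gradient_const 1 x
      rw [this]; simp [lpn]
    rw [e, add_zero] at h2
    simpa using h2
  have hlower : lpn Ω 2 Dψ ^ 2 ≤ ∫ x, inner ℝ (Dχ x) (Dψ x) ∂(vol Ω) := by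
    rw [← integral_norm_sq_eq hψ.memLp_grad]
    refine integral_mono (hψ.memLp_grad.integrable_norm_pow (by norm_num))
      (integrable_inner_of_memLp hχ.memLp_grad hψ.memLp_grad) fun x => ?_
    simp only [hDψ, norm_smul, inner_smul_right, real_inner_self_eq_norm_sq, mul_pow,
      Real.norm_eq_abs, sq_abs]
    gcongr
    nlinarith [hG0 (χ x), hG1 (χ x)]
  have hzero : |∫ x, ((∫ y, α y ∂(surf Ω)) / volume.real Ω) * ψ x ∂(vol Ω)| ≤
      J * N * a * lpn Ω 6 ψ := by
    rw [integral_const_mul, abs_mul, abs_div, hVΩ, abs_of_pos hV]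
    have h3 : |∫ x, ψ x ∂(vol Ω)| ≤ I₂ * lpn Ω 6 ψ * a := by
      have h4 := integral_norm_mul_norm_le hΩ (f := fun _ => (1 : ℝ)) (memLp_const 1)
        (hψ.memLp_six hΩ) hA fun x hx => by simp [hψdef, (hz x hx).1]
      refine (abs_integral_le_integral_abs).trans ?_
      simp only [norm_one, one_mul, Real.norm_eq_abs] at h4
      exact h4
    calc _ ≤ (K * N * V ^ (1 / 3 : ℝ) * I₆) / V * (I₂ * lpn Ω 6 ψ * a) := by gcongr
      _ = _ := by rw [hJ]; ring
  have h5 := (abs_le.1 hb).2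
  have h6 := (abs_le.1 hzero).1
  have h7 : 0 ≤ J * N * a * lpn Ω 2 Dψ := by
    have := lpn_nonneg (Ω := Ω) 2 Dψ
    positivity
  nlinarith

/-- A smooth version of `t ↦ max (t - k) 0`. -/
theorem exists_smooth_truncation {k h : ℝ} (hkh : k < h) :
    ∃ G : ℝ → ℝ, ContDiff ℝ ∞ G ∧ (∀ t, 0 ≤ deriv G t) ∧ (∀ t, deriv G t ≤ 1) ∧
      (∀ t ≤ k, G t = 0 ∧ deriv G t = 0) ∧ (∀ t, 0 ≤ G t) ∧ ∀ t, h ≤ t → (h - k) / 2 ≤ G t := by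
  set s : ℝ → ℝ := fun t => Real.smoothTransition (2 * (t - k) / (h - k)) with hs
  have hsc : ContDiff ℝ ∞ s := Real.smoothTransition.contDiff.comp (by fun_prop)
  have hcont : Continuous s := hsc.continuous
  have hder : ∀ t, deriv (fun t => ∫ x in k..t, s x) t = s t := fun t => hcont.deriv_integral s k t
  have hder' : ∀ t, HasDerivAt (fun t => ∫ x in k..t, s x) (s t) t := fun t =>
    intervalIntegral.integral_hasDerivAt_right (hcont.intervalIntegrable _ _)
      (hcont.stronglyMeasurableAtFilter _ _) hcont.continuousAt
  have hs0 : ∀ t ≤ k, s t = 0 := fun t ht => Real.smoothTransition.zero_of_nonpos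
    (div_nonpos_of_nonpos_of_nonneg (by linarith) (by linarith))
  have hGm : Monotone (fun t => ∫ x in k..t, s x) :=
    monotone_of_deriv_nonneg (fun t => (hder' t).differentiableAt)
      fun t => by rw [hder]; exact Real.smoothTransition.nonneg _
  have hG0 : ∀ t ≤ k, (∫ x in k..t, s x) = 0 := fun t ht => by
    rw [intervalIntegral.integral_symm, neg_eq_zero, intervalIntegral.integral_of_le ht]
    exact setIntegral_eq_zero_of_forall_eq_zero fun x hx => hs0 x hx.2
  have hGn : ∀ t, 0 ≤ ∫ x in k..t, s x := fun t => by
    rcases le_total t k with ht | ht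
    · rw [hG0 t ht]
    · have := hGm ht
      simpa using this
  refine ⟨fun t => ∫ x in k..t, s x, ?_, fun t => ?_, fun t => ?_, fun t ht => ⟨hG0 t ht, ?_⟩,
    hGn, fun t ht => ?_⟩
  · rw [contDiff_infty_iff_deriv]
    refine ⟨fun t => (hder' t).differentiableAt, ?_⟩
    rw [funext hder]
    exact hsc
  · rw [hder]; exact Real.smoothTransition.nonneg _
  · rw [hder]; exact Real.smoothTransition.le_one _
  · rw [hder]; exact hs0 t ht
  · refine le_trans ?_ (hGm ht)
    have hsplit : ∫ x in k..h, s x = (∫ x in k..(k + h) / 2, s x) + ∫ x in (k + h) / 2..h, s x :=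
      (intervalIntegral.integral_add_adjacent_intervals (hcont.intervalIntegrable _ _)
        (hcont.intervalIntegrable _ _)).symm
    have hone : ∫ x in (k + h) / 2..h, s x = ∫ x in (k + h) / 2..h, (1 : ℝ) := by
      refine intervalIntegral.integral_congr fun x hx => ?_
      rw [Set.uIcc_of_le (by linarith)] at hx
      refine Real.smoothTransition.one_of_one_le ?_
      rw [le_div_iff₀ (by linarith)]
      linarith [hx.1]
    have h1 := hGn ((k + h) / 2)
    simp only
    rw [hsplit, hone, intervalIntegral.integral_const, smul_eq_mul]
    linarith

/-- Stampacchia's lemma: superlinear decay between levels forces vanishing at a finite level. -/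
theorem eq_zero_of_stampacchia {m : ℝ → ℝ} (hm : Antitone m) (hm0 : ∀ k, 0 ≤ m k) {V D k₀ : ℝ}
    (hV : m k₀ ≤ V) (hD : 0 < D)
    (h : ∀ k h, k₀ ≤ k → k < h → (h - k) ^ 6 * m h ≤ D ^ 6 * m k ^ 2) :
    m (k₀ + 4 * (1 + V) * D) = 0 := by
  have hV0 : 0 ≤ V := (hm0 _).trans hV
  -- with levels `k₀ + d (1 - 2⁻ⁿ)`, the values decay like `64⁻ⁿ`; `d` is chosen to close the induction
  set d := 4 * (1 + V) * D with hd
  have hdpos : 0 < d := by positivity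
  have hd6 : 4096 * V * D ^ 6 ≤ d ^ 6 := by
    have h1 : V ≤ (1 + V) ^ 6 := by
      have : 1 + 6 * V ≤ (1 + V) ^ 6 := by
        have := one_add_mul_le_pow (a := V) (by linarith) 6
        simpa using this
      linarith
    have h2 : d ^ 6 = 4096 * (1 + V) ^ 6 * D ^ 6 := by rw [hd]; ring
    rw [h2]
    gcongr
  have key : ∀ n : ℕ, m (k₀ + d * (1 - (1 / 2) ^ n)) ≤ V * (1 / 64) ^ n := by
    intro n
    induction n with
    | zero => simpa using hV
    | succ n ih =>
      have hp : (0 : ℝ) < (1 / 2) ^ n := by positivity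
      have hp1 : ((1 : ℝ) / 2) ^ n ≤ 1 := pow_le_one₀ (by norm_num) (by norm_num)
      have h1 := h (k₀ + d * (1 - (1 / 2) ^ n)) (k₀ + d * (1 - (1 / 2) ^ (n + 1)))
        (by nlinarith) (by rw [pow_succ]; nlinarith)
      have e1 : k₀ + d * (1 - (1 / 2) ^ (n + 1)) - (k₀ + d * (1 - (1 / 2) ^ n)) =
          d * (1 / 2) ^ n / 2 := by rw [pow_succ]; ring
      rw [e1] at h1
      set x := m (k₀ + d * (1 - (1 / 2) ^ (n + 1)))
      have e2 : (d * (1 / 2) ^ n / 2) ^ 6 = d ^ 6 * (1 / 64) ^ n / 64 := by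
        rw [div_pow, mul_pow, ← pow_mul, mul_comm n 6, pow_mul]
        norm_num
      rw [e2] at h1
      have hq : (0 : ℝ) < (1 / 64) ^ n := by positivity
      have h2 : D ^ 6 * m (k₀ + d * (1 - (1 / 2) ^ n)) ^ 2 ≤ D ^ 6 * (V * (1 / 64) ^ n) ^ 2 := by
        gcongr
        exact hm0 _
      have h3 : d ^ 6 * (1 / 64) ^ n / 64 * x ≤ d ^ 6 * (1 / 64) ^ n / 64 * (V * (1 / 64) ^ (n + 1)) := by
        refine (h1.trans h2).trans ?_
        have h4 : (4096 * V * D ^ 6) * (V * ((1 / 64) ^ n) ^ 2 / 4096) ≤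
            d ^ 6 * (V * ((1 / 64) ^ n) ^ 2 / 4096) := by gcongr
        calc D ^ 6 * (V * (1 / 64) ^ n) ^ 2 =
              (4096 * V * D ^ 6) * (V * ((1 / 64) ^ n) ^ 2 / 4096) := by ring
          _ ≤ _ := h4
          _ = _ := by rw [pow_succ]; ring
      exact le_of_mul_le_mul_left h3 (by positivity)
  have hlim : Tendsto (fun n : ℕ => V * (1 / 64 : ℝ) ^ n) atTop (𝓝 0) := by
    simpa using (tendsto_pow_atTop_nhds_zero_of_lt_one (by norm_num : (0 : ℝ) ≤ 1 / 64)
      (by norm_num)).const_mul V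
  refine le_antisymm (ge_of_tendsto' hlim fun n => (hm ?_).trans (key n)) (hm0 _)
  have hp : (0 : ℝ) < (1 / 2) ^ n := by positivity
  nlinarith

/-- Chebyshev's inequality in `L⁶(Ω)`. -/
theorem pow_six_mul_measure_le {Ω : Set E3} (hΩ : IsSmoothBoundedDomain Ω) {f : E3 → ℝ}
    (hf : MemLp f 6 (vol Ω)) {c : ℝ} (hc : 0 ≤ c) {B : Set E3} (hB : ∀ x ∈ B, c ≤ f x) :
    c ^ 6 * (vol Ω).real B ≤ lpn Ω 6 f ^ 6 := by
  have hfin := isFiniteMeasure_vol hΩ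
  have h := mul_meas_ge_le_pow_eLpNorm' (vol Ω) (p := 6) (by norm_num) (by norm_num) hf.1
    (ENNReal.ofReal c)
  have e6 : (6 : ℝ≥0∞).toReal = ((6 : ℕ) : ℝ) := by norm_num
  rw [e6, ENNReal.rpow_natCast, ENNReal.rpow_natCast] at h
  have h2 : ENNReal.ofReal c ^ 6 * vol Ω B ≤ eLpNorm f 6 (vol Ω) ^ 6 := by
    refine le_trans (mul_le_mul_right (measure_mono fun x hx => ?_) _) h
    rw [Set.mem_ofPred_eq, Real.enorm_eq_ofReal_abs]
    exact ENNReal.ofReal_le_ofReal ((hB x hx).trans (le_abs_self _))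
  have h3 := ENNReal.toReal_mono (ENNReal.pow_ne_top hf.2.ne) h2
  rwa [ENNReal.toReal_mul, ENNReal.toReal_pow, ENNReal.toReal_pow, ENNReal.toReal_ofReal hc] at h3

/-- The average of a function supported in a small set is small compared to its norm in `L⁶`. -/
theorem exists_abs_average_le {Ω : Set E3} (hΩ : IsSmoothBoundedDomain Ω) :
    ∃ C : ℝ, 0 ≤ C ∧ ∀ ψ : E3 → ℝ, MemLp ψ 6 (vol Ω) → ∀ A : Set E3,
      NullMeasurableSet A (vol Ω) → (∀ x, x ∉ A → ψ x = 0) →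
      |⨍ x, ψ x ∂(vol Ω)| ≤ C * lpn Ω 6 ψ * ((vol Ω).real A) ^ (1 / 3 : ℝ) := by
  have hfin := isFiniteMeasure_vol hΩ
  have hV := vol_real_pos hΩ
  refine ⟨((vol Ω).real Set.univ)⁻¹ * lpn Ω 2 (fun _ => (1 : ℝ)),
    mul_nonneg (by positivity) (lpn_nonneg _ _), fun ψ hψ A hA hz => ?_⟩
  have h := integral_norm_mul_norm_le hΩ (f := fun _ => (1 : ℝ)) (memLp_const 1) hψ hA
    fun x hx => by simp [hz x hx]
  simp only [norm_one, one_mul, Real.norm_eq_abs] at h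
  rw [average_eq, smul_eq_mul, abs_mul, abs_of_pos (inv_pos.2 hV), mul_assoc, mul_assoc]
  refine mul_le_mul_of_nonneg_left ?_ (inv_pos.2 hV).le
  rw [← mul_assoc]
  exact abs_integral_le_integral_abs.trans h

/-- One-sided bound for Neumann potentials: the level sets satisfy the hypothesis of Stampacchia's
lemma from a level proportional to the size `N` of the data onwards. -/
theorem exists_ae_le {Ω : Set E3} (hΩ : IsSmoothBoundedDomain Ω) :
    ∃ κ : ℝ, 0 < κ ∧ ∀ (w χ : E3 → ℝ) (Dw Dχ : E3 → E3) (α : E3 → ℝ) (N : ℝ), 0 < N →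
      HasTrace Ω w Dw α → lpn Ω 2 Dw ≤ N → |⨍ x, w x ∂(vol Ω)| ≤ N → MemH1 Ω χ Dχ →
      ∫ x, χ x ∂(vol Ω) = 0 →
      (∀ (ψ : E3 → ℝ) (Dψ : E3 → E3) (g : E3 → ℝ), HasTrace Ω ψ Dψ g →
        (∫ x, inner ℝ (Dχ x) (Dψ x) ∂(vol Ω)) +
          ∫ x, ((∫ y, α y ∂(surf Ω)) / volume.real Ω) * ψ x ∂(vol Ω) =
            ∫ x, α x * g x ∂(surf Ω)) →
      ∀ᵐ x ∂(vol Ω), χ x ≤ κ * N := by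
  have hfin := isFiniteMeasure_vol hΩ
  obtain ⟨K, hK0, hK⟩ := exists_energy_bound hΩ
  obtain ⟨S, hS0, hS⟩ := exists_sobolev_real hΩ
  obtain ⟨c, hc0, hc⟩ := exists_abs_average_le hΩ
  set V := (vol Ω).real Set.univ with hV
  have hV0 : 0 ≤ V := measureReal_nonneg
  set K₁ := K * V ^ (1 / 3 : ℝ) * (S + 1) with hK₁
  have hK₁0 : 0 ≤ K₁ := by positivity
  set K₃ := 2 * S * (K * (2 * S + 1)) with hK₃
  have hK₃0 : 0 ≤ K₃ := by positivity
  -- beyond the level `T * N`, Chebyshev's inequality makes the average negligible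
  set T := 1 + 2 * (S * c) * (S * K₁) ^ 2 with hT
  have hT1 : 1 ≤ T := by
    have : 0 ≤ 2 * (S * c) * (S * K₁) ^ 2 := by positivity
    linarith
  refine ⟨T + 4 * (1 + V) * (2 * K₃ + 1), by positivity, ?_⟩
  intro w χ Dw Dχ α N hN hw hDw hav hχ hχ0 heq
  have henergy := hK w χ Dw Dχ α N hw hDw hav hχ heq
  have hχ6 := hχ.memLp_six hΩ
  -- the energy inequality without truncation
  have hbound : lpn Ω 6 χ ≤ S * K₁ * N := by
    have h1 := henergy id contDiff_id (fun t => by simp) (fun t => by simp) Set.univ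
      MeasurableSet.univ.nullMeasurableSet (fun x hx => absurd (Set.mem_univ x) hx)
    have h2 := hS χ Dχ hχ
    simp only [id_eq, deriv_id', one_smul] at h1
    rw [average_eq, hχ0, smul_zero, abs_zero, add_zero] at h2
    have h3 := lpn_nonneg (Ω := Ω) 2 Dχ
    have h4 : lpn Ω 2 Dχ * lpn Ω 2 Dχ ≤ (K₁ * N) * lpn Ω 2 Dχ := by
      rw [← sq]
      refine h1.trans ?_
      calc K * N * V ^ (1 / 3 : ℝ) * (lpn Ω 6 χ + lpn Ω 2 Dχ)
          ≤ K * N * V ^ (1 / 3 : ℝ) * (S * lpn Ω 2 Dχ + lpn Ω 2 Dχ) := by gcongr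
        _ = _ := by rw [hK₁]; ring
    have h5 : lpn Ω 2 Dχ ≤ K₁ * N := by
      rcases h3.eq_or_lt with h6 | h6
      · rw [← h6]; positivity
      · exact le_of_mul_le_mul_right h4 h6
    calc _ ≤ S * lpn Ω 2 Dχ := h2
      _ ≤ S * (K₁ * N) := by gcongr
      _ = _ := by ring
  have hA : ∀ k, NullMeasurableSet {x | k < χ x} (vol Ω) := fun k =>
    nullMeasurableSet_lt aemeasurable_const hχ.memLp.1.aemeasurable
  set m : ℝ → ℝ := fun k => (vol Ω).real {x | k < χ x} with hm
  have hm0 : ∀ k, 0 ≤ m k := fun k => measureReal_nonneg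
  have hcube : ∀ k, (m k ^ (1 / 3 : ℝ)) ^ 3 = m k := fun k => by
    rw [← Real.rpow_natCast, ← Real.rpow_mul (hm0 k)]
    norm_num
  have hsmall : ∀ k, T * N ≤ k → S * c * m k ^ (1 / 3 : ℝ) ≤ 1 / 2 := by
    intro k hk
    set a := m k ^ (1 / 3 : ℝ) with ha
    have ha0 : 0 ≤ a := Real.rpow_nonneg (hm0 k) _
    have hk0 : 0 ≤ T * N := by positivity
    have h1 := pow_six_mul_measure_le hΩ hχ6 (hk0.trans hk) (B := {x | k < χ x}) fun x hx => le_of_lt hx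
    have h2 : ((T * N) ^ 2 * a) ^ 3 ≤ ((S * K₁ * N) ^ 2) ^ 3 := by
      calc ((T * N) ^ 2 * a) ^ 3 = (T * N) ^ 6 * a ^ 3 := by ring
        _ ≤ k ^ 6 * m k := by rw [hcube]; gcongr
        _ ≤ lpn Ω 6 χ ^ 6 := h1
        _ ≤ (S * K₁ * N) ^ 6 := by
          have := lpn_nonneg (Ω := Ω) 6 χ
          gcongr
        _ = _ := by ring
    have h3 : (T * N) ^ 2 * a ≤ (S * K₁ * N) ^ 2 :=
      le_of_pow_le_pow_left₀ (by norm_num) (by positivity) h2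
    have h4 : T * a ≤ (S * K₁) ^ 2 := by
      have h5 : N ^ 2 * (T ^ 2 * a) ≤ N ^ 2 * (S * K₁) ^ 2 := by linarith
      have h6 := le_of_mul_le_mul_left h5 (by positivity)
      have h7 : T * a ≤ T ^ 2 * a := by
        rw [sq]
        gcongr
        exact le_mul_of_one_le_left (by linarith) hT1
      linarith
    have h8 : 2 * (S * c) * (T * a) ≤ 2 * (S * c) * (S * K₁) ^ 2 := by gcongr
    have h9 : T * (2 * (S * c * a)) ≤ T * 1 := by linarith
    have := le_of_mul_le_mul_left h9 (by linarith)
    linarith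
  have hdecay : ∀ k h, T * N ≤ k → k < h → (h - k) ^ 6 * m h ≤ ((2 * K₃ + 1) * N) ^ 6 * m k ^ 2 := by
    intro k h hk hkh
    set a := m k ^ (1 / 3 : ℝ) with ha
    have ha0 : 0 ≤ a := Real.rpow_nonneg (hm0 k) _
    obtain ⟨G, hG, hG0, hG1, hGk, hGn, hGh⟩ := exists_smooth_truncation hkh
    have hψ := hχ.comp hΩ hG (fun t => abs_le.2 ⟨by linarith [hG0 t], hG1 t⟩)
    have hψ6 := hψ.memLp_six hΩ
    have hz : ∀ x, x ∉ {x | k < χ x} → G (χ x) = 0 ∧ deriv G (χ x) = 0 :=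
      fun x hx => hGk _ (not_lt.1 hx)
    have h1 := henergy G hG hG0 hG1 _ (hA k) hz
    have h2 := hS _ _ hψ
    have h3 := hc _ hψ6 _ (hA k) fun x hx => (hz x hx).1
    set p := lpn Ω 6 (fun x => G (χ x)) with hp
    set e := lpn Ω 2 (fun x => deriv G (χ x) • Dχ x) with he
    have hp0 : 0 ≤ p := lpn_nonneg _ _
    have he0 : 0 ≤ e := lpn_nonneg _ _
    -- the average in the Sobolev inequality is absorbed
    have h4 : p ≤ 2 * S * e := by
      have h5 := mul_le_mul_of_nonneg_left h3 hS0
      have h6 := mul_le_mul_of_nonneg_right (hsmall k hk) hp0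
      have e1 : S * (c * p * m k ^ (1 / 3 : ℝ)) = S * c * m k ^ (1 / 3 : ℝ) * p := by ring
      have h5' := h5.trans_eq e1
      linarith
    have h7 : e ≤ K * N * a * (2 * S + 1) := by
      have h8 : e * e ≤ (K * N * a * (2 * S + 1)) * e := by
        rw [← sq]
        calc e ^ 2 ≤ K * N * a * (p + e) := h1
          _ ≤ K * N * a * (2 * S * e + e) := by gcongr
          _ = _ := by ring
      rcases he0.eq_or_lt with h6 | h6
      · rw [← h6]; positivity
      · exact le_of_mul_le_mul_right h8 h6
    have h9 : p ≤ K₃ * N * a := by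
      calc p ≤ 2 * S * e := h4
        _ ≤ 2 * S * (K * N * a * (2 * S + 1)) := by gcongr
        _ = _ := by rw [hK₃]; ring
    have h10 := pow_six_mul_measure_le hΩ hψ6 (c := (h - k) / 2) (by linarith)
      (B := {x | h < χ x}) fun x hx => hGh _ (le_of_lt hx)
    calc (h - k) ^ 6 * m h = 64 * (((h - k) / 2) ^ 6 * m h) := by ring
      _ ≤ 64 * p ^ 6 := by gcongr
      _ ≤ 64 * (K₃ * N * a) ^ 6 := by gcongr
      _ = (2 * K₃ * N) ^ 6 * (a ^ 3) ^ 2 := by ring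
      _ ≤ _ := by
        rw [hcube]
        gcongr
        linarith
  have hzero := eq_zero_of_stampacchia (m := m) (V := V) (D := (2 * K₃ + 1) * N) (k₀ := T * N)
    (fun k h hkh => measureReal_mono fun x hx => lt_of_le_of_lt hkh hx) hm0
    (measureReal_mono (Set.subset_univ _)) (by positivity) hdecay
  have e : T * N + 4 * (1 + V) * ((2 * K₃ + 1) * N) = (T + 4 * (1 + V) * (2 * K₃ + 1)) * N := by ring
  rw [e] at hzero
  have hnull := (measureReal_eq_zero_iff (measure_ne_top _ _)).1 hzero
  filter_upwards [measure_eq_zero_iff_ae_notMem.1 hnull] with x hx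
  exact not_lt.1 hx

/-- The constant `κ` exists: the one-sided bound is applied to `χ` and `-χ` with `N` the norm of an
almost optimal extension of `α`. -/
theorem exists_isNeumannBound {Ω : Set E3} (hΩ : IsSmoothBoundedDomain Ω) :
    ∃ κ : ℝ, 0 < κ ∧ IsNeumannBound Ω κ := by
  obtain ⟨κ, hκ, h⟩ := exists_ae_le hΩ
  refine ⟨κ, hκ, fun α χ hα hχ => ?_⟩
  obtain ⟨Dχ, hχ1, hχ0, heq⟩ := hχ
  have hlim : Tendsto (fun r : ℝ => ENNReal.ofReal (κ * r)) (𝓝[>] (normHhalf Ω α))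
      (𝓝 (ENNReal.ofReal (κ * normHhalf Ω α))) :=
    ((ENNReal.continuous_ofReal.comp (continuous_const.mul continuous_id)).tendsto _).mono_left
      nhdsWithin_le_nhds
  refine ge_of_tendsto hlim (eventually_nhdsWithin_of_forall fun r hr => ?_)
  have hne : {r : ℝ | ∃ (w : E3 → ℝ) (Dw : E3 → E3), HasTrace Ω w Dw α ∧
      r = normH1 Ω w Dw}.Nonempty := by
    obtain ⟨w, Dw, hw⟩ := hα
    exact ⟨_, w, Dw, hw, rfl⟩
  obtain ⟨_, ⟨w, Dw, hw, rfl⟩, hlt⟩ := exists_lt_of_csInf_lt hne hr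
  have hr0 : 0 < r := (Real.sqrt_nonneg _).trans_lt hlt
  have hDw : lpn Ω 2 Dw ≤ r := by
    refine le_trans (Real.le_sqrt_of_sq_le ?_) hlt.le
    rw [integral_norm_sq_eq hw.1.memLp_grad]
    linarith [sq_nonneg (⨍ x, w x ∂(vol Ω))]
  have hav : |⨍ x, w x ∂(vol Ω)| ≤ r := by
    refine le_trans (Real.le_sqrt_of_sq_le ?_) hlt.le
    rw [integral_norm_sq_eq hw.1.memLp_grad, sq_abs]
    linarith [sq_nonneg (lpn Ω 2 Dw)]
  have hup := h w χ Dw Dχ α r hr0 hw hDw hav hχ1 hχ0 heq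
  have hlow := h (fun x => -w x) (fun x => -χ x) (fun x => -Dw x) (fun x => -Dχ x) (fun x => -α x) r
    hr0 hw.neg (by rw [lpn]; exact (congrArg ENNReal.toReal (eLpNorm_neg Dw 2 (vol Ω))).trans_le hDw)
    (by simpa [average_eq, integral_neg] using hav) hχ1.neg (by rw [integral_neg, hχ0, neg_zero])
    (fun ψ Dψ g hg => by
      have := heq ψ Dψ g hg
      simp only [inner_neg_left, integral_neg, neg_div, neg_mul]
      linarith)
  rw [eLpNorm_exponent_top]
  refine eLpNormEssSup_le_of_ae_bound ?_
  filter_upwards [hup, hlow] with x h1 h2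
  rw [Real.norm_eq_abs, abs_le]
  exact ⟨by linarith, h1⟩

/-! ### The Sobolev constant -/

/-- The constant `σ` exists. The `1` added to the Sobolev constant of Mathlib makes it positive. -/
theorem exists_isSobolevBound {Ω : Set E3} (hΩ : IsSmoothBoundedDomain Ω) :
    ∃ σ : ℝ, 0 < σ ∧ IsSobolevBound Ω σ := by
  set C := eLpNormLESNormFDerivOfLeConst ℝ (volume : Measure E3) Ω 2 3 with hC
  refine ⟨C + 1, by positivity, fun u Du hu => ?_⟩
  obtain ⟨hu1, f, hf, hl⟩ := hu
  have hbound : ∀ n, eLpNorm (f n) 3 (vol Ω) ≤ C * eLpNorm (gradient (f n)) 2 (vol Ω) := by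
    intro n
    obtain ⟨h1, h2, h3⟩ := hf n
    have h := eLpNorm_le_eLpNorm_fderiv_of_le (volume : Measure E3) (u := f n) (s := Ω)
      (p := 2) (q := 3) (h1.of_le (by simp)) ((subset_tsupport _).trans h3) (by norm_num)
      (by simp; norm_num) (by simp; norm_num) hΩ.isBounded
    have e : eLpNorm (fderiv ℝ (f n)) 2 volume = eLpNorm (gradient (f n)) 2 volume :=
      eLpNorm_congr_norm_ae (Eventually.of_forall fun x => (norm_gradient _ x).symm)
    have e2 : eLpNorm (gradient (f n)) 2 volume = eLpNorm (gradient (f n)) 2 (vol Ω) := by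
      rw [vol, eLpNorm_restrict_eq_of_support_subset]
      intro x hx
      by_contra hxΩ
      exact hx (gradient_eq_zero_of_notMem_tsupport fun h => hxΩ (h3 h))
    refine (eLpNorm_mono_measure _ Measure.restrict_le_self).trans (h.trans (le_of_eq ?_))
    rw [← e2, ← e]
    norm_cast
  have hlim := TendstoL2.eLpNorm_le (f := f) hl.1
    (fun n => (hf n).1.continuous.aestronglyMeasurable) hu1.memLp.1
    (ENNReal.Tendsto.const_mul (tendsto_eLpNorm_grad hΩ (fun n => (hf n).1) hl hu1)
      (Or.inr ENNReal.coe_ne_top)) hbound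
  refine hlim.trans (mul_le_mul_left ?_ _)
  rw [← ENNReal.ofReal_coe_nnreal]
  exact ENNReal.ofReal_le_ofReal (by linarith)

/-! ### Existence of Neumann potentials -/

/-- Functions that are smooth on the whole space. -/
def smoothFunctions : Submodule ℝ (E3 → ℝ) where
  carrier := {f | ContDiff ℝ ∞ f}
  add_mem' hf hg := Set.mem_ofPred.2 ((Set.mem_ofPred.1 hf).add (Set.mem_ofPred.1 hg))
  zero_mem' := Set.mem_ofPred.2 contDiff_const
  smul_mem' c _ hf := Set.mem_ofPred.2 ((Set.mem_ofPred.1 hf).const_smul c)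

theorem mem_smoothFunctions {f : E3 → ℝ} : f ∈ smoothFunctions ↔ ContDiff ℝ ∞ f := Iff.rfl

theorem contDiff_coe (f : smoothFunctions) : ContDiff ℝ ∞ f.1 := mem_smoothFunctions.1 f.2

/-- The gradient of a smooth function, as an element of `L²(Ω)`. -/
def gradientLp {Ω : Set E3} (hΩ : IsSmoothBoundedDomain Ω) :
    smoothFunctions →ₗ[ℝ] Lp E3 2 (vol Ω) where
  toFun f := (memLp_vol hΩ (continuous_gradient (contDiff_coe f)) 2).toLp (gradient f.1)
  map_add' f g := by
    rw [← MemLp.toLp_add]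
    exact MemLp.toLp_congr _ _ (Eventually.of_forall fun x =>
      gradient_add (contDiff_coe f) (contDiff_coe g) x)
  map_smul' c f := by
    rw [RingHom.id_apply, ← MemLp.toLp_const_smul]
    exact MemLp.toLp_congr _ _ (Eventually.of_forall fun x => gradient_const_mul (contDiff_coe f) c x)

/-- Integration against `α` over the boundary, as a linear form on smooth functions. -/
def boundaryForm {Ω : Set E3} (hΩ : IsSmoothBoundedDomain Ω) {α : E3 → ℝ} (hα : MemLp α 2 (surf Ω)) :
    smoothFunctions →ₗ[ℝ] ℝ where
  toFun f := ∫ x, α x * f.1 x ∂(surf Ω)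
  map_add' f g := by
    have h1 : Integrable (fun x => α x * f.1 x) (surf Ω) :=
      hα.integrable_mul (memLp_surf hΩ (contDiff_coe f).continuous)
    have h2 : Integrable (fun x => α x * g.1 x) (surf Ω) :=
      hα.integrable_mul (memLp_surf hΩ (contDiff_coe g).continuous)
    rw [← integral_add h1 h2]
    exact integral_congr_ae (Eventually.of_forall fun x => mul_add _ _ _)
  map_smul' c f := by
    rw [RingHom.id_apply, smul_eq_mul, ← integral_const_mul]
    exact integral_congr_ae (Eventually.of_forall fun x => mul_left_comm _ _ _)

theorem exists_poincare_sub_average {Ω : Set E3} (hΩ : IsSmoothBoundedDomain Ω) :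
    ∃ C : NNReal, ∀ F : E3 → ℝ, ContDiff ℝ ∞ F →
      eLpNorm (fun x => F x - ⨍ y, F y ∂(vol Ω)) 2 (vol Ω) ≤ C * eLpNorm (gradient F) 2 (vol Ω) := by
  have hfin := isFiniteMeasure_vol hΩ
  obtain ⟨C, hC⟩ := exists_poincare hΩ
  refine ⟨C, fun F hF => ?_⟩
  have h := hC _ (hF.sub (contDiff_const (c := ⨍ y, F y ∂(vol Ω))))
  have e : ⨍ x, (F x - ⨍ y, F y ∂(vol Ω)) ∂(vol Ω) = 0 := by
    rw [average_eq, integral_sub_average, smul_zero]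
  have e2 : gradient (fun x => F x - ⨍ y, F y ∂(vol Ω)) = gradient F :=
    funext fun x => gradient_sub_const _ _ _
  rwa [e, e2, enorm_zero, add_zero] at h

/-- As `α` has mean zero, `f` may be replaced by `f` minus its average over `Ω`, to which the
Poincaré inequality applies. -/
theorem exists_abs_boundaryForm_le {Ω : Set E3} (hΩ : IsSmoothBoundedDomain Ω) {α : E3 → ℝ}
    (hα : MemLp α 2 (surf Ω)) (h0 : ∫ x, α x ∂(surf Ω) = 0) :
    ∃ C : NNReal, ∀ f, ‖boundaryForm hΩ hα f‖ ≤ C * ‖gradientLp hΩ f‖ := by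
  have hfin := isFiniteMeasure_vol hΩ
  have hfins := isFiniteMeasure_surf hΩ
  obtain ⟨C1, h1⟩ := exists_poincare_sub_average hΩ
  obtain ⟨C2, h2⟩ := exists_trace_inequality_two hΩ
  refine ⟨(eLpNorm α 2 (surf Ω)).toNNReal * (C2 * (C1 + 1)), fun f => ?_⟩
  set c := ⨍ y, f.1 y ∂(vol Ω) with hc
  have hsm : ContDiff ℝ ∞ (fun x => f.1 x - c) := (contDiff_coe f).sub contDiff_const
  have e2 : gradient (fun x => f.1 x - c) = gradient f.1 := funext fun x => gradient_sub_const _ _ _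
  have hint := hα.integrable (by norm_num : (1 : ℝ≥0∞) ≤ 2)
  have e1 : boundaryForm hΩ hα f = ∫ x, α x * (f.1 x - c) ∂(surf Ω) := by
    simp only [mul_sub]
    have hi : Integrable (fun x => α x * f.1 x) (surf Ω) :=
      hα.integrable_mul (memLp_surf hΩ (contDiff_coe f).continuous)
    rw [integral_sub hi (hint.mul_const c),
      integral_mul_const, h0, zero_mul, sub_zero]
    rfl
  have h3 : ‖boundaryForm hΩ hα f‖ₑ ≤
      eLpNorm α 2 (surf Ω) * (C2 * ((C1 + 1) * eLpNorm (gradient f.1) 2 (vol Ω))) := by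
    rw [e1]
    refine (enorm_integral_le_lintegral_enorm _).trans ?_
    simp only [enorm_mul]
    have hm2 := memLp_surf hΩ hsm.continuous
    have hh := ENNReal.lintegral_mul_le_Lp_mul_Lq (surf Ω) Real.HolderConjugate.two_two
      hα.1.enorm hm2.1.enorm
    rw [lintegral_rpow_two_eq, lintegral_rpow_two_eq] at hh
    refine hh.trans (mul_le_mul_right ((h2 _ hsm).trans (mul_le_mul_right ?_ _)) _)
    rw [e2, add_mul, one_mul]
    exact add_le_add_left (h1 _ (contDiff_coe f)) _
  have e3 : ‖gradientLp hΩ f‖ₑ = eLpNorm (gradient f.1) 2 (vol Ω) :=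
    Lp.enorm_toLp (memLp_vol hΩ (continuous_gradient (contDiff_coe f)) 2)
  rw [← e3] at h3
  have h4 := ENNReal.toReal_mono (ENNReal.mul_ne_top hα.2.ne (ENNReal.mul_ne_top ENNReal.coe_ne_top
    (ENNReal.mul_ne_top (by simp) enorm_ne_top))) h3
  simp only [ENNReal.toReal_mul, toReal_enorm, ENNReal.coe_toReal,
    ENNReal.toReal_add (ENNReal.coe_ne_top (r := C1)) ENNReal.one_ne_top, ENNReal.toReal_one] at h4
  push_cast
  rw [mul_assoc, mul_assoc]
  exact h4

/-- The Neumann problem is solvable for data of mean zero. Riesz' theorem in the closure of the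
gradients in `L²(Ω)` yields a field `V` there; gradients that converge to `V` come from functions of
mean zero, which converge by the Poincaré inequality. -/
theorem exists_isNeumannPotential {Ω : Set E3} (hΩ : IsSmoothBoundedDomain Ω) {α : E3 → ℝ}
    (hα : MemLp α 2 (surf Ω)) (h0 : ∫ x, α x ∂(surf Ω) = 0) :
    ∃ χ : E3 → ℝ, IsNeumannPotential Ω α χ := by
  have hfin := isFiniteMeasure_vol hΩ
  obtain ⟨C, hC⟩ := exists_abs_boundaryForm_le hΩ hα h0
  set K := (LinearMap.range (gradientLp hΩ)).topologicalClosure with hK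
  have hKc : IsClosed (K : Set (Lp E3 2 (vol Ω))) := Submodule.isClosed_topologicalClosure _
  have : CompleteSpace K := hKc.completeSpace_coe
  have hmem : ∀ f, gradientLp hΩ f ∈ K := fun f =>
    Submodule.le_topologicalClosure _ (LinearMap.mem_range_self _ f)
  set e : smoothFunctions →ₗ[ℝ] K := (gradientLp hΩ).codRestrict K hmem with he
  have hdense : DenseRange e := by
    intro x
    rw [closure_subtype]
    have h1 : (x : Lp E3 2 (vol Ω)) ∈ closure (LinearMap.range (gradientLp hΩ) : Set _) := x.2
    refine closure_mono ?_ h1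
    rintro _ ⟨f, rfl⟩
    exact ⟨e f, ⟨f, rfl⟩, rfl⟩
  have hb : ∃ C : ℝ, ∀ f, ‖boundaryForm hΩ hα f‖ ≤ C * ‖e f‖ := ⟨C, hC⟩
  set ℓ : StrongDual ℝ K := (boundaryForm hΩ hα).extendOfNorm e with hℓ
  have hℓe : ∀ f, ℓ (e f) = boundaryForm hΩ hα f := fun f =>
    LinearMap.extendOfNorm_eq hdense hb f
  set V : K := (InnerProductSpace.toDual ℝ K).symm ℓ with hV
  have hVe : ∀ f : smoothFunctions, ∫ x, inner ℝ ((V : Lp E3 2 (vol Ω)) x) (gradient f.1 x) ∂(vol Ω) =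
      ∫ x, α x * f.1 x ∂(surf Ω) := by
    intro f
    have h1 : inner ℝ V (e f) = ℓ (e f) := InnerProductSpace.toDual_symm_apply
    rw [hℓe, Submodule.coe_inner, L2.inner_def] at h1
    refine Eq.trans (integral_congr_ae ?_) h1
    have h2 := (memLp_vol hΩ (continuous_gradient (contDiff_coe f)) 2).coeFn_toLp
    filter_upwards [h2] with x hx
    change _ = inner ℝ _ (((memLp_vol hΩ (continuous_gradient (contDiff_coe f)) 2).toLp (gradient f.1)) x)
    rw [hx]
  have hVm : MemLp (V : Lp E3 2 (vol Ω)) 2 (vol Ω) := Lp.memLp _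
  have hseq : ∃ f : ℕ → smoothFunctions,
      TendstoL2 (vol Ω) (fun n => gradient (f n).1) (V : Lp E3 2 (vol Ω)) := by
    have h1 : (V : Lp E3 2 (vol Ω)) ∈ closure (LinearMap.range (gradientLp hΩ) : Set _) := V.2
    obtain ⟨y, hy, hlim⟩ := mem_closure_iff_seq_limit.1 h1
    choose f hf using hy
    refine ⟨f, ?_⟩
    have h2 : Tendsto (fun n => gradientLp hΩ (f n)) atTop (𝓝 (V : Lp E3 2 (vol Ω))) := by
      simpa only [hf] using hlim
    have h3 := (Lp.tendsto_Lp_iff_tendsto_eLpNorm' _ _).1 h2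
    refine h3.congr fun n => eLpNorm_congr_ae ?_
    filter_upwards [(memLp_vol hΩ (continuous_gradient (contDiff_coe (f n))) 2).coeFn_toLp] with x hx
    rw [Pi.sub_apply]
    exact congrArg (· - _) hx
  obtain ⟨f, hf⟩ := hseq
  set h : ℕ → E3 → ℝ := fun n x => (f n).1 x - ⨍ y, (f n).1 y ∂(vol Ω) with hh
  have hsm : ∀ n, ContDiff ℝ ∞ (h n) := fun n => (contDiff_coe (f n)).sub contDiff_const
  have hgr : ∀ n, gradient (h n) = gradient (f n).1 := fun n =>
    funext fun x => gradient_sub_const _ _ _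
  have hh0 : ∀ n, ∫ x, h n x ∂(vol Ω) = 0 := fun n => integral_sub_average _ _
  have hl2 : TendstoL2 (vol Ω) (fun n => gradient (h n)) (V : Lp E3 2 (vol Ω)) := by
    simpa only [hgr] using hf
  have hgm : ∀ n, MemLp (gradient (h n)) 2 (vol Ω) :=
    fun n => memLp_vol hΩ (continuous_gradient (hsm n)) 2
  have hhm : ∀ n, MemLp (h n) 2 (vol Ω) := fun n => memLp_vol hΩ (hsm n).continuous 2
  obtain ⟨C1, hC1⟩ := exists_poincare hΩ
  have hB := ENNReal.Tendsto.const_mul hl2 (a := (C1 : ℝ≥0∞)) (Or.inr ENNReal.coe_ne_top)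
  rw [mul_zero] at hB
  obtain ⟨χ, hχm, hχ⟩ := exists_tendstoL2 hhm hB fun n m => by
    have h1 := hC1 _ ((hsm n).sub (hsm m))
    have h2 : ⨍ x, (h n x - h m x) ∂(vol Ω) = 0 := by
      rw [average_eq, integral_sub ((hhm n).integrable (by norm_num)) ((hhm m).integrable (by norm_num)),
        hh0, hh0, sub_zero, smul_zero]
    have h3 : gradient (fun x => h n x - h m x) =
        (fun x => gradient (h n) x - (V : Lp E3 2 (vol Ω)) x) -
          fun x => gradient (h m) x - (V : Lp E3 2 (vol Ω)) x := by
      ext1 x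
      rw [gradient_sub (hsm n) (hsm m), Pi.sub_apply]
      abel
    rw [h2, h3, enorm_zero, add_zero] at h1
    refine h1.trans ?_
    rw [← mul_add]
    exact mul_le_mul_right (eLpNorm_sub_le ((hgm n).sub hVm).1 ((hgm m).sub hVm).1 (by norm_num)) _
  refine ⟨χ, V, memH1_of_tendstoH1 hΩ hsm ⟨hχ, hl2⟩ hχm hVm, ?_, fun ψ Dψ g hψ => ?_⟩
  · have h1 := tendsto_integral_of_tendstoL2 hχ hhm hχm
    simp only [hh0] at h1
    exact (tendsto_nhds_unique h1 tendsto_const_nhds)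
  · simp only [h0, zero_div, zero_mul, integral_zero, add_zero]
    obtain ⟨hψ1, hg, p, hp, hpl, hpt⟩ := hψ
    have t1 := tendsto_integral_inner (tendstoL2_const (μ := vol Ω) (V : Lp E3 2 (vol Ω)))
      (g := fun n => gradient (p n)) hpl.2 (fun _ => hVm)
      hVm (fun n => memLp_vol hΩ (continuous_gradient (hp n)) 2) hψ1.memLp_grad
    have t2 := tendsto_integral_mul (tendstoL2_const (μ := surf Ω) α) (g := p) hpt (fun _ => hα) hα
      (fun n => memLp_surf hΩ (hp n).continuous) hg
    refine tendsto_nhds_unique t1 (t2.congr fun n => ?_)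
    exact (hVe ⟨p n, mem_smoothFunctions.2 (hp n)⟩).symm

/-! ### Nonexistence -/

theorem holderTriple_six_six_three : ENNReal.HolderTriple 6 6 3 := by
  constructor
  have h : (6 : ℝ≥0∞) = 2 * 3 := by norm_num
  rw [h, ENNReal.mul_inv (by simp) (by simp), ← add_mul, ENNReal.inv_two_add_inv_two, one_mul]

theorem holderTriple_six_three_two : ENNReal.HolderTriple 6 3 2 := by
  constructor
  rw [← ENNReal.toReal_eq_toReal_iff' (by simp) (by simp), ENNReal.toReal_add (by simp) (by simp)]
  simp only [ENNReal.toReal_inv, ENNReal.toReal_ofNat]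
  norm_num

theorem lpn_mul_le {Ω : Set E3} {q u : E3 → ℝ} (hq : MemLp q 6 (vol Ω)) (hu : MemLp u 3 (vol Ω)) :
    lpn Ω 2 (fun x => q x * u x) ≤ lpn Ω 6 q * lpn Ω 3 u := by
  have := holderTriple_six_three_two
  have h : eLpNorm (q • u) 2 (vol Ω) ≤ eLpNorm q 6 (vol Ω) * eLpNorm u 3 (vol Ω) :=
    eLpNorm_smul_le_mul_eLpNorm hu.1 hq.1
  rw [lpn, lpn, lpn, ← ENNReal.toReal_mul]
  exact ENNReal.toReal_mono (ENNReal.mul_ne_top hq.2.ne hu.2.ne) h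

/-- A Neumann potential bounded by `b` controls `‖∇u‖₂` for every weak solution `(u, φ)`. -/
theorem IsWeakSolution.exists_energy_le {Ω : Set E3} (hΩ : IsSmoothBoundedDomain Ω) {m : ℝ}
    {q α u φ χ : E3 → ℝ} (hq : MemLp q 6 (vol Ω)) (hχ : IsNeumannPotential Ω α χ)
    (h0 : ∫ x, α x ∂(surf Ω) = 0) {b : ℝ} (hb : ∀ᵐ x ∂(vol Ω), |χ x| ≤ b)
    (h : IsWeakSolution Ω m q α u φ) :
    ∃ Du, MemH10 Ω u Du ∧ lpn Ω 2 Du ^ 2 ≤ b ^ 2 * (lpn Ω 6 q * lpn Ω 3 u) ^ 2 := by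
  have hfin := isFiniteMeasure_vol hΩ
  obtain ⟨Du, Dφ, hu, hφ, eq1, eq2⟩ := h
  obtain ⟨Dχ, hχ1, -, eq3⟩ := hχ
  refine ⟨Du, hu, ?_⟩
  have := holderTriple_six_six_three
  have := holderTriple_six_three_two
  have hu6 := hu.1.memLp_six hΩ
  have hu3 : MemLp u 3 (vol Ω) := hu6.mono_exponent (by norm_num)
  have hqu : MemLp (fun x => q x * u x) 2 (vol Ω) := hu3.mul hq
  have hqu3 : MemLp (fun x => q x * u x) 3 (vol Ω) := hu6.mul hq
  have hmul : ∀ {w : E3 → ℝ} {Dw : E3 → E3}, MemH1 Ω w Dw →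
      MemLp (fun x => q x * u x * w x) 2 (vol Ω) := fun hw => by
    have h1 : MemLp (fun x => _ * (q x * u x)) 2 (vol Ω) := hqu3.mul (hw.memLp_six hΩ)
    simpa only [mul_comm] using h1
  have hP := hmul hφ
  have hQ := hmul hχ1
  set P := ∫ x, (q x * u x * φ x) ^ 2 ∂(vol Ω) with hPdef
  set Q := ∫ x, (q x * u x * χ x) ^ 2 ∂(vol Ω) with hQdef
  -- the first equation, tested with `u`
  have s1 : lpn Ω 2 Du ^ 2 ≤ P := by
    have h1 := eq1 u Du hu
    have e : ∀ x, (m ^ 2 * u x - (q x * φ x) ^ 2 * u x) * u x =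
        m ^ 2 * u x ^ 2 - (q x * u x * φ x) ^ 2 := fun x => by ring
    simp only [e, real_inner_self_eq_norm_sq] at h1
    rw [integral_norm_sq_eq hu.1.memLp_grad,
      integral_sub (hu.1.memLp.integrable_sq.const_mul _) hP.integrable_sq,
      integral_const_mul] at h1
    have h2 : 0 ≤ m ^ 2 * ∫ x, u x ^ 2 ∂(vol Ω) := by positivity
    linarith
  -- the second equation and that of `χ`, tested with `φ - χ`
  have s2 : P ≤ Q := by
    have hη := hφ.sub hΩ hχ1
    obtain ⟨g, hg⟩ := hη.exists_hasTrace hΩ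
    have h1 := eq2 _ _ g hg
    have h2 := eq3 _ _ g hg
    simp only [h0, zero_div, zero_mul, integral_zero, add_zero] at h2
    have h3 : 0 ≤ ∫ x, inner ℝ (Dφ x) (Dφ x - Dχ x) ∂(vol Ω) -
        ∫ x, inner ℝ (Dχ x) (Dφ x - Dχ x) ∂(vol Ω) := by
      rw [← integral_sub (integrable_inner_of_memLp hφ.memLp_grad hη.memLp_grad)
        (integrable_inner_of_memLp hχ1.memLp_grad hη.memLp_grad)]
      refine integral_nonneg fun x => ?_
      simp only [← inner_sub_left, real_inner_self_eq_norm_sq]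
      positivity
    have h4 : ∫ x, ((q x * u x * φ x) ^ 2 - (q x * u x * χ x) ^ 2) / 2 ∂(vol Ω) ≤
        ∫ x, (q x * u x) ^ 2 * φ x * (φ x - χ x) ∂(vol Ω) := by
      refine integral_mono ((hP.integrable_sq.sub hQ.integrable_sq).div_const 2) ?_ fun x => ?_
      · refine (hP.integrable_sq.sub (hP.integrable_mul hQ)).congr (Eventually.of_forall fun x => ?_)
        simp only [Pi.sub_apply, Pi.mul_apply]
        ring
      · simp only
        nlinarith [sq_nonneg (q x * u x * φ x - q x * u x * χ x)]
    rw [integral_div, integral_sub hP.integrable_sq hQ.integrable_sq] at h4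
    linarith
  have s3 : Q ≤ b ^ 2 * lpn Ω 2 (fun x => q x * u x) ^ 2 := by
    rw [← integral_norm_sq_eq hqu, ← integral_const_mul]
    refine integral_mono_ae hQ.integrable_sq
      ((hqu.integrable_norm_pow (by norm_num)).const_mul _) ?_
    filter_upwards [hb] with x hx
    have h1 : χ x ^ 2 ≤ b ^ 2 := by
      rw [← sq_abs]
      gcongr
    simp only [Real.norm_eq_abs, sq_abs]
    rw [mul_pow, mul_comm]
    gcongr
  have s4 := lpn_mul_le hq hu3
  calc lpn Ω 2 Du ^ 2 ≤ Q := s1.trans s2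
    _ ≤ b ^ 2 * lpn Ω 2 (fun x => q x * u x) ^ 2 := s3
    _ ≤ _ := by
      have := lpn_nonneg (Ω := Ω) 2 (fun x => q x * u x)
      gcongr

theorem normHhalf_nonneg (Ω : Set E3) (α : E3 → ℝ) : 0 ≤ normHhalf Ω α :=
  Real.sInf_nonneg (by rintro _ ⟨w, Dw, -, rfl⟩; exact Real.sqrt_nonneg _)

/-- Nonexistence, for given constants `κ` and `σ`. -/
theorem IsWeakSolution.eq_zero {Ω : Set E3} (hΩ : IsSmoothBoundedDomain Ω) {m κ σ : ℝ}
    {q α u φ : E3 → ℝ} (hκ : 0 < κ) (hσ : 0 < σ) (hκΩ : IsNeumannBound Ω κ) (hσΩ : IsSobolevBound Ω σ)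
    (hq : MemLp q 6 (vol Ω)) (hα : MemHhalf Ω α) (h0 : ∫ x, α x ∂(surf Ω) = 0)
    (hsmall : (eLpNorm q 6 (vol Ω)).toReal * normHhalf Ω α < 1 / (κ * σ))
    (h : IsWeakSolution Ω m q α u φ) : u =ᵐ[vol Ω] 0 := by
  obtain ⟨w, Dw, hw⟩ := id hα
  obtain ⟨χ, hχ⟩ := exists_isNeumannPotential hΩ hw.2.1 h0
  set N := normHhalf Ω α with hN
  have hN0 : 0 ≤ N := normHhalf_nonneg Ω α
  have hb : ∀ᵐ x ∂(vol Ω), |χ x| ≤ κ * N := by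
    have h1 := hκΩ α χ hα hχ
    rw [eLpNorm_exponent_top] at h1
    filter_upwards [enorm_ae_le_eLpNormEssSup χ (vol Ω)] with x hx
    have h2 := hx.trans h1
    rw [Real.enorm_eq_ofReal_abs] at h2
    exact (ENNReal.ofReal_le_ofReal_iff (by positivity)).1 h2
  obtain ⟨Du, hu, hle⟩ := h.exists_energy_le hΩ hq hχ h0 hb
  have hS := hσΩ u Du hu
  have hDut := hu.1.memLp_grad.2.ne
  have hS' : lpn Ω 3 u ≤ σ * lpn Ω 2 Du := by
    have h1 := ENNReal.toReal_mono (ENNReal.mul_ne_top ENNReal.ofReal_ne_top hDut) hS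
    rwa [ENNReal.toReal_mul, ENNReal.toReal_ofReal hσ.le] at h1
  set d := lpn Ω 2 Du with hd
  set Q := lpn Ω 6 q with hQ
  have hd0 : 0 ≤ d := lpn_nonneg _ _
  have hQ0 : 0 ≤ Q := lpn_nonneg _ _
  set t := κ * N * (Q * σ) with ht
  have ht0 : 0 ≤ t := by positivity
  have ht1 : t < 1 := by
    have h1 : Q * N * (κ * σ) < 1 := (lt_div_iff₀ (by positivity)).1 hsmall
    calc t = Q * N * (κ * σ) := by rw [ht]; ring
      _ < 1 := h1
  have h1 : d ^ 2 ≤ t ^ 2 * d ^ 2 := by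
    calc d ^ 2 ≤ (κ * N) ^ 2 * (Q * lpn Ω 3 u) ^ 2 := hle
      _ ≤ (κ * N) ^ 2 * (Q * (σ * d)) ^ 2 := by
        have := lpn_nonneg (Ω := Ω) 3 u
        gcongr
      _ = _ := by rw [ht]; ring
  have h2 : t ^ 2 < 1 := pow_lt_one₀ ht0 ht1 (by norm_num)
  have h3 : d = 0 := by
    by_contra hne
    have : 0 < d ^ 2 := by positivity
    nlinarith
  have h4 : eLpNorm Du 2 (vol Ω) = 0 := by
    have := (ENNReal.toReal_eq_zero_iff _).1 h3
    exact this.resolve_right hDut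
  rw [h4, mul_zero, nonpos_iff_eq_zero] at hS
  exact (eLpNorm_eq_zero_iff hu.1.memLp.1 (by norm_num)).1 hS

end KGM

end

theorem theorem2 (Ω : Set KGM.E3) (hΩ : KGM.IsSmoothBoundedDomain Ω) :
    (∃ δ : ℝ, 0 < δ ∧ KGM.IsThreshold Ω δ) ∧
    ∀ δ : ℝ, KGM.IsThreshold Ω δ →
      ∀ (m : ℝ) (q α : KGM.E3 → ℝ),
        MemLp q 6 (KGM.vol Ω) → ¬ (q =ᵐ[KGM.vol Ω] 0) →
        KGM.MemHhalf Ω α →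
        ∫ x, α x ∂(KGM.surf Ω) = 0 →
        (eLpNorm q 6 (KGM.vol Ω)).toReal * KGM.normHhalf Ω α < δ →
        ∀ u φ : KGM.E3 → ℝ, KGM.IsWeakSolution Ω m q α u φ → u =ᵐ[KGM.vol Ω] 0 := by
  obtain ⟨κ, hκ, hκΩ⟩ := KGM.exists_isNeumannBound hΩ
  obtain ⟨σ, hσ, hσΩ⟩ := KGM.exists_isSobolevBound hΩ
  refine ⟨⟨1 / (κ * σ), by positivity, κ, σ, hκ, hσ, hκΩ, hσΩ, rfl⟩, ?_⟩
  rintro _ ⟨κ, σ, hκ, hσ, hκΩ, hσΩ, rfl⟩ m q α hq - hα h0 hsmall u φ h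
  exact h.eq_zero hΩ hκ hσ hκΩ hσΩ hq hα h0 hsmall
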